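/- Let $\mathbb K\in\{\mathbb R,\mathbb C\}$ and let $f\in C^\infty(\mathbb R)$ satisfy $f'(\pm1)=0$, $f''(\pm1)>0$, $f(-1)=f(1)$ and $f>f(1)$ on $(-1,1)$. Let $\theta_0\in C^2(\mathbb R)$ be the optimal profile, i.e. the solution of $-\theta_0''+f'(\theta_0)=0$, $\theta_0(0)=0$, $\lim_{z\to\pm\infty}\theta_0(z)=\pm1$. **Setting.** Let $\delta>0$, $\tilde\delta\in(0,\tfrac34\delta]$ and $\overline C_0,c_1,C_2,C_3,C_4>0$. Let $J\in C^2([-\delta,\delta])$ with $J\ge c_1$ and $|J|,|J'|,|J''|\le C_2$. Let $\theta_1\in L^\infty(\mathbb R)$ with $\|\theta_1\|_\infty\le C_4$ and $$\int_{\mathbb R} f'''(\theta_0)\,(\theta_0')^2\,\theta_1\,dz=0 .$$ For $\varepsilon>0$ let $h_\varepsilon\in C^2([-\delta,\delta])$ with $|h_\varepsilon|,|h_\varepsilon'|,|h_\varepsilon''|\le\overline C_0$, let $p_\varepsilon\in\mathbb R$, and let $q_\varepsilon:[-\delta,\delta]\to\mathbb R$ be measurable with $|p_\varepsilon|+\frac{\varepsilon}{\varepsilon+|r|}|q_\varepsilon(r)|\le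 C_3$ for all $r\in[-\delta,\delta]$. Put $\rho_\varepsilon(r)=\frac1\varepsilon(r-\varepsilon h_\varepsilon(r))$ on $[-\delta,\delta]$, $F_\varepsilon=\rho_\varepsilon^{-1}$, $J_\varepsilon=J\circ F_\varepsilon$, $I_{\varepsilon,\tilde\delta}=(-\tilde\delta/\varepsilon,\tilde\delta/\varepsilon)$ and $$\phi_\varepsilon(r)=\theta_0(\tfrac r\varepsilon)+\varepsilon p_\varepsilon\theta_1(\tfrac r\varepsilon)+\varepsilon^2q_\varepsilon(r),\qquad r\in[-\delta,\delta].$$ (For $\varepsilon$ small, $\rho_\varepsilon$ is invertible onto its image, which contains $\overline{I_{\varepsilon,\tilde\delta}}$.) On $L^2(I_{\varepsilon,\tilde\delta},\mathbb K)$ let $(\Phi,\Psi)_{J_\varepsilon}=\int_{I_{\varepsilon,\tilde\delta}}\Phi\overline\Psi J_\varepsilon\,dz$, with norm $\|\cdot\|_{J_\varepsilon}$ and orthogonality $\perp_{J_\varepsilon}$. Consider $$L_\varepsilon u=-J_\varepsilon^{-1}(J_\varepsilon u')'+f''(\phi_\varepsilon(\varepsilon\,\cdot))\,u$$ for $u\in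 H^2(I_{\varepsilon,\tilde\delta},\mathbb K)$ with $u'(\pm\tilde\delta/\varepsilon)=0$, and the form $$B_\varepsilon(\Phi,\Psi)=\int_{I_{\varepsilon,\tilde\delta}}\bigl[\Phi'\overline{\Psi'}+f''(\phi_\varepsilon(\varepsilon z))\Phi\overline\Psi\bigr]J_\varepsilon\,dz\qquad\text{on }H^1(I_{\varepsilon,\tilde\delta},\mathbb K).$$ Let $\lambda_\varepsilon^1\le\lambda_\varepsilon^2$ be the first two eigenvalues of $L_\varepsilon$, in increasing order and counted with multiplicity. Let $\Psi_\varepsilon^1$ be the eigenfunction to $\lambda_\varepsilon^1$ that is positive and satisfies $\|\Psi_\varepsilon^1\|_{J_\varepsilon}=1$. Finally, let $\nu_1>0$ be a constant such that for every $\tilde\delta>0$ and all sufficiently small $\varepsilon>0$ (depending on $\tilde\delta$) the second eigenvalue of $-\frac{d^2}{dz^2}+f''(\theta_0)$ on $I_{\varepsilon,\tilde\delta}$ with homogeneous Neumann boundary condition is at least $\nu_1$. **Theorem.** Such a $\nu_1$ exists. For every such $\nu_1$ there are (for fixed $f$ and $\nu_1$) a constant $C>0$ depending only on $\tilde\delta,\overline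 C_0,c_1,C_2,C_3,C_4$ and an $\varepsilon_0>0$ depending only on $\delta,\tilde\delta,\overline C_0,c_1,C_2,C_3,C_4$ such that for all $\varepsilon\in(0,\varepsilon_0]$ the objects $\lambda^1_\varepsilon,\lambda_\varepsilon^2,\Psi_\varepsilon^1$ exist and: 1. $\displaystyle\lambda_\varepsilon^1=\inf_{\Psi\in H^1(I_{\varepsilon,\tilde\delta},\mathbb K),\ \|\Psi\|_{J_\varepsilon}=1}B_\varepsilon(\Psi,\Psi)=B_\varepsilon(\Psi_\varepsilon^1,\Psi_\varepsilon^1)$ and $|\lambda_\varepsilon^1|\le C\varepsilon^2$. 2. With $\beta_\varepsilon=\|\theta_0'\|_{L^2(I_{\varepsilon,\tilde\delta})}^{-1}$ and $\Psi_\varepsilon^R=\Psi_\varepsilon^1-J(0)^{-1/2}\beta_\varepsilon\theta_0'$ one has $\|\Psi_\varepsilon^R\|_{J_\varepsilon}+\|\frac{d}{dz}\Psi_\varepsilon^R\|_{J_\varepsilon}\le C\varepsilon$. 3. $\displaystyle\lambda_\varepsilon^2=\inf_{\Psi\in H^1(I_{\varepsilon,\tilde\delta},\mathbb K),\ \|\Psi\|_{J_\varepsilon}=1,\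 \Psi\perp_{J_\varepsilon}\Psi_\varepsilon^1}B_\varepsilon(\Psi,\Psi)\ \ge\ \nu_2:=\min\Bigl\{\frac{\nu_1}2,\frac{\min\{f''(1),f''(-1)\}}4\Bigr\}>0$. -/

import Mathlib

open MeasureTheory Filter Set
open scoped Topology ContDiff ENNReal ComplexConjugate

namespace AllenCahn

/-- Double-well potential with wells `±1` of equal depth. -/
structure IsDoubleWell (f : ℝ → ℝ) : Prop where
  smooth : ContDiff ℝ ∞ f
  deriv_one : deriv f 1 = 0
  deriv_neg_one : deriv f (-1) = 0
  deriv2_one : 0 < iteratedDeriv 2 f 1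
  deriv2_neg_one : 0 < iteratedDeriv 2 f (-1)
  equal_depth : f (-1) = f 1
  above : ∀ u ∈ Ioo (-1 : ℝ) 1, f 1 < f u

/-- The optimal profile: `-θ₀'' + f'(θ₀) = 0`, `θ₀(0) = 0`, `θ₀(±∞) = ±1`. -/
structure IsOptimalProfile (f θ₀ : ℝ → ℝ) : Prop where
  contDiff : ContDiff ℝ 2 θ₀
  ode : ∀ z, -(iteratedDeriv 2 θ₀ z) + deriv f (θ₀ z) = 0
  zero : θ₀ 0 = 0
  lim_top : Tendsto θ₀ atTop (𝓝 1)
  lim_bot : Tendsto θ₀ atBot (𝓝 (-1))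

section Sobolev

variable {𝕜 : Type*} [RCLike 𝕜]

/-- `v` is the weak derivative of `u` on the open set `I ⊆ ℝ`. -/
def HasWeakDeriv (I : Set ℝ) (u v : ℝ → 𝕜) : Prop :=
  LocallyIntegrableOn u I ∧ LocallyIntegrableOn v I ∧
  ∀ ϕ : ℝ → ℝ, ContDiff ℝ ∞ ϕ → HasCompactSupport ϕ → tsupport ϕ ⊆ I →
    ∫ z in I, ((deriv ϕ z : ℝ) : 𝕜) * u z = -∫ z in I, (ϕ z : 𝕜) * v z

open Classical in
/-- A representative of the weak derivative of `u` on `I` (which is unique almost everywhere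
on `I`); by convention `0` if `u` has no weak derivative. -/
noncomputable def weakDeriv (I : Set ℝ) (u : ℝ → 𝕜) : ℝ → 𝕜 :=
  if h : ∃ v, HasWeakDeriv I u v then h.choose else 0

/-- `u ∈ H¹(I, 𝕜)`. -/
def MemH1 (I : Set ℝ) (u : ℝ → 𝕜) : Prop :=
  MemLp u 2 (volume.restrict I) ∧
    ∃ v, HasWeakDeriv I u v ∧ MemLp v 2 (volume.restrict I)

/-- `u ∈ H²(I, 𝕜)`. -/
def MemH2 (I : Set ℝ) (u : ℝ → 𝕜) : Prop :=
  MemH1 I u ∧ MemH1 I (weakDeriv I u)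

/-- The continuous representative on `[-R, R]` of `v` (an element of `H¹(-R, R)`) vanishes
at both end points. -/
def VanishesAtEnds (R : ℝ) (v : ℝ → 𝕜) : Prop :=
  ∃ g : ℝ → 𝕜, ContinuousOn g (Icc (-R) R) ∧
    (∀ᵐ z ∂(volume.restrict (Ioo (-R) R)), g z = v z) ∧ g (-R) = 0 ∧ g R = 0

/-- `u ∈ H²(-R, R)` with the homogeneous Neumann boundary condition `u'(±R) = 0`. -/
def MemH2N (R : ℝ) (u : ℝ → 𝕜) : Prop :=
  MemH2 (Ioo (-R) R) u ∧ VanishesAtEnds R (weakDeriv (Ioo (-R) R) u)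

/-- The scalar product of `L²((-R, R), 𝕜)` with weight `w`. -/
noncomputable def wInner (R : ℝ) (w : ℝ → ℝ) (u v : ℝ → 𝕜) : 𝕜 :=
  ∫ z in Ioo (-R) R, u z * conj (v z) * (w z : 𝕜)

/-- The norm of `L²((-R, R), 𝕜)` with weight `w`. -/
noncomputable def wNorm (R : ℝ) (w : ℝ → ℝ) (u : ℝ → 𝕜) : ℝ :=
  √(∫ z in Ioo (-R) R, ‖u z‖ ^ 2 * w z)

/-- The differential expression `-w⁻¹ (w u')' + V u` on `(-R, R)`. -/
noncomputable def wOp (R : ℝ) (w V : ℝ → ℝ) (u : ℝ → 𝕜) : ℝ → 𝕜 := fun z =>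
  -((w z : 𝕜)⁻¹ *
      weakDeriv (Ioo (-R) R) (fun y => (w y : 𝕜) * weakDeriv (Ioo (-R) R) u y) z)
    + (V z : 𝕜) * u z

/-- The associated sesquilinear form `∫ (Φ' conj(Ψ') + V Φ conj(Ψ)) w`. -/
noncomputable def wForm (R : ℝ) (w V : ℝ → ℝ) (Φ Ψ : ℝ → 𝕜) : 𝕜 :=
  ∫ z in Ioo (-R) R,
    (weakDeriv (Ioo (-R) R) Φ z * conj (weakDeriv (Ioo (-R) R) Ψ z)
      + (V z : 𝕜) * Φ z * conj (Ψ z)) * (w z : 𝕜)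

/-- `u` is an eigenfunction to the eigenvalue `lam`, normalized in the weighted `L²`-space,
of the operator `-w⁻¹ (w u')' + V u` on `(-R, R)` with Neumann boundary condition. -/
def IsNormalizedEigenfunction (R : ℝ) (w V : ℝ → ℝ) (lam : ℝ) (u : ℝ → 𝕜) : Prop :=
  MemH2N R u ∧ wNorm R w u = 1 ∧
    ∀ᵐ z ∂(volume.restrict (Ioo (-R) R)), wOp R w V u z = (lam : 𝕜) * u z

variable (𝕜) in
/-- `lam` is the `k`-th eigenvalue (`k ≥ 1`), in increasing order and counted with multiplicity:
the least real number `μ` for which there are `k` mutually orthogonal normalized eigenfunctions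
to eigenvalues `≤ μ`. -/
def IsNthEigenvalue (R : ℝ) (w V : ℝ → ℝ) (k : ℕ) (lam : ℝ) : Prop :=
  IsLeast {μ : ℝ | ∃ (u : Fin k → ℝ → 𝕜) (ν : Fin k → ℝ),
    (∀ i, IsNormalizedEigenfunction R w V (ν i) (u i) ∧ ν i ≤ μ) ∧
    ∀ i j, i ≠ j → wInner R w (u i) (u j) = 0} lam

/-- `u` takes positive real values on `(-R, R)`, up to a null set. -/
def IsPositiveOn (R : ℝ) (u : ℝ → 𝕜) : Prop :=
  ∀ᵐ z ∂(volume.restrict (Ioo (-R) R)), 0 < RCLike.re (u z) ∧ RCLike.im (u z) = 0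

variable (𝕜) in
/-- `ν₁ > 0` is a lower bound, for every fixed `δ'` and all small `ε`, for the second eigenvalue
of the unperturbed Neumann operator `-d²/dz² + f''(θ₀)` on `(-δ'/ε, δ'/ε)`. -/
def IsUnperturbedGap (f θ₀ : ℝ → ℝ) (ν₁ : ℝ) : Prop :=
  0 < ν₁ ∧ ∀ δ' : ℝ, 0 < δ' → ∃ ε₀ : ℝ, 0 < ε₀ ∧ ∀ ε ∈ Ioc 0 ε₀,
    ∃ lam : ℝ, IsNthEigenvalue 𝕜 (δ' / ε) (fun _ => 1) (fun z => iteratedDeriv 2 f (θ₀ z)) 2 lam ∧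
      ν₁ ≤ lam

end Sobolev

/-- `g ∈ C²([-δ, δ])` with `|g|, |g'|, |g''| ≤ K`. -/
def C2Bounded (δ K : ℝ) (g : ℝ → ℝ) : Prop :=
  ContDiffOn ℝ 2 g (Icc (-δ) δ) ∧
    ∀ k ≤ 2, ∀ r ∈ Icc (-δ) δ, |iteratedDerivWithin k g (Icc (-δ) δ) r| ≤ K

/-- The stretched variable `ρ_ε(r) = (r - ε h(r)) / ε`. -/
noncomputable def rhoEps (ε : ℝ) (h : ℝ → ℝ) (r : ℝ) : ℝ := (r - ε * h r) / ε

/-- `F_ε`, the inverse of `ρ_ε : [-δ, δ] → ρ_ε([-δ, δ])`. -/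
noncomputable def FEps (δ ε : ℝ) (h : ℝ → ℝ) : ℝ → ℝ :=
  Function.invFunOn (rhoEps ε h) (Icc (-δ) δ)

/-- The weight `J_ε = J ∘ F_ε`. -/
noncomputable def JEps (δ ε : ℝ) (h J : ℝ → ℝ) (z : ℝ) : ℝ := J (FEps δ ε h z)

/-- `φ_ε(r) = θ₀(r/ε) + ε p θ₁(r/ε) + q(r) ε²`. -/
noncomputable def phiEps (θ₀ θ₁ : ℝ → ℝ) (ε p : ℝ) (q : ℝ → ℝ) (r : ℝ) : ℝ :=
  θ₀ (r / ε) + ε * p * θ₁ (r / ε) + q r * ε ^ 2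

end AllenCahn

open AllenCahn

/-! Write g = θ₀', w for the weight, V for the potential and B for the energy form. Differentiating
the profile equation gives -g'' + f''(θ₀) g = 0, and g is positive, so g is nearly a ground state of
the perturbed operator with eigenvalue 0. The proof measures the error of this approximation and
keeps the rest of the spectrum away from 0.

Smallness. Integration by parts turns B(g, y) into boundary terms plus the integral of -w' g' y + (V
- f''(θ₀)) g y w. Both w' and V - f''(θ₀) are O(ε), hence B(g, y) = O(ε) in terms of the H¹ norm of
y (`exists_energy_deriv_profile_le`). For y = g the part of order ε is -ε J'(0) ∫ g' g + ε p J(0) ∫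
f'''(θ₀) g² θ₁. The first integrand is a total derivative, and the second integral over ℝ is zero by
hypothesis, so on the truncated interval both integrals are O(ε). This yields B(g, g) = O(ε²)
(`exists_energy_deriv_profile_self_le`). The remaining errors grow linearly in |z|, which the decay
of g and g' absorbs (`IsOptimalProfile.exists_decay`).

Second eigenvalue. On a fixed large interval (-ρ, ρ) the perturbation is uniformly small and half of
the unperturbed gap survives; outside it the potential is at least a quarter of min f''(±1). Some
combination of the first two eigenfunctions is orthogonal, on (-ρ, ρ), to the unperturbed ground
state; comparing its Rayleigh quotient with both bounds gives λ² ≥ ν₂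
(`IsEigenbasis.le_second_of_bracketing`, `exists_second_eigenvalue_bound`).

First eigenpair. Split g = a e + Φ with e the normalized first eigenfunction and Φ orthogonal to it.
Then B(Φ, Φ) = B(g, Φ), which is O(ε) times the norm of Φ, while the bound on λ² makes B coercive on
Φ; so Φ = O(ε) in H¹. From a² λ¹ = B(g, g) - B(Φ, Φ) follows λ¹ = O(ε²), and e = (g - Φ)/a is
compared with the explicit multiple of g (`exists_first_eigenpair_bound`).

Existence of ν₁. The same bracketing reduces it to one large interval having a positive second
eigenvalue. There, a combination of the first two eigenfunctions that vanishes at 0 would have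
energy ≤ 0, but on each half interval a positive solution of G'' = f''(θ₀) G with outward slope of
the right sign writes the energy as a square plus a nonnegative boundary term
(`IsOptimalProfile.second_pos`).

The spectral theory rests on real absolutely continuous representatives: eigenfunctions come from
the direct method and are then shown to be regular. Since the coefficients are real, functions with
values in 𝕜 are handled through their real and imaginary parts. All that the estimates need to know
about J, h, p, q is collected in `ProfilePerturbation`, whose constant K is fixed before δ. -/

namespace AllenCahn

/-! ### Absolutely continuous functions and real H¹ functions on an interval. -/

section AbsolutelyContinuous

/-- `u` is absolutely continuous on `[a, b]` with almost everywhere derivative `v`. -/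
structure HasACDeriv (a b : ℝ) (u v : ℝ → ℝ) : Prop where
  ac : AbsolutelyContinuousOnInterval u a b
  ae_deriv : ∀ᵐ x, x ∈ Ioo a b → HasDerivAt u (v x) x

variable {a b : ℝ} {u v y z : ℝ → ℝ}

lemma absolutelyContinuousOnInterval_congr (hab : a ≤ b)
    (hu : AbsolutelyContinuousOnInterval u a b) (h : EqOn u y (Icc a b)) :
    AbsolutelyContinuousOnInterval y a b := by
  rw [absolutelyContinuousOnInterval_iff] at hu ⊢
  intro ε hε
  obtain ⟨δ, hδ, H⟩ := hu ε hε
  refine ⟨δ, hδ, fun E hE hEδ => ?_⟩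
  have := H E hE hEδ
  convert this using 1
  refine Finset.sum_congr rfl fun i hi => ?_
  have h1 := hE.1 i hi
  rw [uIcc_of_le hab] at h1
  rw [h h1.1, h h1.2]

namespace HasACDeriv

lemma continuousOn (h : HasACDeriv a b u v) (hab : a ≤ b) : ContinuousOn u (Icc a b) := by
  have := h.ac.continuousOn
  rwa [uIcc_of_le hab] at this

lemma deriv_ae_eq (h : HasACDeriv a b u v) :
    deriv u =ᵐ[volume.restrict (Ioo a b)] v := by
  rw [EventuallyEq, ae_restrict_iff' measurableSet_Ioo]
  filter_upwards [h.ae_deriv] with x hx hxi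
  exact (hx hxi).deriv

lemma integrableOn (h : HasACDeriv a b u v) (hab : a ≤ b) : IntegrableOn v (Ioo a b) := by
  have h1 := h.ac.intervalIntegrable_deriv
  rw [intervalIntegrable_iff_integrableOn_Ioo_of_le hab] at h1
  exact h1.congr h.deriv_ae_eq

lemma setIntegral_eq_sub (h : HasACDeriv a b u v) (hab : a ≤ b) :
    ∫ x in Ioo a b, v x = u b - u a := by
  rw [← h.ac.integral_deriv_eq_sub, intervalIntegral.integral_of_le hab,
    integral_Ioc_eq_integral_Ioo]
  exact (integral_congr_ae h.deriv_ae_eq).symm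

lemma mono (h : HasACDeriv a b u v) {c d : ℝ} (hac : a ≤ c) (hcd : c ≤ d) (hdb : d ≤ b) :
    HasACDeriv c d u v := by
  refine ⟨h.ac.mono ?_, ?_⟩
  · rw [uIcc_of_le hcd, uIcc_of_le (hac.trans (hcd.trans hdb))]
    exact Icc_subset_Icc hac hdb
  · filter_upwards [h.ae_deriv] with x hx hxi
    exact hx ⟨hac.trans_lt hxi.1, hxi.2.trans_le hdb⟩

lemma eq_add_integral (h : HasACDeriv a b u v) {x : ℝ} (hx : x ∈ Icc a b) :
    u x = u a + ∫ t in Ioo a x, v t := by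
  rw [(h.mono le_rfl hx.1 hx.2).setIntegral_eq_sub hx.1]; ring

lemma congr_deriv (h : HasACDeriv a b u v) (hv : v =ᵐ[volume.restrict (Ioo a b)] z) :
    HasACDeriv a b u z := by
  refine ⟨h.ac, ?_⟩
  rw [EventuallyEq, ae_restrict_iff' measurableSet_Ioo] at hv
  filter_upwards [h.ae_deriv, hv] with x hx h2 hxi
  rw [← h2 hxi]; exact hx hxi

lemma congr (h : HasACDeriv a b u v) (hab : a ≤ b) (hu : EqOn u y (Icc a b)) :
    HasACDeriv a b y v := by
  refine ⟨absolutelyContinuousOnInterval_congr hab h.ac hu, ?_⟩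
  filter_upwards [h.ae_deriv] with x hx hxi
  refine (hx hxi).congr_of_eventuallyEq ?_
  filter_upwards [Ioo_mem_nhds hxi.1 hxi.2] with t ht
  exact (hu (Ioo_subset_Icc_self ht)).symm

lemma of_integral (hab : a ≤ b) (hv : IntegrableOn v (Ioo a b)) (C : ℝ) :
    HasACDeriv a b (fun x => C + ∫ t in a..x, v t) v := by
  rw [← intervalIntegrable_iff_integrableOn_Ioo_of_le hab] at hv
  refine ⟨?_, ?_⟩
  · have h1 := hv.absolutelyContinuousOnInterval_intervalIntegral (c := a) left_mem_uIcc
    have h2 : AbsolutelyContinuousOnInterval (fun _ : ℝ => C) a b :=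
      (LipschitzOnWith.absolutelyContinuousOnInterval (K := 0) (by
        intro x _ y _; simp))
    exact h2.add h1
  · filter_upwards [hv.ae_hasDerivAt_integral] with x hx hxi
    have hx' : x ∈ uIcc a b := by rw [uIcc_of_le hab]; exact Ioo_subset_Icc_self hxi
    exact (hx hx' a left_mem_uIcc).const_add C

lemma of_hasDerivAt (hab : a ≤ b) (h : ∀ x ∈ Icc a b, HasDerivAt u (v x) x)
    (hv : ContinuousOn v (Icc a b)) : HasACDeriv a b u v := by
  refine ⟨?_, Eventually.of_forall fun x hx => h x (Ioo_subset_Icc_self hx)⟩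
  obtain ⟨M, hM⟩ := isCompact_Icc.exists_bound_of_continuousOn hv
  refine LipschitzOnWith.absolutelyContinuousOnInterval (K := M.toNNReal) ?_
  rw [uIcc_of_le hab]
  refine (convex_Icc a b).lipschitzOnWith_of_nnnorm_hasDerivWithin_le
    (fun x hx => (h x hx).hasDerivWithinAt) fun x hx => ?_
  rw [← NNReal.coe_le_coe, coe_nnnorm]
  exact (hM x hx).trans (Real.le_coe_toNNReal M)

lemma const (C : ℝ) : HasACDeriv a b (fun _ => C) (fun _ => 0) :=
  ⟨LipschitzOnWith.absolutelyContinuousOnInterval (K := 0) (by intro x _ y _; simp),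
    Eventually.of_forall fun x _ => hasDerivAt_const x C⟩

lemma add (h : HasACDeriv a b u v) (h' : HasACDeriv a b y z) :
    HasACDeriv a b (fun x => u x + y x) (fun x => v x + z x) := by
  refine ⟨h.ac.add h'.ac, ?_⟩
  filter_upwards [h.ae_deriv, h'.ae_deriv] with x h1 h2 hx
  exact (h1 hx).add (h2 hx)

lemma sub (h : HasACDeriv a b u v) (h' : HasACDeriv a b y z) :
    HasACDeriv a b (fun x => u x - y x) (fun x => v x - z x) := by
  refine ⟨h.ac.sub h'.ac, ?_⟩
  filter_upwards [h.ae_deriv, h'.ae_deriv] with x h1 h2 hx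
  exact (h1 hx).sub (h2 hx)

lemma mul (h : HasACDeriv a b u v) (h' : HasACDeriv a b y z) :
    HasACDeriv a b (fun x => u x * y x) (fun x => v x * y x + u x * z x) := by
  refine ⟨h.ac.mul h'.ac, ?_⟩
  filter_upwards [h.ae_deriv, h'.ae_deriv] with x h1 h2 hx
  exact (h1 hx).mul (h2 hx)

lemma const_mul (h : HasACDeriv a b u v) (C : ℝ) :
    HasACDeriv a b (fun x => C * u x) (fun x => C * v x) := by
  refine ⟨h.ac.const_mul C, ?_⟩
  filter_upwards [h.ae_deriv] with x h1 hx
  exact (h1 hx).const_mul C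

lemma abs (h : HasACDeriv a b u v) (hab : a ≤ b) : HasACDeriv a b (fun x => |u x|) (deriv fun x => |u x|) := by
  have hac : AbsolutelyContinuousOnInterval (fun x => |u x|) a b := by
    have hu := h.ac
    rw [absolutelyContinuousOnInterval_iff] at hu ⊢
    intro ε hε
    obtain ⟨δ, hδ, H⟩ := hu ε hε
    refine ⟨δ, hδ, fun E hE hEδ => lt_of_le_of_lt ?_ (H E hE hEδ)⟩
    refine Finset.sum_le_sum fun i hi => ?_
    rw [Real.dist_eq, Real.dist_eq]
    exact abs_abs_sub_abs_le_abs_sub _ _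
  refine ⟨hac, ?_⟩
  filter_upwards [hac.ae_differentiableAt] with x hx hxi
  exact (hx (by rw [uIcc_of_le hab]; exact Ioo_subset_Icc_self hxi)).hasDerivAt

/-- The reverse triangle inequality holds for every difference quotient and passes to the limit.
Needed to see that |u| has no more energy than u. -/
lemma abs_deriv_abs_le (h : HasACDeriv a b u v) (hab : a ≤ b) :
    ∀ᵐ x, x ∈ Ioo a b → |deriv (fun x => |u x|) x| ≤ |v x| := by
  filter_upwards [h.ae_deriv, (h.abs hab).ae_deriv] with x h1 h2 hx
  refine le_of_tendsto_of_tendsto (((hasDerivAt_iff_tendsto_slope.1 (h2 hx))).abs)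
    ((hasDerivAt_iff_tendsto_slope.1 (h1 hx)).abs) ?_
  refine Eventually.of_forall fun t => ?_
  simp only [slope_def_field, abs_div]
  exact div_le_div_of_nonneg_right (abs_abs_sub_abs_le_abs_sub _ _) (abs_nonneg _)

end HasACDeriv

/-- `u ∈ H¹(a, b)`, represented by a function that is continuous on `[a, b]`, with weak
derivative `v`. -/
structure SobolevPair (a b : ℝ) (u v : ℝ → ℝ) : Prop where
  acd : HasACDeriv a b u v
  memLp : MemLp v 2 (volume.restrict (Ioo a b))

lemma memLp_Ioo_of_continuousOn (h : ContinuousOn u (Icc a b)) (p : ℝ≥0∞) :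
    MemLp u p (volume.restrict (Ioo a b)) := by
  obtain ⟨M, hM⟩ := isCompact_Icc.exists_bound_of_continuousOn h
  refine MemLp.of_bound ((h.mono Ioo_subset_Icc_self).aestronglyMeasurable measurableSet_Ioo) M ?_
  exact (ae_restrict_iff' measurableSet_Ioo).2
    (Eventually.of_forall fun x hx => hM x (Ioo_subset_Icc_self hx))

lemma SobolevPair.of_continuousOn (h : HasACDeriv a b u v)
    (hv : ContinuousOn v (Icc a b)) : SobolevPair a b u v :=
  ⟨h, memLp_Ioo_of_continuousOn hv 2⟩

namespace SobolevPair

lemma continuousOn (h : SobolevPair a b u v) (hab : a ≤ b) : ContinuousOn u (Icc a b) :=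
  h.acd.continuousOn hab

lemma memLp_left (h : SobolevPair a b u v) (hab : a ≤ b) :
    MemLp u 2 (volume.restrict (Ioo a b)) := memLp_Ioo_of_continuousOn (h.continuousOn hab) 2

lemma mono (h : SobolevPair a b u v) {c d : ℝ} (hac : a ≤ c) (hcd : c ≤ d) (hdb : d ≤ b) :
    SobolevPair c d u v :=
  ⟨h.acd.mono hac hcd hdb, h.memLp.mono_measure
    (Measure.restrict_mono (Ioo_subset_Ioo hac hdb) le_rfl)⟩

lemma add (h : SobolevPair a b u v) (h' : SobolevPair a b y z) :
    SobolevPair a b (fun x => u x + y x) (fun x => v x + z x) :=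
  ⟨h.acd.add h'.acd, h.memLp.add h'.memLp⟩

lemma sub (h : SobolevPair a b u v) (h' : SobolevPair a b y z) :
    SobolevPair a b (fun x => u x - y x) (fun x => v x - z x) :=
  ⟨h.acd.sub h'.acd, h.memLp.sub h'.memLp⟩

lemma const_mul (h : SobolevPair a b u v) (C : ℝ) :
    SobolevPair a b (fun x => C * u x) (fun x => C * v x) :=
  ⟨h.acd.const_mul C, h.memLp.const_mul C⟩

lemma congr_deriv (h : SobolevPair a b u v) (hv : v =ᵐ[volume.restrict (Ioo a b)] z) :
    SobolevPair a b u z := ⟨h.acd.congr_deriv hv, (memLp_congr_ae hv).1 h.memLp⟩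

lemma abs (h : SobolevPair a b u v) (hab : a ≤ b) :
    SobolevPair a b (fun x => |u x|) (deriv fun x => |u x|) := by
  refine ⟨h.acd.abs hab, h.memLp.of_le (measurable_deriv _).aestronglyMeasurable ?_⟩
  rw [ae_restrict_iff' measurableSet_Ioo]
  exact h.acd.abs_deriv_abs_le hab

/-- Integration by parts. -/
lemma integral_by_parts (hab : a ≤ b) (h : HasACDeriv a b u v) (h' : HasACDeriv a b y z) :
    ∫ x in Ioo a b, (v x * y x + u x * z x) = u b * y b - u a * y a :=
  (h.mul h').setIntegral_eq_sub hab

/-- Fundamental theorem of calculus and Cauchy–Schwarz. This Hölder modulus later provides the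
equicontinuity for the compact embedding. -/
lemma sq_sub_le (h : SobolevPair a b u v) {s t : ℝ} (has : a ≤ s) (hst : s ≤ t) (htb : t ≤ b) :
    (u t - u s) ^ 2 ≤ (t - s) * ∫ x in Ioo a b, v x ^ 2 := by
  have h1 := (h.mono has hst htb)
  rw [← h1.acd.setIntegral_eq_sub hst]
  have hint : IntegrableOn (fun x => v x ^ 2) (Ioo s t) := h1.memLp.integrable_sq
  have h2 : ∫ x in Ioo s t, v x ^ 2 ≤ ∫ x in Ioo a b, v x ^ 2 :=
    setIntegral_mono_set h.memLp.integrable_sq (Eventually.of_forall fun x => sq_nonneg _)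
      (Ioo_subset_Ioo has htb).eventuallyLE
  have h3 : (∫ x in Ioo s t, v x) ^ 2 ≤ (t - s) * ∫ x in Ioo s t, v x ^ 2 := by
    set m := ∫ x in Ioo s t, v x with hm
    have hi := h1.acd.integrableOn hst
    -- Cauchy–Schwarz against the constant 1, by expanding the integral of (v - k)²; the mean value
    -- k = m / (t - s) is the optimal choice.
    have key : ∀ k : ℝ, 0 ≤ (∫ x in Ioo s t, v x ^ 2) - 2 * k * m + k ^ 2 * (t - s) := by
      intro k
      have e : ∫ x in Ioo s t, (v x - k) ^ 2 =
          (∫ x in Ioo s t, v x ^ 2) - 2 * k * m + k ^ 2 * (t - s) := by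
        have : ∀ x, (v x - k) ^ 2 = v x ^ 2 - 2 * k * v x + k ^ 2 := fun x => by ring
        simp_rw [this]
        rw [integral_add, integral_sub, integral_const_mul, integral_const]
        · simp [hst, mul_comm, hm]
        · exact hint
        · exact hi.const_mul _
        · exact hint.sub (hi.const_mul _)
        · exact integrable_const _
      rw [← e]
      exact integral_nonneg fun x => sq_nonneg _
    rcases hst.eq_or_lt with rfl | hlt
    · have : m = 0 := by simp [hm]
      simp [this]
    · have := key (m / (t - s))
      have hpos : 0 < t - s := sub_pos.2 hlt
      have e2 : (∫ x in Ioo s t, v x ^ 2) - 2 * (m / (t - s)) * m + (m / (t - s)) ^ 2 * (t - s)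
          = (∫ x in Ioo s t, v x ^ 2) - m ^ 2 / (t - s) := by
        field_simp; ring
      rw [e2, sub_nonneg, div_le_iff₀ hpos] at this
      linarith
  exact h3.trans (by gcongr)

lemma sq_le_of_one_le (h : SobolevPair a b u v) (hab : 1 ≤ b - a) {t : ℝ} (ht : t ∈ Icc a b) :
    u t ^ 2 ≤ 2 * ((b - a) * ∫ x in Ioo a b, v x ^ 2) + 2 * ∫ x in Ioo a b, u x ^ 2 := by
  have hab' : a ≤ b := by linarith
  have hu2 := (h.memLp_left hab').integrable_sq
  have h1 : ∀ s ∈ Ioo a b, u t ^ 2 - 2 * ((b - a) * ∫ x in Ioo a b, v x ^ 2) ≤ 2 * u s ^ 2 := by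
    intro s hs
    have h0 : 0 ≤ ∫ x in Ioo a b, v x ^ 2 := integral_nonneg fun x => sq_nonneg _
    have : (u t - u s) ^ 2 ≤ (b - a) * ∫ x in Ioo a b, v x ^ 2 := by
      rcases le_total s t with hst | hst
      · exact (h.sq_sub_le hs.1.le hst ht.2).trans (by gcongr <;> linarith [ht.2, hs.1])
      · have := (h.sq_sub_le ht.1 hst hs.2.le).trans
          (show _ ≤ (b - a) * ∫ x in Ioo a b, v x ^ 2 by gcongr <;> linarith [ht.1, hs.2])
        nlinarith
    -- Here (u t - 2 u s)² is exactly 2 (u s)² + 2 (u t - u s)² - (u t)².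
    nlinarith [sq_nonneg (u t - 2 * u s)]
  have h2 := setIntegral_mono_on (s := Ioo a b) (μ := volume)
    (f := fun _ => u t ^ 2 - 2 * ((b - a) * ∫ x in Ioo a b, v x ^ 2)) (g := fun s => 2 * u s ^ 2)
    (integrableOn_const (by simp)) (hu2.const_mul 2) measurableSet_Ioo h1
  rw [integral_const_mul] at h2
  simp only [integral_const, measureReal_restrict_apply_univ, Real.volume_real_Ioo_of_le hab',
    smul_eq_mul] at h2
  have h0 : 0 ≤ ∫ x in Ioo a b, u x ^ 2 := integral_nonneg fun x => sq_nonneg _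
  by_contra hcon
  push Not at hcon
  nlinarith

/-- The trace inequality on intervals of length at least one. -/
lemma sq_le (h : SobolevPair a b u v) (hab : 1 ≤ b - a) {t : ℝ} (ht : t ∈ Icc a b) :
    u t ^ 2 ≤ 2 * (∫ x in Ioo a b, v x ^ 2) + 2 * ∫ x in Ioo a b, u x ^ 2 := by
  -- Localizing to a unit interval around t makes the constant independent of the length, which
  -- grows like 1/ε in the application.
  obtain ⟨c, hac, hcb, htc⟩ : ∃ c, a ≤ c ∧ c + 1 ≤ b ∧ t ∈ Icc c (c + 1) := by
    rcases le_total (t + 1) b with h1 | h1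
    · exact ⟨t, ht.1, h1, le_rfl, by linarith⟩
    · exact ⟨b - 1, by linarith, by linarith, by linarith, by linarith [ht.2]⟩
  have h1 := (h.mono hac (by linarith) hcb).sq_le_of_one_le (by linarith) htc
  have h2 : ∫ x in Ioo c (c + 1), v x ^ 2 ≤ ∫ x in Ioo a b, v x ^ 2 :=
    setIntegral_mono_set h.memLp.integrable_sq (Eventually.of_forall fun x => sq_nonneg _)
      (Ioo_subset_Ioo hac hcb).eventuallyLE
  have h3 : ∫ x in Ioo c (c + 1), u x ^ 2 ≤ ∫ x in Ioo a b, u x ^ 2 :=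
    setIntegral_mono_set (h.memLp_left (by linarith)).integrable_sq
      (Eventually.of_forall fun x => sq_nonneg _) (Ioo_subset_Ioo hac hcb).eventuallyLE
  have e : c + 1 - c = 1 := by ring
  rw [e] at h1
  linarith

end SobolevPair

end AbsolutelyContinuous

/-! ### Weak derivatives and their absolutely continuous representatives. -/

section WeakDerivatives

variable {𝕜 : Type*} [RCLike 𝕜] {a b : ℝ} {I : Set ℝ}

lemma integrableOn_test_mul {v : ℝ → 𝕜} (hv : LocallyIntegrableOn v I) {ϕ : ℝ → ℝ}
    (hϕ : Continuous ϕ) (hc : HasCompactSupport ϕ) (hs : tsupport ϕ ⊆ I) :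
    IntegrableOn (fun x => (ϕ x : 𝕜) * v x) I := by
  have h1 : IntegrableOn (fun x => (ϕ x : 𝕜) * v x) (tsupport ϕ) :=
    (hv.integrableOn_compact_subset hs hc).continuousOn_mul
      (RCLike.continuous_ofReal.comp hϕ).continuousOn hc
  have h2 : Integrable (fun x => (ϕ x : 𝕜) * v x) := by
    rw [← integrableOn_iff_integrable_of_support_subset (s := tsupport ϕ)]
    · exact h1
    · intro x hx
      apply subset_tsupport
      intro h0
      apply hx
      simp [h0]
  exact h2.integrableOn

lemma HasWeakDeriv.ae_eq (hI : IsOpen I) {u v v' : ℝ → 𝕜} (h : HasWeakDeriv I u v)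
    (h' : HasWeakDeriv I u v') : v =ᵐ[volume.restrict I] v' := by
  have key : ∀ᵐ x, x ∈ I → v x - v' x = 0 := by
    refine hI.ae_eq_zero_of_integral_contDiff_smul_eq_zero (h.2.1.sub h'.2.1) ?_
    intro g hg hgc hgs
    have e1 : ∫ x, g x • (v x - v' x) = ∫ x in I, ((g x : 𝕜) * v x - (g x : 𝕜) * v' x) := by
      rw [← setIntegral_eq_integral_of_forall_compl_eq_zero (s := I)]
      · refine integral_congr_ae (Eventually.of_forall fun x => ?_)
        simp only [RCLike.real_smul_eq_coe_mul]
        ring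
      · intro x hx
        rw [image_eq_zero_of_notMem_tsupport (fun h => hx (hgs h)), zero_smul]
    have e2 := h.2.2 g hg hgc hgs
    have e3 := h'.2.2 g hg hgc hgs
    change ∫ x, g x • (v x - v' x) = 0
    rw [e1, integral_sub (integrableOn_test_mul h.2.1 hg.continuous hgc hgs)
      (integrableOn_test_mul h'.2.1 hg.continuous hgc hgs), sub_eq_zero]
    exact neg_injective (e2.symm.trans e3)
  rw [EventuallyEq, ae_restrict_iff' hI.measurableSet]
  filter_upwards [key] with x hx hxI
  exact sub_eq_zero.1 (hx hxI)

lemma HasWeakDeriv.weakDeriv_ae_eq (hI : IsOpen I) {u v : ℝ → 𝕜} (h : HasWeakDeriv I u v) :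
    weakDeriv I u =ᵐ[volume.restrict I] v := by
  have hex : ∃ v, HasWeakDeriv I u v := ⟨v, h⟩
  have : HasWeakDeriv I u (weakDeriv I u) := by
    rw [weakDeriv, dif_pos hex]; exact hex.choose_spec
  exact this.ae_eq hI h

lemma HasWeakDeriv.hasWeakDeriv_weakDeriv {u v : ℝ → 𝕜} (h : HasWeakDeriv I u v) :
    HasWeakDeriv I u (weakDeriv I u) := by
  have hex : ∃ v, HasWeakDeriv I u v := ⟨v, h⟩
  rw [weakDeriv, dif_pos hex]; exact hex.choose_spec

lemma locallyIntegrableOn_congr_ae (hI : IsOpen I) {u y : ℝ → 𝕜} (h : LocallyIntegrableOn u I)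
    (hu : u =ᵐ[volume.restrict I] y) : LocallyIntegrableOn y I := by
  rw [locallyIntegrableOn_iff hI.isLocallyClosed] at h ⊢
  intro K hK hKc
  exact (h K hK hKc).congr (ae_restrict_of_ae_restrict_of_subset hK hu)

lemma HasWeakDeriv.congr (hI : IsOpen I) {u v y z : ℝ → 𝕜} (h : HasWeakDeriv I u v)
    (hu : u =ᵐ[volume.restrict I] y) (hv : v =ᵐ[volume.restrict I] z) : HasWeakDeriv I y z := by
  refine ⟨locallyIntegrableOn_congr_ae hI h.1 hu, locallyIntegrableOn_congr_ae hI h.2.1 hv, ?_⟩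
  intro ϕ h1 h2 h3
  have e := h.2.2 ϕ h1 h2 h3
  have e1 : ∫ z in I, ((deriv ϕ z : ℝ) : 𝕜) * u z = ∫ z in I, ((deriv ϕ z : ℝ) : 𝕜) * y z :=
    integral_congr_ae (by filter_upwards [hu] with x hx; rw [hx])
  have e2 : ∫ x in I, (ϕ x : 𝕜) * v x = ∫ x in I, (ϕ x : 𝕜) * z x :=
    integral_congr_ae (by filter_upwards [hv] with x hx; rw [hx])
  rw [← e1, ← e2, e]

lemma HasWeakDeriv.re {u v : ℝ → 𝕜} (h : HasWeakDeriv I u v) :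
    HasWeakDeriv (𝕜 := ℝ) I (fun x => RCLike.re (u x)) (fun x => RCLike.re (v x)) := by
  refine ⟨fun x hx => ?_, fun x hx => ?_, fun ϕ h1 h2 h3 => ?_⟩
  · obtain ⟨s, hs, hi⟩ := h.1 x hx
    exact ⟨s, hs, Integrable.re hi⟩
  · obtain ⟨s, hs, hi⟩ := h.2.1 x hx
    exact ⟨s, hs, Integrable.re hi⟩
  · have e := congrArg RCLike.re (h.2.2 ϕ h1 h2 h3)
    have hd : Continuous (deriv ϕ) := h1.continuous_deriv (by simp)
    rw [map_neg, ← integral_re (integrableOn_test_mul h.1 hd h2.deriv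
      ((tsupport_deriv_subset).trans h3)),
      ← integral_re (integrableOn_test_mul h.2.1 h1.continuous h2 h3)] at e
    simpa [RCLike.re_ofReal_mul] using e

lemma HasWeakDeriv.im {u v : ℝ → 𝕜} (h : HasWeakDeriv I u v) :
    HasWeakDeriv (𝕜 := ℝ) I (fun x => RCLike.im (u x)) (fun x => RCLike.im (v x)) := by
  refine ⟨fun x hx => ?_, fun x hx => ?_, fun ϕ h1 h2 h3 => ?_⟩
  · obtain ⟨s, hs, hi⟩ := h.1 x hx
    exact ⟨s, hs, Integrable.im hi⟩
  · obtain ⟨s, hs, hi⟩ := h.2.1 x hx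
    exact ⟨s, hs, Integrable.im hi⟩
  · have e := congrArg RCLike.im (h.2.2 ϕ h1 h2 h3)
    have hd : Continuous (deriv ϕ) := h1.continuous_deriv (by simp)
    rw [map_neg, ← integral_im (integrableOn_test_mul h.1 hd h2.deriv
      ((tsupport_deriv_subset).trans h3)),
      ← integral_im (integrableOn_test_mul h.2.1 h1.continuous h2 h3)] at e
    simpa [RCLike.im_ofReal_mul] using e

lemma HasWeakDeriv.const_mul {u v : ℝ → 𝕜} (h : HasWeakDeriv I u v) (c : 𝕜) :
    HasWeakDeriv I (fun x => c * u x) (fun x => c * v x) := by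
  refine ⟨fun x hx => ?_, fun x hx => ?_, fun ϕ h1 h2 h3 => ?_⟩
  · obtain ⟨s, hs, hi⟩ := h.1 x hx
    exact ⟨s, hs, Integrable.const_mul hi c⟩
  · obtain ⟨s, hs, hi⟩ := h.2.1 x hx
    exact ⟨s, hs, Integrable.const_mul hi c⟩
  · have e := congrArg (c * ·) (h.2.2 ϕ h1 h2 h3)
    simp only [mul_neg, ← integral_const_mul] at e
    simpa only [mul_left_comm] using e

lemma HasWeakDeriv.add {u v y z : ℝ → 𝕜} (h : HasWeakDeriv I u v) (h' : HasWeakDeriv I y z) :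
    HasWeakDeriv I (fun x => u x + y x) (fun x => v x + z x) := by
  refine ⟨h.1.add h'.1, h.2.1.add h'.2.1, fun ϕ h1 h2 h3 => ?_⟩
  have hd : Continuous (deriv ϕ) := h1.continuous_deriv (by simp)
  have hds := (tsupport_deriv_subset (f := ϕ)).trans h3
  simp only [mul_add]
  rw [integral_add (integrableOn_test_mul h.1 hd h2.deriv hds)
      (integrableOn_test_mul h'.1 hd h2.deriv hds),
    integral_add (integrableOn_test_mul h.2.1 h1.continuous h2 h3)
      (integrableOn_test_mul h'.2.1 h1.continuous h2 h3), h.2.2 ϕ h1 h2 h3, h'.2.2 ϕ h1 h2 h3]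
  ring

lemma HasWeakDeriv.ofReal {u v : ℝ → ℝ} (h : HasWeakDeriv I u v) :
    HasWeakDeriv I (fun x => (u x : 𝕜)) (fun x => (v x : 𝕜)) := by
  refine ⟨fun x hx => ?_, fun x hx => ?_, fun ϕ h1 h2 h3 => ?_⟩
  · obtain ⟨s, hs, hi⟩ := h.1 x hx
    exact ⟨s, hs, Integrable.ofReal hi⟩
  · obtain ⟨s, hs, hi⟩ := h.2.1 x hx
    exact ⟨s, hs, Integrable.ofReal hi⟩
  · have e := congrArg (RCLike.ofReal (K := 𝕜)) (h.2.2 ϕ h1 h2 h3)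
    rw [RCLike.ofReal_neg, ← integral_ofReal, ← integral_ofReal] at e
    simpa using e

lemma HasACDeriv.hasWeakDeriv (hab : a ≤ b) {u v : ℝ → ℝ} (h : HasACDeriv a b u v) :
    HasWeakDeriv (Ioo a b) u v := by
  have hu : IntegrableOn u (Ioo a b) :=
    (memLp_Ioo_of_continuousOn (h.continuousOn hab) 1).integrable le_rfl
  refine ⟨hu.locallyIntegrableOn, (h.integrableOn hab).locallyIntegrableOn, ?_⟩
  intro ϕ h1 h2 h3
  have hd : Continuous (deriv ϕ) := h1.continuous_deriv (by simp)
  have hϕ : HasACDeriv a b ϕ (deriv ϕ) := HasACDeriv.of_hasDerivAt hab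
    (fun x _ => (h1.differentiable (by simp) x).hasDerivAt) hd.continuousOn
  have e := SobolevPair.integral_by_parts hab hϕ h
  have za : ϕ a = 0 := image_eq_zero_of_notMem_tsupport fun h => (h3 h).1.false
  have zb : ϕ b = 0 := image_eq_zero_of_notMem_tsupport fun h => (h3 h).2.false
  have hds := (tsupport_deriv_subset (f := ϕ)).trans h3
  have i1 := integrableOn_test_mul hu.locallyIntegrableOn hd h2.deriv hds
  have i2 := integrableOn_test_mul (h.integrableOn hab).locallyIntegrableOn h1.continuous h2 h3
  simp only [RCLike.ofReal_real_eq_id, id_eq] at i1 i2 ⊢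
  rw [integral_add i1 i2, za, zb] at e
  linarith

/-- The primitive starting at the left end of the support vanishes again to the right of the support
because the total integral is zero. -/
lemma exists_test_primitive {χ : ℝ → ℝ} (h1 : ContDiff ℝ ∞ χ) (h2 : HasCompactSupport χ)
    (h3 : tsupport χ ⊆ Ioo a b) (h0 : ∫ x, χ x = 0) :
    ∃ ϕ : ℝ → ℝ, ContDiff ℝ ∞ ϕ ∧ HasCompactSupport ϕ ∧ tsupport ϕ ⊆ Ioo a b ∧ deriv ϕ = χ := by
  rcases (tsupport χ).eq_empty_or_nonempty with he | hne
  · have : χ = 0 := by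
      rw [← Function.support_eq_empty_iff]
      exact subset_empty_iff.1 ((subset_tsupport χ).trans he.le)
    refine ⟨0, contDiff_const, HasCompactSupport.zero, by simp [tsupport], ?_⟩
    rw [this]; ext x; simp
  obtain ⟨c, hc⟩ := h2.isCompact.exists_isLeast hne
  obtain ⟨d, hd⟩ := h2.isCompact.exists_isGreatest hne
  have hcd : c ≤ d := hc.2 hd.1
  have hz : ∀ x, x ∉ Icc c d → χ x = 0 := fun x hx =>
    image_eq_zero_of_notMem_tsupport fun h => hx ⟨hc.2 h, hd.2 h⟩
  have hint : ∀ x y, IntervalIntegrable χ volume x y := fun x y =>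
    h1.continuous.intervalIntegrable x y
  have hder : ∀ x, HasDerivAt (fun x => ∫ t in c..x, χ t) (χ x) x := fun x =>
    (h1.continuous.integral_hasStrictDerivAt c x).hasDerivAt
  have hsupp : Function.support (fun x => ∫ t in c..x, χ t) ⊆ Icc c d := by
    intro x hx
    by_contra hcon
    apply hx
    rcases lt_or_ge x c with hxc | hxc
    · simp only
      rw [intervalIntegral.integral_symm, intervalIntegral.integral_of_le hxc.le,
        integral_Ioc_eq_integral_Ioo, setIntegral_eq_zero_of_forall_eq_zero, neg_zero]
      intro t ht
      exact hz t fun h => absurd h.1 (not_le.2 ht.2)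
    · have hxd : d < x := by
        by_contra h; exact hcon ⟨hxc, not_lt.1 h⟩
      simp only
      rw [intervalIntegral.integral_of_le hxc, integral_Ioc_eq_integral_Ioo,
        ← integral_Icc_eq_integral_Ioo,
        setIntegral_eq_integral_of_forall_compl_eq_zero, h0]
      intro t ht
      exact hz t fun h => ht ⟨h.1, h.2.trans hxd.le⟩
  refine ⟨fun x => ∫ t in c..x, χ t, ?_, ?_, ?_, ?_⟩
  · rw [contDiff_infty_iff_deriv]
    refine ⟨fun x => (hder x).differentiableAt, ?_⟩
    rwa [show deriv (fun x => ∫ t in c..x, χ t) = χ from funext fun x => (hder x).deriv]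
  · exact HasCompactSupport.of_support_subset_isCompact isCompact_Icc hsupp
  · exact (closure_minimal hsupp isClosed_Icc).trans
      (Icc_subset_Ioo (h3 hc.1).1 (h3 hd.1).2)
  · exact funext fun x => (hder x).deriv

/-- The lemma of du Bois-Reymond. -/
lemma ae_const_of_integral_deriv_mul_eq_zero (hab : a < b) {g : ℝ → ℝ}
    (hg : IntegrableOn g (Ioo a b))
    (h : ∀ ϕ : ℝ → ℝ, ContDiff ℝ ∞ ϕ → HasCompactSupport ϕ → tsupport ϕ ⊆ Ioo a b →
      ∫ x in Ioo a b, deriv ϕ x * g x = 0) :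
    ∃ c, ∀ᵐ x ∂(volume.restrict (Ioo a b)), g x = c := by
  -- Outer radius a quarter of the length, so that the support stays inside the open interval.
  let B : ContDiffBump ((a + b) / 2) := ⟨(b - a) / 8, (b - a) / 4, by linarith, by linarith⟩
  let η : ℝ → ℝ := B.normed volume
  have hη1 : ContDiff ℝ ∞ η := B.contDiff_normed
  have hη2 : HasCompactSupport η := B.hasCompactSupport_normed
  have hη3 : tsupport η ⊆ Ioo a b := by
    rw [show tsupport η = _ from B.tsupport_normed_eq, Real.closedBall_eq_Icc]
    refine Icc_subset_Ioo ?_ ?_ <;> simp only [B] <;> linarith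
  have hη0 : ∫ x, η x = 1 := B.integral_normed
  have hl := hg.locallyIntegrableOn
  set k := ∫ x in Ioo a b, η x * g x with hk
  refine ⟨k, ?_⟩
  have key : ∀ᵐ x, x ∈ Ioo a b → g x - k = 0 := by
    refine isOpen_Ioo.ae_eq_zero_of_integral_contDiff_smul_eq_zero
      (hg.sub (integrableOn_const (by simp))).locallyIntegrableOn ?_
    intro ψ h1 h2 h3
    set m := ∫ x, ψ x with hm
    -- Subtracting m η makes the mean of ψ zero; the difference is then the derivative of an
    -- admissible test function.
    have hsub : tsupport (fun x => ψ x - m * η x) ⊆ Ioo a b := by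
      refine (tsupport_sub ψ (fun x => m * η x)).trans (union_subset h3 ?_)
      exact (tsupport_mul_subset_right (f := fun _ => m) (g := η)).trans hη3
    have hcs : HasCompactSupport (fun x => ψ x - m * η x) := h2.sub (hη2.mul_left (f := fun _ => m))
    obtain ⟨ϕ, p1, p2, p3, p4⟩ := exists_test_primitive (a := a) (b := b)
      (χ := fun x => ψ x - m * η x) (h1.sub (contDiff_const.mul hη1)) hcs hsub (by
        rw [integral_sub (h1.continuous.integrable_of_hasCompactSupport h2)
          ((hη1.continuous.integrable_of_hasCompactSupport hη2).const_mul m),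
          integral_const_mul, hη0, hm]; ring)
    have e := h ϕ p1 p2 p3
    rw [p4] at e
    have i1 := integrableOn_test_mul (𝕜 := ℝ) hl h1.continuous h2 h3
    have i2 := integrableOn_test_mul (𝕜 := ℝ) hl hη1.continuous hη2 hη3
    simp only [RCLike.ofReal_real_eq_id, id_eq] at i1 i2
    have e2 : ∫ x in Ioo a b, (ψ x - m * η x) * g x
        = (∫ x in Ioo a b, ψ x * g x) - m * k := by
      simp only [sub_mul, mul_assoc]
      rw [integral_sub i1 (i2.const_mul m), integral_const_mul]
    rw [e2] at e
    have hψ : ∫ x in Ioo a b, ψ x = m := setIntegral_eq_integral_of_forall_compl_eq_zero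
      fun x hx => image_eq_zero_of_notMem_tsupport fun h => hx (h3 h)
    change ∫ x, ψ x * (g x - k) = 0
    rw [← setIntegral_eq_integral_of_forall_compl_eq_zero (s := Ioo a b)]
    · simp only [mul_sub]
      rw [integral_sub i1
        ((h1.continuous.integrable_of_hasCompactSupport h2).integrableOn.mul_const k),
        integral_mul_const, hψ]
      exact e
    · intro x hx
      rw [image_eq_zero_of_notMem_tsupport (fun h => hx (h3 h)), zero_mul]
  rw [ae_restrict_iff' measurableSet_Ioo]
  filter_upwards [key] with x hx hxi
  exact sub_eq_zero.1 (hx hxi)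

/-- The difference of u and a primitive of v has weak derivative zero, hence is constant by du
Bois-Reymond. -/
lemma HasWeakDeriv.exists_hasACDeriv (hab : a < b) {u v : ℝ → ℝ}
    (h : HasWeakDeriv (Ioo a b) u v) (hu : IntegrableOn u (Ioo a b))
    (hv : IntegrableOn v (Ioo a b)) :
    ∃ r, HasACDeriv a b r v ∧ u =ᵐ[volume.restrict (Ioo a b)] r := by
  have hU := HasACDeriv.of_integral hab.le hv 0
  set U : ℝ → ℝ := fun x => 0 + ∫ t in a..x, v t
  have hUi : IntegrableOn U (Ioo a b) :=
    (memLp_Ioo_of_continuousOn (hU.continuousOn hab.le) 1).integrable le_rfl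
  obtain ⟨c, hc⟩ := ae_const_of_integral_deriv_mul_eq_zero hab (hu.sub hUi) (by
    intro ϕ h1 h2 h3
    have hd : Continuous (deriv ϕ) := h1.continuous_deriv (by simp)
    have hds := (tsupport_deriv_subset (f := ϕ)).trans h3
    have e1 := h.2.2 ϕ h1 h2 h3
    have e2 := (hU.hasWeakDeriv hab.le).2.2 ϕ h1 h2 h3
    have i1 := integrableOn_test_mul (𝕜 := ℝ) hu.locallyIntegrableOn hd h2.deriv hds
    have i2 := integrableOn_test_mul (𝕜 := ℝ) hUi.locallyIntegrableOn hd h2.deriv hds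
    simp only [RCLike.ofReal_real_eq_id, id_eq] at e1 e2 i1 i2
    simp only [Pi.sub_apply, mul_sub]
    rw [integral_sub i1 i2, e1, e2, sub_self])
  refine ⟨fun x => c + ∫ t in a..x, v t, HasACDeriv.of_integral hab.le hv c, ?_⟩
  filter_upwards [hc] with x hx
  simp only [Pi.sub_apply, U] at hx
  linarith

/-- Real and imaginary parts of a Sobolev function have absolutely continuous representatives. -/
lemma MemH1.exists_sobolevPair (hab : a < b) {Ψ : ℝ → 𝕜} (h : MemH1 (Ioo a b) Ψ) :
    ∃ r v s z : ℝ → ℝ, SobolevPair a b r v ∧ SobolevPair a b s z ∧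
      ∀ᵐ x ∂(volume.restrict (Ioo a b)), RCLike.re (Ψ x) = r x ∧ RCLike.im (Ψ x) = s x ∧
        RCLike.re (weakDeriv (Ioo a b) Ψ x) = v x ∧
        RCLike.im (weakDeriv (Ioo a b) Ψ x) = z x := by
  obtain ⟨hΨ, V, hV, hV2⟩ := h
  have hint : ∀ {F : ℝ → ℝ}, MemLp F 2 (volume.restrict (Ioo a b)) → IntegrableOn F (Ioo a b) :=
    fun hF => hF.integrable one_le_two
  obtain ⟨r, hr, hr'⟩ := hV.re.exists_hasACDeriv hab (hint hΨ.re) (hint hV2.re)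
  obtain ⟨s, hs, hs'⟩ := hV.im.exists_hasACDeriv hab (hint hΨ.im) (hint hV2.im)
  refine ⟨r, _, s, _, ⟨hr, hV2.re⟩, ⟨hs, hV2.im⟩, ?_⟩
  filter_upwards [hr', hs', hV.weakDeriv_ae_eq isOpen_Ioo] with x h1 h2 h3
  rw [h3]
  exact ⟨h1, h2, rfl, rfl⟩

lemma SobolevPair.hasWeakDeriv_of_ae_eq (hab : a ≤ b) {Ψ : ℝ → 𝕜} {r v s z : ℝ → ℝ}
    (hr : SobolevPair a b r v) (hs : SobolevPair a b s z)
    (h : ∀ᵐ x ∂(volume.restrict (Ioo a b)), Ψ x = r x + s x * RCLike.I) :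
    HasWeakDeriv (Ioo a b) Ψ (fun x => v x + z x * RCLike.I) := by
  have h1 : HasWeakDeriv (Ioo a b) (fun x => (r x : 𝕜)) (fun x => (v x : 𝕜)) :=
    (hr.acd.hasWeakDeriv hab).ofReal
  have h2 : HasWeakDeriv (Ioo a b) (fun x => (s x : 𝕜)) (fun x => (z x : 𝕜)) :=
    (hs.acd.hasWeakDeriv hab).ofReal
  refine (h1.add (h2.const_mul RCLike.I)).congr isOpen_Ioo ?_ ?_
  · filter_upwards [h] with x hx
    rw [hx, mul_comm RCLike.I]
  · exact Eventually.of_forall fun x => by simp only [mul_comm RCLike.I]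

lemma SobolevPair.memH1_of_ae_eq (hab : a ≤ b) {Ψ : ℝ → 𝕜} {r v s z : ℝ → ℝ}
    (hr : SobolevPair a b r v) (hs : SobolevPair a b s z)
    (h : ∀ᵐ x ∂(volume.restrict (Ioo a b)), Ψ x = r x + s x * RCLike.I) :
    MemH1 (Ioo a b) Ψ := by
  have hcomb : ∀ {p q : ℝ → ℝ}, MemLp p 2 (volume.restrict (Ioo a b)) →
      MemLp q 2 (volume.restrict (Ioo a b)) →
      MemLp (fun x => (p x : 𝕜) + q x * RCLike.I) 2 (volume.restrict (Ioo a b)) := by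
    intro p q hp hq
    have h1 : MemLp (fun x => (p x : 𝕜)) 2 (volume.restrict (Ioo a b)) := hp.ofReal
    have h2 : MemLp (fun x => (q x : 𝕜)) 2 (volume.restrict (Ioo a b)) := hq.ofReal
    exact h1.add (h2.mul_const _)
  refine ⟨(memLp_congr_ae h).2 (hcomb (hr.memLp_left hab) (hs.memLp_left hab)), _,
    hr.hasWeakDeriv_of_ae_eq hab hs h, hcomb hr.memLp hs.memLp⟩

end WeakDerivatives

/-! ### The direct method for two quadratic forms on a real vector space. -/

section AbstractMinimization

variable {E : Type*} [AddCommGroup E] [Module ℝ E] {a b B : LinearMap.BilinForm ℝ E}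

/-- Cauchy–Schwarz for a form that is only semidefinite. Definiteness is not available: the vectors
will be functions on all of ℝ, and the forms do not see values outside the interval. For this reason
convergence is phrased through the forms and not through a norm. -/
lemma tendsto_bilin_apply (hB : ∀ x y, B x y = B y x) (hB0 : ∀ x, 0 ≤ B x x) {z : ℕ → E} {y : E}
    (h : Tendsto (fun n => B (z n - y) (z n - y)) atTop (𝓝 0)) (e : E) :
    Tendsto (fun n => B e (z n)) atTop (𝓝 (B e y)) := by
  have h1 : Tendsto (fun n => B e (z n - y)) atTop (𝓝 0) := by
    have h2 : Tendsto (fun n => √(B e e * B (z n - y) (z n - y))) atTop (𝓝 0) := by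
      simpa using (h.const_mul (B e e)).sqrt
    refine squeeze_zero_norm (fun n => ?_) h2
    rw [Real.norm_eq_abs]
    refine Real.abs_le_sqrt ?_
    have := LinearMap.BilinForm.apply_mul_apply_le_of_forall_zero_le B hB0 e (z n - y)
    rwa [hB (z n - y) e, ← sq] at this
  simpa using h1.add_const (B e y)

lemma tendsto_bilin_self (hB : ∀ x y, B x y = B y x) (hB0 : ∀ x, 0 ≤ B x x) {z : ℕ → E} {y : E}
    (h : Tendsto (fun n => B (z n - y) (z n - y)) atTop (𝓝 0)) :
    Tendsto (fun n => B (z n) (z n)) atTop (𝓝 (B y y)) := by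
  have h1 : ∀ n, B (z n) (z n) = B (z n - y) (z n - y) + 2 * B y (z n) - B y y := by
    intro n
    have := hB y (z n)
    simp only [map_sub, LinearMap.sub_apply, this]
    ring
  simp_rw [h1]
  have h2 := (h.add ((tendsto_bilin_apply hB hB0 h y).const_mul 2)).sub_const (B y y)
  convert h2 using 2
  ring

/-- Existence of a minimizer of a quotient of quadratic forms on the complement of a vector:
the direct method with an abstract compactness and an abstract completeness hypothesis. -/
theorem exists_minimizer (ha : ∀ x y, a x y = a y x) (hb : ∀ x y, b x y = b y x) (hb0 : ∀ x, 0 ≤ b x x)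
    (hba : ∀ x, b x x ≤ a x x) (e : E)
    (hC : ∀ x : ℕ → E, (∃ K, ∀ n, a (x n) (x n) ≤ K) → ∃ φ : ℕ → ℕ, StrictMono φ ∧
      ∀ ε > 0, ∃ N, ∀ m ≥ N, ∀ n ≥ N, b (x (φ m) - x (φ n)) (x (φ m) - x (φ n)) ≤ ε)
    (hQ : ∀ x : ℕ → E,
      (∀ ε > 0, ∃ N, ∀ m ≥ N, ∀ n ≥ N, a (x m - x n) (x m - x n) ≤ ε) →
      ∃ y, Tendsto (fun n => a (x n - y) (x n - y)) atTop (𝓝 0))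
    (hne : ∃ x, b e x = 0 ∧ 0 < b x x) :
    ∃ x, b e x = 0 ∧ b x x = 1 ∧ ∀ y, b e y = 0 → a x x * b y y ≤ a y y := by
  have ha0 : ∀ x, 0 ≤ a x x := fun x => (hb0 x).trans (hba x)
  have hscale : ∀ y, b e y = 0 → 0 < b y y → ∃ x, b e x = 0 ∧ b x x = 1 ∧
      a x x * b y y = a y y := by
    intro y hy hpos
    have hs := Real.sq_sqrt hpos.le
    have hs0 : √(b y y) ≠ 0 := (Real.sqrt_pos.2 hpos).ne'
    refine ⟨(√(b y y))⁻¹ • y, by simp [hy], ?_, ?_⟩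
    · simp only [map_smul, LinearMap.smul_apply, smul_eq_mul]
      field_simp
      exact hs.symm
    · simp only [map_smul, LinearMap.smul_apply, smul_eq_mul]
      field_simp
      rw [hs, mul_comm]
  set T : Set ℝ := {t | ∃ x, b e x = 0 ∧ b x x = 1 ∧ a x x = t} with hT
  have hTne : T.Nonempty := by
    obtain ⟨y, hy, hpos⟩ := hne
    obtain ⟨x, h1, h2, -⟩ := hscale y hy hpos
    exact ⟨_, x, h1, h2, rfl⟩
  have hTb : BddBelow T := ⟨0, by rintro t ⟨x, -, -, rfl⟩; exact ha0 x⟩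
  set m := sInf T with hm
  have hm0 : 0 ≤ m := le_csInf hTne (by rintro t ⟨x, -, -, rfl⟩; exact ha0 x)
  have hlow : ∀ y, b e y = 0 → m * b y y ≤ a y y := by
    intro y hy
    rcases (hb0 y).eq_or_lt with h0 | hpos
    · rw [← h0, mul_zero]; exact ha0 y
    · obtain ⟨x, h1, h2, h3⟩ := hscale y hy hpos
      rw [← h3]
      gcongr
      exact csInf_le hTb ⟨x, h1, h2, rfl⟩
  have hex : ∀ n : ℕ, ∃ x, b e x = 0 ∧ b x x = 1 ∧ a x x < m + 1 / ((n : ℝ) + 1) := by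
    intro n
    obtain ⟨t, ⟨x, h1, h2, rfl⟩, ht⟩ := exists_lt_of_csInf_lt hTne
      (lt_add_of_pos_right m (Nat.one_div_pos_of_nat (α := ℝ) (n := n)))
    exact ⟨x, h1, h2, ht⟩
  choose x hx1 hx2 hx3 using hex
  obtain ⟨φ, hφ, hcau⟩ := hC x ⟨m + 1, fun n => (hx3 n).le.trans (by
    gcongr
    rw [div_le_one (by positivity)]
    linarith [Nat.cast_nonneg (α := ℝ) n])⟩
  have hlim : Tendsto (fun n => a (x (φ n)) (x (φ n))) atTop (𝓝 m) := by
    have h1 : Tendsto (fun n : ℕ => a (x n) (x n)) atTop (𝓝 m) := by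
      refine tendsto_of_tendsto_of_tendsto_of_le_of_le tendsto_const_nhds
        (h := fun n : ℕ => m + 1 / ((n : ℝ) + 1)) ?_
        (fun n => csInf_le hTb ⟨_, hx1 n, hx2 n, rfl⟩) (fun n => (hx3 n).le)
      simpa using (tendsto_one_div_add_atTop_nhds_zero_nat (𝕜 := ℝ)).const_add m
    exact h1.comp hφ.tendsto_atTop
  -- The parallelogram identity upgrades the subsequence from b-Cauchy to a-Cauchy: a(p+q, p+q) is
  -- at least m b(p+q, p+q), and b(p+q, p+q) is close to 4.
  obtain ⟨y, hy⟩ := hQ (fun n => x (φ n)) (by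
    intro ε hε
    -- The denominator has m + 1 because m may be zero. The two tolerances contribute ε/2 each in
    -- the end.
    obtain ⟨N1, hN1⟩ := hcau (ε / (2 * (m + 1))) (by positivity)
    obtain ⟨N2, hN2⟩ := eventually_atTop.1 (hlim.eventually_le_const
      (show m < m + ε / 8 by linarith))
    refine ⟨max N1 N2, fun i hi j hj => ?_⟩
    have e1 := hN1 i (le_of_max_le_left hi) j (le_of_max_le_left hj)
    have e2 := hN2 i (le_of_max_le_right hi)
    have e3 := hN2 j (le_of_max_le_right hj)
    set p := x (φ i)
    set q := x (φ j)
    have e4 := hlow (p + q) (by simp [p, q, hx1])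
    have e5 : b (p + q) (p + q) = 4 - b (p - q) (p - q) := by
      have h1 : b p p = 1 := hx2 _
      have h2 : b q q = 1 := hx2 _
      simp only [map_sub, map_add, LinearMap.sub_apply, LinearMap.add_apply, h1, h2]
      ring
    have e6 : a (p - q) (p - q) = 2 * a p p + 2 * a q q - a (p + q) (p + q) := by
      simp only [map_sub, map_add, LinearMap.sub_apply, LinearMap.add_apply]
      ring
    have e7 : m * b (p - q) (p - q) ≤ ε / 2 := by
      calc m * b (p - q) (p - q) ≤ (m + 1) * (ε / (2 * (m + 1))) := by
            gcongr
            · exact hb0 _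
            · linarith
        _ = ε / 2 := by field_simp
    rw [e5] at e4
    change a (p - q) (p - q) ≤ ε
    rw [e6]
    linarith)
  have hyb : Tendsto (fun n => b (x (φ n) - y) (x (φ n) - y)) atTop (𝓝 0) :=
    squeeze_zero (fun n => hb0 _) (fun n => hba _) hy
  have l1 := tendsto_bilin_apply hb hb0 hyb e
  have l2 := tendsto_bilin_self hb hb0 hyb
  have l3 := tendsto_bilin_self ha ha0 hy
  simp only [hx1, hx2] at l1 l2
  refine ⟨y, tendsto_nhds_unique l1 tendsto_const_nhds,
    tendsto_nhds_unique l2 tendsto_const_nhds, ?_⟩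
  rw [tendsto_nhds_unique l3 hlim]
  exact hlow

/-- The Euler-Lagrange equation of a minimizer. -/
theorem bilin_eq_of_minimizer (ha : ∀ x y, a x y = a y x) (hb : ∀ x y, b x y = b y x) {e x : E} (hx : b e x = 0)
    (hmin : ∀ y, b e y = 0 → a x x * b y y ≤ a y y) (hx1 : b x x = 1) {y : E} (hy : b e y = 0) :
    a x y = a x x * b x y := by
  set m := a x x
  -- First variation: the quadratic polynomial in t is nonnegative and vanishes at 0, so its linear
  -- coefficient must vanish.
  have key : ∀ t : ℝ, 0 ≤ 2 * t * (a x y - m * b x y) + t ^ 2 * (a y y - m * b y y) := by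
    intro t
    have h := hmin (x + t • y) (by simp [hx, hy])
    have s1 := ha x y
    have s2 := hb x y
    simp only [map_add, map_smul, LinearMap.add_apply, LinearMap.smul_apply, smul_eq_mul, hx1,
      ← s1, ← s2] at h
    change m * _ ≤ m + _ + _ at h
    linarith
  by_contra hne
  set d := a x y - m * b x y with hd
  have hd0 : d ≠ 0 := sub_ne_zero.2 hne
  set k := a y y - m * b y y
  -- A step against the slope that is short enough for the linear term to dominate, whatever the
  -- sign of k.
  have hk := key (-d / (|k| + 1))
  have hp : 0 < |k| + 1 := by positivity
  have e1 : 2 * (-d / (|k| + 1)) * d + (-d / (|k| + 1)) ^ 2 * k =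
      d ^ 2 / (|k| + 1) * (-2 + k / (|k| + 1)) := by field_simp
  rw [e1] at hk
  have e2 : k / (|k| + 1) ≤ 1 := by
    rw [div_le_one hp]; linarith [le_abs_self k]
  have e3 : 0 < d ^ 2 / (|k| + 1) := by positivity
  nlinarith

end AbstractMinimization

/-! ### Weighted mass and energy as bilinear forms on H¹. -/

section Forms

/-- The weighted `L²` scalar product of real functions. -/
noncomputable def mass (R : ℝ) (w u y : ℝ → ℝ) : ℝ := ∫ x in Ioo (-R) R, u x * y x * w x

/-- The energy form of real functions `u`, `y` with derivatives `v`, `z`. -/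
noncomputable def energy (R : ℝ) (w V u v y z : ℝ → ℝ) : ℝ :=
  ∫ x in Ioo (-R) R, (v x * z x + V x * u x * y x) * w x

/-- Coefficients of a regular Neumann problem on `(-R, R)`: a positive `C¹` weight with derivative
`w'` and a bounded potential. -/
structure Coefficients (R : ℝ) (w w' V : ℝ → ℝ) : Prop where
  one_le : 1 ≤ R
  hasDerivAt : ∀ x ∈ Icc (-R) R, HasDerivAt w (w' x) x
  continuousOn_deriv : ContinuousOn w' (Icc (-R) R)
  pos : ∀ x ∈ Icc (-R) R, 0 < w x
  measurable : AEStronglyMeasurable V (volume.restrict (Ioo (-R) R))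
  bounded : ∃ M, ∀ᵐ x ∂(volume.restrict (Ioo (-R) R)), |V x| ≤ M

lemma integrable_mul_mul {μ : Measure ℝ} {u y k : ℝ → ℝ} (hu : MemLp u 2 μ) (hy : MemLp y 2 μ)
    (hk : AEStronglyMeasurable k μ) (hb : ∃ M, ∀ᵐ x ∂μ, |k x| ≤ M) :
    Integrable (fun x => u x * y x * k x) μ := by
  obtain ⟨M, hM⟩ := hb
  exact (hu.integrable_mul hy).mul_bdd hk hM

variable {R : ℝ} {w w' V u v y z u₁ v₁ u₂ v₂ : ℝ → ℝ}

namespace Coefficients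

lemma neg_le (hc : Coefficients R w w' V) : -R ≤ R := by linarith [hc.one_le]

lemma neg_lt (hc : Coefficients R w w' V) : -R < R := by linarith [hc.one_le]

lemma continuousOn (hc : Coefficients R w w' V) : ContinuousOn w (Icc (-R) R) :=
  fun x hx => (hc.hasDerivAt x hx).continuousAt.continuousWithinAt

lemma hasACDeriv (hc : Coefficients R w w' V) : HasACDeriv (-R) R w w' :=
  HasACDeriv.of_hasDerivAt hc.neg_le hc.hasDerivAt hc.continuousOn_deriv

lemma exists_lower (hc : Coefficients R w w' V) : ∃ c, 0 < c ∧ ∀ x ∈ Icc (-R) R, c ≤ w x := by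
  obtain ⟨x, hx, hmin⟩ := isCompact_Icc.exists_isMinOn (nonempty_Icc.2 hc.neg_le) hc.continuousOn
  exact ⟨w x, hc.pos x hx, fun y hy => hmin hy⟩

lemma exists_upper (hc : Coefficients R w w' V) : ∃ C, 0 < C ∧ ∀ x ∈ Icc (-R) R, w x ≤ C := by
  obtain ⟨x, hx, hmax⟩ := isCompact_Icc.exists_isMaxOn (nonempty_Icc.2 hc.neg_le) hc.continuousOn
  exact ⟨w x, hc.pos x hx, fun y hy => hmax hy⟩

lemma aestronglyMeasurable (hc : Coefficients R w w' V) :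
    AEStronglyMeasurable w (volume.restrict (Ioo (-R) R)) :=
  (hc.continuousOn.mono Ioo_subset_Icc_self).aestronglyMeasurable measurableSet_Ioo

lemma ae_abs_le (hc : Coefficients R w w' V) :
    ∃ M, ∀ᵐ x ∂(volume.restrict (Ioo (-R) R)), |w x| ≤ M := by
  obtain ⟨C, -, hC⟩ := hc.exists_upper
  refine ⟨C, (ae_restrict_iff' measurableSet_Ioo).2 (Eventually.of_forall fun x hx => ?_)⟩
  rw [abs_of_pos (hc.pos x (Ioo_subset_Icc_self hx))]
  exact hC x (Ioo_subset_Icc_self hx)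

lemma integrable_mass (hc : Coefficients R w w' V)
    (hu : MemLp u 2 (volume.restrict (Ioo (-R) R)))
    (hy : MemLp y 2 (volume.restrict (Ioo (-R) R))) :
    IntegrableOn (fun x => u x * y x * w x) (Ioo (-R) R) :=
  integrable_mul_mul hu hy hc.aestronglyMeasurable hc.ae_abs_le

lemma integrable_potential (hc : Coefficients R w w' V)
    (hu : MemLp u 2 (volume.restrict (Ioo (-R) R)))
    (hy : MemLp y 2 (volume.restrict (Ioo (-R) R))) :
    IntegrableOn (fun x => V x * u x * y x * w x) (Ioo (-R) R) := by
  obtain ⟨M, hM⟩ := hc.bounded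
  obtain ⟨C, hC⟩ := hc.ae_abs_le
  have := integrable_mul_mul (k := fun x => V x * w x) hu hy
    (hc.measurable.mul hc.aestronglyMeasurable) ⟨M * C, by
      filter_upwards [hM, hC] with x h1 h2
      rw [abs_mul]
      exact mul_le_mul h1 h2 (abs_nonneg _) ((abs_nonneg _).trans h1)⟩
  refine this.congr (Eventually.of_forall fun x => ?_)
  simp only; ring

lemma integrable_energy (hc : Coefficients R w w' V)
    (h : SobolevPair (-R) R u v) (h' : SobolevPair (-R) R y z) :
    IntegrableOn (fun x => (v x * z x + V x * u x * y x) * w x) (Ioo (-R) R) := by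
  simp only [add_mul]
  exact (hc.integrable_mass h.memLp h'.memLp).add
    (hc.integrable_potential (h.memLp_left hc.neg_le) (h'.memLp_left hc.neg_le))

lemma mass_add (hc : Coefficients R w w' V)
    (h₁ : MemLp u₁ 2 (volume.restrict (Ioo (-R) R)))
    (h₂ : MemLp u₂ 2 (volume.restrict (Ioo (-R) R)))
    (hy : MemLp y 2 (volume.restrict (Ioo (-R) R))) :
    mass R w (fun x => u₁ x + u₂ x) y = mass R w u₁ y + mass R w u₂ y := by
  simp only [mass, add_mul]
  exact integral_add (hc.integrable_mass h₁ hy) (hc.integrable_mass h₂ hy)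

lemma energy_add (hc : Coefficients R w w' V)
    (h₁ : SobolevPair (-R) R u₁ v₁) (h₂ : SobolevPair (-R) R u₂ v₂)
    (h' : SobolevPair (-R) R y z) :
    energy R w V (fun x => u₁ x + u₂ x) (fun x => v₁ x + v₂ x) y z
      = energy R w V u₁ v₁ y z + energy R w V u₂ v₂ y z := by
  simp only [energy]
  rw [← integral_add (hc.integrable_energy h₁ h') (hc.integrable_energy h₂ h')]
  exact integral_congr_ae (Eventually.of_forall fun x => by simp only; ring)

end Coefficients

lemma mass_comm : mass R w u y = mass R w y u := by
  simp only [mass, mul_comm (u _)]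

lemma energy_comm : energy R w V u v y z = energy R w V y z u v := by
  simp only [energy]
  exact integral_congr_ae (Eventually.of_forall fun x => by simp only; ring)

lemma mass_const_mul (c : ℝ) : mass R w (fun x => c * u x) y = c * mass R w u y := by
  simp only [mass, ← integral_const_mul, mul_assoc]

lemma energy_const_mul (c : ℝ) :
    energy R w V (fun x => c * u x) (fun x => c * v x) y z = c * energy R w V u v y z := by
  simp only [energy, ← integral_const_mul]
  exact integral_congr_ae (Eventually.of_forall fun x => by simp only; ring)

lemma Coefficients.mass_self_nonneg (hc : Coefficients R w w' V) (u : ℝ → ℝ) :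
    0 ≤ mass R w u u :=
  setIntegral_nonneg measurableSet_Ioo fun x hx =>
    mul_nonneg (mul_self_nonneg _) (hc.pos x (Ioo_subset_Icc_self hx)).le

lemma Coefficients.energy_shift (hc : Coefficients R w w' V) (h : SobolevPair (-R) R u v)
    (h' : SobolevPair (-R) R y z) (k : ℝ) :
    energy R w (fun x => V x + k) u v y z = energy R w V u v y z + k * mass R w u y := by
  simp only [energy, mass, ← integral_const_mul]
  rw [← integral_add (hc.integrable_energy h h') ((hc.integrable_mass
    (h.memLp_left hc.neg_le) (h'.memLp_left hc.neg_le)).const_mul k)]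
  exact integral_congr_ae (Eventually.of_forall fun x => by simp only; ring)

lemma Coefficients.add_const (hc : Coefficients R w w' V) (k : ℝ) :
    Coefficients R w w' (fun x => V x + k) where
  one_le := hc.one_le
  hasDerivAt := hc.hasDerivAt
  continuousOn_deriv := hc.continuousOn_deriv
  pos := hc.pos
  measurable := hc.measurable.add aestronglyMeasurable_const
  bounded := by
    obtain ⟨M, hM⟩ := hc.bounded
    refine ⟨M + |k|, ?_⟩
    filter_upwards [hM] with x hx
    exact (abs_add_le _ _).trans (by gcongr)

variable (R) in
/-- The space `H¹(-R, R)` of pairs of a function and its weak derivative. -/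
def sobolevSpace : Submodule ℝ ((ℝ → ℝ) × (ℝ → ℝ)) where
  carrier := {p | SobolevPair (-R) R p.1 p.2}
  add_mem' := fun hp hq => hp.add hq
  zero_mem' := ⟨HasACDeriv.const 0, MemLp.zero⟩
  smul_mem' := fun c _ hp => hp.const_mul c

/-- The weighted `L²` scalar product as a bilinear form on the Sobolev space. -/
noncomputable def massForm (hc : Coefficients R w w' V) :
    LinearMap.BilinForm ℝ (sobolevSpace R) :=
  have hmem : ∀ p : sobolevSpace R, MemLp p.1.1 2 (volume.restrict (Ioo (-R) R)) := fun p =>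
    SobolevPair.memLp_left p.2 hc.neg_le
  LinearMap.mk₂ ℝ (fun p q => mass R w p.1.1 q.1.1)
    (fun p q r => hc.mass_add (hmem p) (hmem q) (hmem r))
    (fun c p q => mass_const_mul c)
    (fun p q r => by
      rw [mass_comm, mass_comm (u := p.1.1) (y := q.1.1), mass_comm (u := p.1.1) (y := r.1.1)]
      exact hc.mass_add (hmem q) (hmem r) (hmem p))
    (fun c p q => by
      rw [mass_comm, mass_comm (u := p.1.1)]
      exact mass_const_mul c)

/-- The energy as a bilinear form on the Sobolev space. -/
noncomputable def energyForm (hc : Coefficients R w w' V) :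
    LinearMap.BilinForm ℝ (sobolevSpace R) :=
  have hmem : ∀ p : sobolevSpace R, SobolevPair (-R) R p.1.1 p.1.2 := fun p => p.2
  LinearMap.mk₂ ℝ (fun p q => energy R w V p.1.1 p.1.2 q.1.1 q.1.2)
    (fun p q r => hc.energy_add (hmem p) (hmem q) (hmem r))
    (fun c p q => energy_const_mul c)
    (fun p q r => by
      rw [energy_comm, energy_comm (u := p.1.1) (y := q.1.1),
        energy_comm (u := p.1.1) (y := r.1.1)]
      exact hc.energy_add (hmem q) (hmem r) (hmem p))
    (fun c p q => by
      rw [energy_comm, energy_comm (u := p.1.1)]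
      exact energy_const_mul c)

end Forms

/-! ### Compact embedding into continuous functions and completeness of H¹. -/

section Compactness

variable {R : ℝ} {w w' V : ℝ → ℝ}

/-- Compactness of the embedding of `H¹(-R, R)` into the continuous functions. -/
lemma exists_uniformly_cauchy_subseq (hR : 1 ≤ R) {u v : ℕ → ℝ → ℝ} {K : ℝ}
    (h : ∀ n, SobolevPair (-R) R (u n) (v n))
    (hu : ∀ n, ∫ x in Ioo (-R) R, u n x ^ 2 ≤ K) (hv : ∀ n, ∫ x in Ioo (-R) R, v n x ^ 2 ≤ K) :
    ∃ φ : ℕ → ℕ, StrictMono φ ∧ ∀ ε > 0, ∃ N, ∀ m ≥ N, ∀ n ≥ N, ∀ x ∈ Icc (-R) R,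
      |u (φ m) x - u (φ n) x| ≤ ε := by
  have hab : -R ≤ R := by linarith
  have hK : 0 ≤ K := (integral_nonneg fun x => sq_nonneg _).trans (hu 0)
  let F : ℕ → BoundedContinuousFunction (Icc (-R) R) ℝ := fun n =>
    BoundedContinuousFunction.mkOfCompact
      ⟨(Icc (-R) R).domRestrict (u n), ((h n).continuousOn hab).domRestrict⟩
  have hF : ∀ n (x : Icc (-R) R), F n x = u n x := fun n x => rfl
  have hbound : ∀ n, ∀ x ∈ Icc (-R) R, |u n x| ≤ √(4 * K) := fun n x hx => by
    refine Real.abs_le_sqrt (((h n).sq_le (by linarith) hx).trans ?_)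
    linarith [hu n, hv n]
  -- Arzelà–Ascoli: the uniform bound is the trace inequality, the modulus of continuity comes from
  -- `SobolevPair.sq_sub_le`.
  have hcomp : IsCompact (closure (range F)) := by
    refine BoundedContinuousFunction.arzela_ascoli (Icc (-√(4 * K)) √(4 * K)) isCompact_Icc
      (range F) ?_ ?_
    · rintro f x ⟨n, rfl⟩
      exact abs_le.1 (hbound n x x.2)
    · refine Metric.equicontinuous_of_continuity_modulus (fun d => √(d * K)) ?_ _ ?_
      · have : Continuous fun d : ℝ => √(d * K) := by fun_prop
        simpa using this.tendsto 0
      · rintro x y ⟨f, n, rfl⟩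
        have key : ∀ s t : ℝ, -R ≤ s → s ≤ t → t ≤ R → |u n t - u n s| ≤ √((t - s) * K) := by
          intro s t h1 h2 h3
          refine Real.abs_le_sqrt (((h n).sq_sub_le h1 h2 h3).trans ?_)
          exact mul_le_mul_of_nonneg_left (hv n) (sub_nonneg.2 h2)
        change dist (u n x) (u n y) ≤ √(dist (x : ℝ) y * K)
        rcases le_total (x : ℝ) y with hxy | hxy
        · rw [dist_comm, dist_comm (x : ℝ), Real.dist_eq, Real.dist_eq,
            abs_of_nonneg (sub_nonneg.2 hxy)]
          exact key _ _ x.2.1 hxy y.2.2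
        · rw [Real.dist_eq, Real.dist_eq, abs_of_nonneg (sub_nonneg.2 hxy)]
          exact key _ _ y.2.1 hxy x.2.2
  obtain ⟨g, -, φ, hφ, hlim⟩ := hcomp.tendsto_subseq (x := F)
    (fun n => subset_closure (mem_range_self n))
  refine ⟨φ, hφ, fun ε hε => ?_⟩
  obtain ⟨N, hN⟩ := Metric.cauchySeq_iff.1 hlim.cauchySeq ε hε
  refine ⟨N, fun m hm n hn x hx => ?_⟩
  have h1 := (BoundedContinuousFunction.dist_coe_le_dist (f := (F ∘ φ) m) (g := (F ∘ φ) n)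
    ⟨x, hx⟩).trans (hN m hm n hn).le
  rwa [Real.dist_eq] at h1

lemma norm_toLp_sub_sq {μ : Measure ℝ} {f g : ℝ → ℝ} (hf : MemLp f 2 μ) (hg : MemLp g 2 μ) :
    ‖hf.toLp f - hg.toLp g‖ ^ 2 = ∫ x, (f x - g x) ^ 2 ∂μ := by
  rw [← MemLp.toLp_sub, ← real_inner_self_eq_norm_sq, L2.inner_def]
  refine integral_congr_ae ?_
  filter_upwards [(hf.sub hg).coeFn_toLp] with x hx
  rw [hx]
  simp [sq]

lemma exists_tendsto_of_cauchy_sq {μ : Measure ℝ} {f : ℕ → ℝ → ℝ} (hf : ∀ n, MemLp (f n) 2 μ)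
    (h : ∀ ε > 0, ∃ N, ∀ m ≥ N, ∀ n ≥ N, ∫ x, (f m x - f n x) ^ 2 ∂μ ≤ ε) :
    ∃ g, MemLp g 2 μ ∧ Tendsto (fun n => ∫ x, (f n x - g x) ^ 2 ∂μ) atTop (𝓝 0) := by
  have hcau : CauchySeq fun n => (hf n).toLp (f n) := by
    rw [Metric.cauchySeq_iff]
    intro ε hε
    obtain ⟨N, hN⟩ := h (ε ^ 2 / 4) (by positivity)
    refine ⟨N, fun m hm n hn => ?_⟩
    have h1 := hN m hm n hn
    rw [← norm_toLp_sub_sq (hf m) (hf n)] at h1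
    rw [dist_eq_norm]
    refine lt_of_pow_lt_pow_left₀ 2 hε.le (h1.trans_lt ?_)
    have : 0 < ε ^ 2 := by positivity
    linarith
  obtain ⟨g, hg⟩ := cauchySeq_tendsto_of_complete hcau
  refine ⟨g, Lp.memLp g, ?_⟩
  have h2 : Tendsto (fun n => ‖(hf n).toLp (f n) - g‖ ^ 2) atTop (𝓝 0) := by
    have := (tendsto_iff_norm_sub_tendsto_zero.1 hg).pow 2
    simpa using this
  refine h2.congr fun n => ?_
  rw [← norm_toLp_sub_sq (hf n) (Lp.memLp g), Lp.toLp_coeFn]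

/-- Completeness of `H¹(-R, R)`. -/
lemma exists_sobolevPair_limit (hR : 1 ≤ R) {u v : ℕ → ℝ → ℝ}
    (h : ∀ n, SobolevPair (-R) R (u n) (v n))
    (hcau : ∀ ε > 0, ∃ N, ∀ m ≥ N, ∀ n ≥ N, ∫ x in Ioo (-R) R, (u m x - u n x) ^ 2 ≤ ε ∧
      ∫ x in Ioo (-R) R, (v m x - v n x) ^ 2 ≤ ε) :
    ∃ y z, SobolevPair (-R) R y z ∧
      Tendsto (fun n => ∫ x in Ioo (-R) R, (u n x - y x) ^ 2) atTop (𝓝 0) ∧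
      Tendsto (fun n => ∫ x in Ioo (-R) R, (v n x - z x) ^ 2) atTop (𝓝 0) := by
  have hab : -R ≤ R := by linarith
  obtain ⟨z, hz, hlim⟩ := exists_tendsto_of_cauchy_sq (fun n => (h n).memLp)
    (fun ε hε => (hcau ε hε).imp fun N hN m hm n hn => (hN m hm n hn).2)
  -- The values at the left end converge by the trace inequality. The limit is then built as this
  -- value plus the primitive of the limit of the derivatives, so it is absolutely continuous by
  -- construction.
  have hc : CauchySeq fun n => u n (-R) := by
    rw [Metric.cauchySeq_iff]
    intro ε hε
    obtain ⟨N, hN⟩ := hcau (ε ^ 2 / 8) (by positivity)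
    refine ⟨N, fun m hm n hn => ?_⟩
    have h1 := ((h m).sub (h n)).sq_le (by linarith) (left_mem_Icc.2 hab)
    obtain ⟨h2, h3⟩ := hN m hm n hn
    have hp : 0 < ε ^ 2 := by positivity
    rw [Real.dist_eq]
    exact abs_lt_of_sq_lt_sq (by linarith) hε.le
  obtain ⟨c, hc⟩ := cauchySeq_tendsto_of_complete hc
  have hy : SobolevPair (-R) R (fun x => c + ∫ t in (-R)..x, z t) z :=
    ⟨HasACDeriv.of_integral hab (hz.integrable one_le_two) c, hz⟩
  refine ⟨_, z, hy, ?_, hlim⟩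
  set y : ℝ → ℝ := fun x => c + ∫ t in (-R)..x, z t with hydef
  have hyc : y (-R) = c := by simp [hydef]
  have hpt : ∀ n, ∀ x ∈ Ioo (-R) R, (u n x - y x) ^ 2 ≤
      2 * (u n (-R) - c) ^ 2 + 2 * ((2 * R) * ∫ x in Ioo (-R) R, (v n x - z x) ^ 2) := by
    intro n x hx
    have h1 := ((h n).sub hy).sq_sub_le le_rfl hx.1.le hx.2.le
    have h2 : (x - -R) * ∫ x in Ioo (-R) R, (v n x - z x) ^ 2 ≤
        (2 * R) * ∫ x in Ioo (-R) R, (v n x - z x) ^ 2 := by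
      gcongr
      linarith [hx.2]
    rw [hyc] at h1
    nlinarith [sq_nonneg ((u n x - y x) - 2 * (u n (-R) - c))]
  refine squeeze_zero (fun n => integral_nonneg fun x => sq_nonneg _) (fun n =>
    (setIntegral_mono_on (((h n).sub hy).memLp_left hab).integrable_sq
      (integrableOn_const (by simp)) measurableSet_Ioo (hpt n))) ?_
  simp only [setIntegral_const, smul_eq_mul]
  have h1 : Tendsto (fun n => (u n (-R) - c) ^ 2) atTop (𝓝 0) := by
    have := (hc.sub_const c).pow 2
    simpa using this
  have h2 := ((h1.const_mul 2).add ((hlim.const_mul (2 * R)).const_mul 2)).const_mul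
    (volume.real (Ioo (-R) R))
  simpa using h2

end Compactness
-- Weak eigenpairs by minimization, and their regularity.
section EigenvalueProblem

variable {R lam : ℝ} {w w' V u v y z e e' : ℝ → ℝ}

lemma eqOn_Icc_of_ae_eq_Ioo {a b : ℝ} (hab : a < b) {f g : ℝ → ℝ}
    (h : f =ᵐ[volume.restrict (Ioo a b)] g) (hf : ContinuousOn f (Icc a b))
    (hg : ContinuousOn g (Icc a b)) : EqOn f g (Icc a b) := by
  refine Measure.eqOn_Icc_of_ae_eq volume hab.ne ?_ hf hg
  rwa [← Measure.restrict_congr_set Ioo_ae_eq_Icc]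

lemma Coefficients.eqOn_zero_of_mass_eq_zero (hc : Coefficients R w w' V)
    (hu : ContinuousOn u (Icc (-R) R)) (h : mass R w u u = 0) : ∀ x ∈ Icc (-R) R, u x = 0 := by
  have h1 := (setIntegral_eq_zero_iff_of_nonneg_ae ((ae_restrict_iff' measurableSet_Ioo).2
    (Eventually.of_forall fun x hx => mul_nonneg (mul_self_nonneg (u x))
      (hc.pos x (Ioo_subset_Icc_self hx)).le))
    (hc.integrable_mass (memLp_Ioo_of_continuousOn hu 2) (memLp_Ioo_of_continuousOn hu 2))).1 h
  refine eqOn_Icc_of_ae_eq_Ioo hc.neg_lt ?_ hu continuousOn_const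
  filter_upwards [h1, ae_restrict_mem measurableSet_Ioo] with x hx hxi
  have := (hc.pos x (Ioo_subset_Icc_self hxi)).ne'
  simpa [this] using hx

lemma Coefficients.mass_le (hc : Coefficients R w w' V) :
    ∃ C, 0 < C ∧ ∀ f, MemLp f 2 (volume.restrict (Ioo (-R) R)) →
      mass R w f f ≤ C * ∫ x in Ioo (-R) R, f x ^ 2 := by
  obtain ⟨C, hC0, hC⟩ := hc.exists_upper
  refine ⟨C, hC0, fun f hf => ?_⟩
  rw [mass, ← integral_const_mul]
  refine setIntegral_mono_on (hc.integrable_mass hf hf) (hf.integrable_sq.const_mul C)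
    measurableSet_Ioo fun x hx => ?_
  nlinarith [hC x (Ioo_subset_Icc_self hx), sq_nonneg (f x)]

lemma Coefficients.le_mass (hc : Coefficients R w w' V) :
    ∃ c, 0 < c ∧ ∀ f, MemLp f 2 (volume.restrict (Ioo (-R) R)) →
      ∫ x in Ioo (-R) R, f x ^ 2 ≤ c * mass R w f f := by
  obtain ⟨c, hc0, hcw⟩ := hc.exists_lower
  refine ⟨c⁻¹, inv_pos.2 hc0, fun f hf => ?_⟩
  rw [mass, ← integral_const_mul]
  refine setIntegral_mono_on hf.integrable_sq ((hc.integrable_mass hf hf).const_mul _)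
    measurableSet_Ioo fun x hx => ?_
  have h1 := hcw x (Ioo_subset_Icc_self hx)
  have h2 : 1 ≤ c⁻¹ * w x := by rw [inv_mul_eq_div, one_le_div hc0]; exact h1
  nlinarith [mul_le_mul_of_nonneg_left h2 (sq_nonneg (f x))]

lemma Coefficients.energy_bounds (hc : Coefficients R w w' V) :
    ∃ M, 0 < M ∧ ∀ u v, SobolevPair (-R) R u v →
      |energy R w V u v u v - mass R w v v| ≤ M * mass R w u u := by
  obtain ⟨M, hM⟩ := hc.bounded
  refine ⟨|M| + 1, by positivity, fun u v h => ?_⟩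
  have hu := h.memLp_left hc.neg_le
  have i1 := hc.integrable_potential hu hu
  have i2 := hc.integrable_mass hu hu
  have e1 : energy R w V u v u v - mass R w v v
      = ∫ x in Ioo (-R) R, V x * u x * u x * w x := by
    rw [energy, mass, ← integral_sub (hc.integrable_energy h h) (hc.integrable_mass h.memLp h.memLp)]
    exact integral_congr_ae (Eventually.of_forall fun x => by simp only; ring)
  rw [e1, mass, ← integral_const_mul, ← Real.norm_eq_abs]
  refine norm_integral_le_of_norm_le (i2.const_mul _) ?_
  filter_upwards [hM, ae_restrict_mem measurableSet_Ioo] with x hx hxi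
  have hw := (hc.pos x (Ioo_subset_Icc_self hxi)).le
  rw [Real.norm_eq_abs, mul_assoc, mul_assoc, abs_mul, ← mul_assoc (u x),
    abs_of_nonneg (mul_nonneg (mul_self_nonneg (u x)) hw)]
  refine mul_le_mul_of_nonneg_right ?_ (mul_nonneg (mul_self_nonneg (u x)) hw)
  linarith [le_abs_self M]

/-- One linear condition on the two-dimensional span of 1 and x leaves a nonzero vector, so the
constraint set of the minimization is not empty. -/
lemma Coefficients.exists_orthogonal (hc : Coefficients R w w' V)
    (he : SobolevPair (-R) R e e') :
    ∃ y z, SobolevPair (-R) R y z ∧ mass R w e y = 0 ∧ 0 < mass R w y y := by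
  have h1 : SobolevPair (-R) R (fun _ => 1) (fun _ => 0) := ⟨HasACDeriv.const 1, MemLp.zero⟩
  have h2 : SobolevPair (-R) R (fun x => x) (fun _ => 1) :=
    SobolevPair.of_continuousOn (HasACDeriv.of_hasDerivAt hc.neg_le (fun x _ => hasDerivAt_id x)
      continuousOn_const) continuousOn_const
  have hpos : ∀ {y z}, SobolevPair (-R) R y z → (∃ x ∈ Icc (-R) R, y x ≠ 0) →
      0 < mass R w y y := by
    rintro y z h ⟨x, hx, hne⟩
    refine (hc.mass_self_nonneg y).lt_of_ne fun h0 => hne ?_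
    exact hc.eqOn_zero_of_mass_eq_zero (h.continuousOn hc.neg_le) h0.symm x hx
  by_cases h0 : mass R w e (fun _ => 1) = 0
  · exact ⟨_, _, h1, h0, hpos h1 ⟨0, ⟨by linarith [hc.one_le], by linarith [hc.one_le]⟩, one_ne_zero⟩⟩
  · set s := mass R w e (fun _ => 1) with hs
    set t := mass R w e (fun x => x) with ht
    have h3 := (h1.const_mul t).add (h2.const_mul (-s))
    refine ⟨_, _, h3, ?_, hpos h3 ?_⟩
    · rw [mass_comm, hc.mass_add ((h1.const_mul t).memLp_left hc.neg_le)
        ((h2.const_mul (-s)).memLp_left hc.neg_le) (he.memLp_left hc.neg_le), mass_const_mul,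
        mass_const_mul, mass_comm, ← hs, mass_comm, ← ht]
      ring
    · by_contra hcon
      push Not at hcon
      have a0 := hcon 0 ⟨by linarith [hc.one_le], by linarith [hc.one_le]⟩
      have a1 := hcon 1 ⟨by linarith [hc.one_le], hc.one_le⟩
      apply h0
      simp only [mul_one, mul_zero, add_zero] at a0 a1
      linarith

/-- Existence of weak eigenfunctions by minimization, possibly on an orthogonal complement. -/
theorem Coefficients.exists_weak_eigenpair (hc : Coefficients R w w' V)
    (he : SobolevPair (-R) R e e') :
    ∃ lam u v, SobolevPair (-R) R u v ∧ mass R w u u = 1 ∧ mass R w e u = 0 ∧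
      energy R w V u v u v = lam ∧
      (∀ y z, SobolevPair (-R) R y z → mass R w e y = 0 →
        lam * mass R w y y ≤ energy R w V y z y z) ∧
      (∀ y z, SobolevPair (-R) R y z → mass R w e y = 0 →
        energy R w V u v y z = lam * mass R w u y) := by
  obtain ⟨M, hM0, hM⟩ := hc.energy_bounds
  -- Adding M + 1 to the potential makes the energy dominate the masses of both the function and its
  -- derivative; minimizers are unchanged and the eigenvalue is shifted back at the end.
  have hc' := hc.add_const (M + 1)
  obtain ⟨C, hC0, hC⟩ := hc.mass_le
  obtain ⟨c, hc0, hcm⟩ := hc.le_mass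
  set a := energyForm hc' with ha
  set b := massForm hc with hb
  have a_apply : ∀ p q : sobolevSpace R, a p q =
      energy R w V p.1.1 p.1.2 q.1.1 q.1.2 + (M + 1) * mass R w p.1.1 q.1.1 := fun p q =>
    hc.energy_shift p.2 q.2 (M + 1)
  have b_apply : ∀ p q : sobolevSpace R, b p q = mass R w p.1.1 q.1.1 := fun p q => rfl
  have hsym_a : ∀ p q, a p q = a q p := fun p q => energy_comm
  have hsym_b : ∀ p q, b p q = b q p := fun p q => mass_comm
  have hb0 : ∀ p, 0 ≤ b p p := fun p => hc.mass_self_nonneg _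
  have hlow : ∀ p : sobolevSpace R, mass R w p.1.2 p.1.2 + mass R w p.1.1 p.1.1 ≤ a p p := by
    intro p
    rw [a_apply]
    have := (abs_le.1 (hM _ _ p.2)).1
    linarith
  have hupp : ∀ p : sobolevSpace R, a p p ≤
      mass R w p.1.2 p.1.2 + (2 * M + 1) * mass R w p.1.1 p.1.1 := by
    intro p
    rw [a_apply]
    have := (abs_le.1 (hM _ _ p.2)).2
    linarith
  have hba : ∀ p, b p p ≤ a p p := fun p => by
    have := hlow p
    have := hc.mass_self_nonneg p.1.2
    rw [b_apply]; linarith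
  have hl2 : ∀ p : sobolevSpace R, ∫ x in Ioo (-R) R, p.1.1 x ^ 2 ≤ c * a p p ∧
      ∫ x in Ioo (-R) R, p.1.2 x ^ 2 ≤ c * a p p := by
    intro p
    have h0 := hlow p
    have h1 := hc.mass_self_nonneg p.1.2
    have h2 := hc.mass_self_nonneg p.1.1
    exact ⟨(hcm _ (SobolevPair.memLp_left p.2 hc.neg_le)).trans (by gcongr; linarith),
      (hcm _ (SobolevPair.memLp p.2)).trans (by gcongr; linarith)⟩
  obtain ⟨y₀, z₀, h₀, h₀e, h₀pos⟩ := hc.exists_orthogonal he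
  obtain ⟨p, hp1, hp2, hp3⟩ := exists_minimizer hsym_a hsym_b hb0 hba (⟨(e, e'), he⟩ : sobolevSpace R)
    (by
      rintro x ⟨K, hK⟩
      obtain ⟨φ, hφ, hcau⟩ := exists_uniformly_cauchy_subseq hc.one_le (fun n => (x n).2)
        (K := c * K) (fun n => (hl2 (x n)).1.trans (by gcongr; exact hK n))
        (fun n => (hl2 (x n)).2.trans (by gcongr; exact hK n))
      refine ⟨φ, hφ, fun ε hε => ?_⟩
      have hR : 0 < R := by linarith [hc.one_le]
      obtain ⟨N, hN⟩ := hcau (√(ε / (C * (2 * R)))) (by positivity)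
      refine ⟨N, fun m hm n hn => ?_⟩
      rw [b_apply]
      have hmem := SobolevPair.memLp_left (x (φ m) - x (φ n)).2 hc.neg_le
      refine (hC _ hmem).trans ?_
      have h1 := setIntegral_mono_on (s := Ioo (-R) R) (μ := volume) hmem.integrable_sq
        (integrableOn_const (C := ε / (C * (2 * R))) (by simp)) measurableSet_Ioo (by
          intro t ht
          have h2 := hN m hm n hn t (Ioo_subset_Icc_self ht)
          have h3 : (x (φ m) - x (φ n)).1.1 t ^ 2 ≤ (√(ε / (C * (2 * R)))) ^ 2 := by
            rw [← sq_abs]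
            exact pow_le_pow_left₀ (abs_nonneg _) h2 2
          rwa [Real.sq_sqrt (by positivity)] at h3)
      rw [setIntegral_const, Real.volume_real_Ioo_of_le hc.neg_le, smul_eq_mul] at h1
      calc _ ≤ C * ((R - -R) * (ε / (C * (2 * R)))) := by gcongr
        _ = ε := by field_simp; ring)
    (by
      intro x hcau
      obtain ⟨y, z, hyz, l1, l2⟩ := exists_sobolevPair_limit hc.one_le (fun n => (x n).2) (by
        intro ε hε
        obtain ⟨N, hN⟩ := hcau (ε / c) (by positivity)
        refine ⟨N, fun m hm n hn => ?_⟩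
        have h1 := hl2 (x m - x n)
        have h2 : c * a (x m - x n) (x m - x n) ≤ ε := by
          calc _ ≤ c * (ε / c) := by gcongr; exact hN m hm n hn
            _ = ε := by field_simp
        exact ⟨h1.1.trans h2, h1.2.trans h2⟩)
      refine ⟨⟨(y, z), hyz⟩, ?_⟩
      have hd : ∀ n, SobolevPair (-R) R (fun t => (x n).1.1 t - y t) (fun t => (x n).1.2 t - z t) :=
        fun n => SobolevPair.sub (x n).2 hyz
      refine squeeze_zero (fun n => (hb0 _).trans (hba _)) (fun n => (hupp _).trans
        (add_le_add (hC _ (hd n).memLp)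
          (mul_le_mul_of_nonneg_left (hC _ ((hd n).memLp_left hc.neg_le)) (by positivity)))) ?_
      have := (l2.const_mul C).add ((l1.const_mul C).const_mul (2 * M + 1))
      simpa using this)
    ⟨⟨(y₀, z₀), h₀⟩, h₀e, h₀pos⟩
  refine ⟨a p p - (M + 1), p.1.1, p.1.2, p.2, hp2, hp1, ?_, ?_, ?_⟩
  · rw [a_apply]
    change mass R w p.1.1 p.1.1 = 1 at hp2
    rw [hp2]; ring
  · intro y z hyz hey
    have := hp3 ⟨(y, z), hyz⟩ hey
    rw [a_apply ⟨(y, z), hyz⟩, b_apply] at this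
    simp only at this
    linarith
  · intro y z hyz hey
    have := bilin_eq_of_minimizer hsym_a hsym_b hp1 hp3 hp2 (y := ⟨(y, z), hyz⟩) hey
    rw [a_apply p ⟨(y, z), hyz⟩, b_apply] at this
    simp only at this
    linarith

/-- `u` is an eigenfunction, with derivative `v`, of `-w⁻¹ (w u')' + V u` on `(-R, R)` with
homogeneous Neumann boundary condition. -/
structure IsEigenfunction (R : ℝ) (w V : ℝ → ℝ) (lam : ℝ) (u v : ℝ → ℝ) : Prop where
  acd : HasACDeriv (-R) R u v
  flux : HasACDeriv (-R) R (fun x => w x * v x) (fun x => (V x - lam) * w x * u x)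
  left : v (-R) = 0
  right : v R = 0

namespace IsEigenfunction

/-- The equation controls the flux w v; since w is C¹ and positive, v = w⁻¹ (w v) is absolutely
continuous too, and in particular continuous up to the ends. -/
lemma hasACDeriv_deriv (h : IsEigenfunction R w V lam u v) (hc : Coefficients R w w' V) :
    HasACDeriv (-R) R v (fun x => (V x - lam) * u x - w' x / w x * v x) := by
  have hi : HasACDeriv (-R) R (fun x => (w x)⁻¹) (fun x => -w' x / w x ^ 2) :=
    HasACDeriv.of_hasDerivAt hc.neg_le (fun x hx => (hc.hasDerivAt x hx).fun_inv (hc.pos x hx).ne')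
      (hc.continuousOn_deriv.neg.div (hc.continuousOn.pow 2)
        fun x hx => (pow_pos (hc.pos x hx) 2).ne')
  have h1 := (hi.mul h.flux).congr hc.neg_le (y := v) (fun x hx => by
    have := (hc.pos x hx).ne'
    simp only; field_simp)
  refine h1.congr_deriv ?_
  filter_upwards [ae_restrict_mem measurableSet_Ioo] with x hx
  have := (hc.pos x (Ioo_subset_Icc_self hx)).ne'
  field_simp
  ring

lemma sobolevPair (h : IsEigenfunction R w V lam u v) (hc : Coefficients R w w' V) :
    SobolevPair (-R) R u v :=
  SobolevPair.of_continuousOn h.acd ((h.hasACDeriv_deriv hc).continuousOn hc.neg_le)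

/-- The weak form of the eigenvalue equation. -/
lemma energy_eq (h : IsEigenfunction R w V lam u v) (hc : Coefficients R w w' V)
    (hyz : SobolevPair (-R) R y z) : energy R w V u v y z = lam * mass R w u y := by
  have h1 := SobolevPair.integral_by_parts hc.neg_le h.flux hyz.acd
  rw [h.left, h.right] at h1
  have hp := h.sobolevPair hc
  have hm := hc.integrable_mass (hp.memLp_left hc.neg_le) (hyz.memLp_left hc.neg_le)
  rw [energy, mass, ← sub_eq_zero, ← integral_const_mul,
    ← integral_sub (hc.integrable_energy hp hyz) (hm.const_mul _)]
  refine Eq.trans (integral_congr_ae (Eventually.of_forall fun x => ?_)) (h1.trans (by ring))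
  simp only; ring

end IsEigenfunction

/-- Regularity of weak eigenfunctions. -/
theorem Coefficients.exists_isEigenfunction (hc : Coefficients R w w' V)
    (h : SobolevPair (-R) R u v)
    (hw : ∀ y z, SobolevPair (-R) R y z → energy R w V u v y z = lam * mass R w u y) :
    ∃ v', v =ᵐ[volume.restrict (Ioo (-R) R)] v' ∧ IsEigenfunction R w V lam u v' := by
  have hab := hc.neg_le
  have h1 : SobolevPair (-R) R (fun _ => 1) (fun _ => 0) := ⟨HasACDeriv.const 1, MemLp.zero⟩
  have hu := h.memLp_left hab
  have hG : IntegrableOn (fun x => (V x - lam) * w x * u x) (Ioo (-R) R) := by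
    have i1 := hc.integrable_potential hu (h1.memLp_left hab)
    have i2 := (hc.integrable_mass hu (h1.memLp_left hab)).const_mul lam
    refine (i1.sub i2).congr (Eventually.of_forall fun x => ?_)
    simp only [Pi.sub_apply]; ring
  -- The primitive P is the candidate for the flux w v; its value 0 at -R encodes the Neumann
  -- condition there.
  have hP := HasACDeriv.of_integral hab hG 0
  set G : ℝ → ℝ := fun x => (V x - lam) * w x * u x with hGdef
  set P : ℝ → ℝ := fun x => 0 + ∫ t in (-R)..x, G t with hPdef
  have hP0 : P (-R) = 0 := by simp [hPdef]
  have hPc := hP.continuousOn hab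
  have hmem : MemLp (fun x => w x * v x - P x) 2 (volume.restrict (Ioo (-R) R)) := by
    obtain ⟨C, hC⟩ := hc.ae_abs_le
    refine MemLp.sub ?_ (memLp_Ioo_of_continuousOn hPc 2)
    exact h.memLp.of_le_mul (c := C) (hc.aestronglyMeasurable.mul h.memLp.1) (by
      filter_upwards [hC] with x hx
      rw [norm_mul]
      exact mul_le_mul_of_nonneg_right hx (norm_nonneg _))
  have key : ∀ y z, SobolevPair (-R) R y z →
      ∫ x in Ioo (-R) R, (w x * v x - P x) * z x = -(P R * y R) := by
    intro y z hyz
    have e1 := hw y z hyz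
    have e2 := SobolevPair.integral_by_parts hab hP hyz.acd
    rw [hP0, zero_mul, sub_zero] at e2
    have i1 := hc.integrable_energy h hyz
    have i2 := hc.integrable_mass hu (hyz.memLp_left hab)
    have i3 : IntegrableOn (fun x => G x * y x + P x * z x) (Ioo (-R) R) :=
      (hP.mul hyz.acd).integrableOn hab
    rw [energy, mass, ← sub_eq_zero, ← integral_const_mul,
      ← integral_sub i1 (i2.const_mul _)] at e1
    have i4 : IntegrableOn (fun x => (v x * z x + V x * u x * y x) * w x
        - lam * (u x * y x * w x)) (Ioo (-R) R) := i1.sub (i2.const_mul _)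
    rw [← e2, ← zero_sub (∫ x in Ioo (-R) R, _), ← e1, ← integral_sub i4 i3]
    refine integral_congr_ae (Eventually.of_forall fun x => ?_)
    simp only [hGdef]; ring
  -- Testing with the constant 1 produces the natural boundary condition at the right end.
  have hPR : P R = 0 := by
    have := key _ _ h1
    simpa using this
  -- Testing with a primitive of w v - P itself makes the integral of its square vanish.
  have hae : (fun x => w x * v x - P x) =ᵐ[volume.restrict (Ioo (-R) R)] 0 := by
    have hy : SobolevPair (-R) R _ (fun x => w x * v x - P x) :=
      ⟨HasACDeriv.of_integral hab (hmem.integrable one_le_two) 0, hmem⟩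
    have e := key _ _ hy
    rw [hPR, zero_mul, neg_zero, integral_eq_zero_iff_of_nonneg
      (fun x => mul_self_nonneg _) (hmem.integrable_mul hmem)] at e
    filter_upwards [e] with x hx
    simpa using hx
  have hvae : v =ᵐ[volume.restrict (Ioo (-R) R)] fun x => P x / w x := by
    filter_upwards [hae, ae_restrict_mem measurableSet_Ioo] with x hx hxi
    have := (hc.pos x (Ioo_subset_Icc_self hxi)).ne'
    simp only [Pi.zero_apply, sub_eq_zero] at hx
    rw [← hx]; field_simp
  refine ⟨fun x => P x / w x, hvae, h.acd.congr_deriv hvae, ?_, ?_, ?_⟩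
  · refine hP.congr hab fun x hx => ?_
    have := (hc.pos x hx).ne'
    field_simp
  · simp [hP0]
  · simp [hPR]

end EigenvalueProblem

/-! ### Uniqueness for the initial value problem, positive ground state, second eigenfunction. -/

section PrincipalEigenfunction

variable {a b R lam : ℝ} {w w' V u v y z e e' : ℝ → ℝ}

lemma HasACDeriv.le_of_ae_nonpos {E D : ℝ → ℝ} (h : HasACDeriv a b E D)
    (hD : ∀ᵐ x, x ∈ Ioo a b → D x ≤ 0) {s t : ℝ} (has : a ≤ s) (hst : s ≤ t) (htb : t ≤ b) :
    E t ≤ E s := by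
  have h1 := (h.mono has hst htb).setIntegral_eq_sub hst
  have h2 : ∫ x in Ioo s t, D x ≤ 0 := by
    refine setIntegral_nonpos_of_ae_restrict ?_
    rw [EventuallyLE, ae_restrict_iff' measurableSet_Ioo]
    filter_upwards [hD] with x hx hxi
    exact hx ⟨has.trans_lt hxi.1, hxi.2.trans_le htb⟩
  linarith

lemma hasACDeriv_exp (hab : a ≤ b) (k : ℝ) :
    HasACDeriv a b (fun x => Real.exp (k * x)) (fun x => k * Real.exp (k * x)) := by
  refine HasACDeriv.of_hasDerivAt hab (fun x _ => ?_) (by fun_prop)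
  have := ((hasDerivAt_id x).const_mul k).exp
  simpa [mul_comm] using this

/-- A uniqueness lemma of Gronwall type. -/
lemma HasACDeriv.eq_zero_of_gronwall (hab : a ≤ b) {E D : ℝ → ℝ} (h : HasACDeriv a b E D) {L : ℝ}
    (hD : ∀ᵐ x, x ∈ Ioo a b → |D x| ≤ L * E x) (hE : ∀ x ∈ Icc a b, 0 ≤ E x)
    {x₀ : ℝ} (hx₀ : x₀ ∈ Icc a b) (h0 : E x₀ = 0) : ∀ x ∈ Icc a b, E x = 0 := by
  intro x hx
  refine le_antisymm ?_ (hE x hx)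
  rcases le_total x₀ x with hle | hle
  -- To the right of the zero, E exp(-L x) is nonincreasing.
  · have h1 := (h.mul (hasACDeriv_exp hab (-L))).le_of_ae_nonpos (by
      filter_upwards [hD] with t ht hti
      have h2 := (abs_le.1 (ht hti)).2
      nlinarith [Real.exp_pos (-L * t)]) hx₀.1 hle hx.2
    simp only [h0, zero_mul] at h1
    exact nonpos_of_mul_nonpos_left h1 (Real.exp_pos _)
  -- To the left of the zero, E exp(L x) is nondecreasing.
  · have h1 := ((h.mul (hasACDeriv_exp hab L)).const_mul (-1)).le_of_ae_nonpos (by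
      filter_upwards [hD] with t ht hti
      have h2 := (abs_le.1 (ht hti)).1
      nlinarith [Real.exp_pos (L * t)]) hx.1 hle hx₀.2
    simp only [h0, zero_mul, mul_zero] at h1
    exact nonpos_of_mul_nonpos_left (b := Real.exp (L * x)) (by linarith) (Real.exp_pos _)

lemma HasACDeriv.hasDerivAt_of_continuousOn (h : HasACDeriv a b u v)
    (hv : ContinuousOn v (Icc a b)) {x : ℝ} (hx : x ∈ Ioo a b) : HasDerivAt u (v x) x := by
  have hab : a ≤ b := (hx.1.trans hx.2).le
  have hint : IntervalIntegrable v volume a x :=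
    ((hv.mono (Icc_subset_Icc_right hx.2.le)).intervalIntegrable_of_Icc hx.1.le)
  have hcont : ContinuousAt v x := hv.continuousAt (Icc_mem_nhds hx.1 hx.2)
  have h1 : HasDerivAt (fun x => u a + ∫ t in a..x, v t) (v x) x := by
    refine (intervalIntegral.integral_hasDerivAt_right hint ?_ hcont).const_add _
    exact (hv.mono Ioo_subset_Icc_self).stronglyMeasurableAtFilter isOpen_Ioo x hx
  refine h1.congr_of_eventuallyEq ?_
  filter_upwards [Ioo_mem_nhds hx.1 hx.2] with t ht
  rw [h.eq_add_integral (Ioo_subset_Icc_self ht), intervalIntegral.integral_of_le ht.1.le,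
    integral_Ioc_eq_integral_Ioo]

/-- Uniqueness for the initial value problem of the eigenvalue equation. -/
lemma IsEigenfunction.eq_zero_of_initial (hc : Coefficients R w w' V)
    (h : IsEigenfunction R w V lam u v) {x₀ : ℝ} (hx₀ : x₀ ∈ Icc (-R) R) (hu : u x₀ = 0)
    (hv : v x₀ = 0) : ∀ x ∈ Icc (-R) R, u x = 0 := by
  obtain ⟨M, hM⟩ := hc.bounded
  obtain ⟨C, hC0, hC⟩ := hc.exists_upper
  obtain ⟨c, hc0, hcw⟩ := hc.exists_lower
  -- Gronwall is applied to u² + (w v)²; using the flux in place of v keeps the derivative of the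
  -- weight out of the estimate.
  have hE := (h.acd.mul h.acd).add (h.flux.mul h.flux)
  have key := hE.eq_zero_of_gronwall hc.neg_le (L := c⁻¹ + (|M| + |lam|) * C) (by
    rw [ae_restrict_iff' measurableSet_Ioo] at hM
    filter_upwards [hM] with x hx hxi
    have hxi' := Ioo_subset_Icc_self hxi
    have hw := hc.pos x hxi'
    set p := w x * v x with hp
    have e1 : v x = (w x)⁻¹ * p := by rw [hp]; field_simp
    have h1 : (w x)⁻¹ ≤ c⁻¹ := inv_anti₀ hc0 (hcw x hxi')
    have h2 : |(V x - lam) * w x| ≤ (|M| + |lam|) * C := by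
      rw [abs_mul, abs_of_pos hw]
      refine mul_le_mul ?_ (hC x hxi') hw.le (by positivity)
      have h5 := abs_le.1 ((hx hxi).trans (le_abs_self M))
      rw [abs_le]
      constructor <;> linarith [le_abs_self lam, neg_abs_le lam]
    have e2 : v x * u x + u x * v x + ((V x - lam) * w x * u x * p + p * ((V x - lam) * w x * u x))
        = (2 * (u x * p)) * ((w x)⁻¹ + (V x - lam) * w x) := by rw [e1]; ring
    rw [e2, abs_mul, mul_comm]
    have h3 : |2 * (u x * p)| ≤ u x * u x + p * p := by
      rw [abs_le]; constructor <;> nlinarith [sq_nonneg (u x + p), sq_nonneg (u x - p)]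
    refine mul_le_mul ?_ h3 (abs_nonneg _) (by positivity)
    refine (abs_add_le _ _).trans (add_le_add ?_ h2)
    rwa [abs_of_pos (inv_pos.2 hw)])
    (fun x _ => add_nonneg (mul_self_nonneg _) (mul_self_nonneg _)) hx₀ (by simp [hu, hv])
  intro x hx
  have := key x hx
  nlinarith [mul_self_nonneg (u x), mul_self_nonneg (w x * v x)]

/-- Minimizers of the Rayleigh quotient are weak eigenfunctions. -/
lemma Coefficients.energy_eq_of_minimizer (hc : Coefficients R w w' V)
    (h : SobolevPair (-R) R u v) (h1 : mass R w u u = 1) (hmin : ∀ y z, SobolevPair (-R) R y z →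
      energy R w V u v u v * mass R w y y ≤ energy R w V y z y z) (hyz : SobolevPair (-R) R y z) :
    energy R w V u v y z = energy R w V u v u v * mass R w u y :=
  bilin_eq_of_minimizer (a := energyForm hc) (b := massForm hc) (fun _ _ => energy_comm)
    (fun _ _ => mass_comm) (e := 0) (x := ⟨(u, v), h⟩) (by simp)
    (fun p _ => hmin p.1.1 p.1.2 p.2) h1 (y := ⟨(y, z), hyz⟩) (by simp)

/-- Existence of a positive eigenfunction to the lowest eigenvalue. -/
theorem Coefficients.exists_principal (hc : Coefficients R w w' V) :
    ∃ lam u v, IsEigenfunction R w V lam u v ∧ mass R w u u = 1 ∧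
      (∀ x ∈ Icc (-R) R, 0 < u x) ∧
      ∀ y z, SobolevPair (-R) R y z → lam * mass R w y y ≤ energy R w V y z y z := by
  have h0 : SobolevPair (-R) R (fun _ => 0) (fun _ => 0) := ⟨HasACDeriv.const 0, MemLp.zero⟩
  have hm0 : ∀ y : ℝ → ℝ, mass R w (fun _ => 0) y = 0 := fun y => by simp [mass]
  -- Orthogonality to the zero function is no constraint, so this is the unconstrained minimum.
  obtain ⟨lam, u, v, huv, h1, -, he, hmin, -⟩ := hc.exists_weak_eigenpair h0
  have habs := huv.abs hc.neg_le
  have hmabs : mass R w (fun x => |u x|) (fun x => |u x|) = 1 := by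
    rw [← h1]; simp [mass]
  -- Passing to |u| keeps the mass and does not raise the energy, so |u| is a minimizer as well and
  -- solves the same equation.
  have hle : energy R w V (fun x => |u x|) (deriv fun x => |u x|) (fun x => |u x|)
      (deriv fun x => |u x|) ≤ lam := by
    rw [← he]
    refine integral_mono_ae (hc.integrable_energy habs habs) (hc.integrable_energy huv huv) ?_
    have := huv.acd.abs_deriv_abs_le hc.neg_le
    rw [← ae_restrict_iff' measurableSet_Ioo] at this
    filter_upwards [this, ae_restrict_mem measurableSet_Ioo] with x hx hxi
    refine mul_le_mul_of_nonneg_right ?_ (hc.pos x (Ioo_subset_Icc_self hxi)).le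
    have h2 := sq_le_sq.2 hx
    have h3 : V x * |u x| * |u x| = V x * u x * u x := by
      rw [mul_assoc, abs_mul_abs_self, mul_assoc]
    rw [h3]
    nlinarith
  have heq := le_antisymm hle (by simpa [hmabs] using hmin _ _ habs (hm0 _))
  obtain ⟨v', -, hv'⟩ := hc.exists_isEigenfunction (lam := lam) habs (fun y z hyz => by
    rw [← heq]
    exact hc.energy_eq_of_minimizer habs hmabs (fun y z hyz => by
      rw [heq]; exact hmin y z hyz (hm0 _)) hyz)
  refine ⟨lam, _, v', hv', hmabs, fun x hx => ?_, fun y z hyz => hmin y z hyz (hm0 _)⟩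
  by_contra hcon
  have hux : |u x| = 0 := le_antisymm (not_lt.1 hcon) (abs_nonneg _)
  -- A zero of |u| is an interior minimum or an end point; the derivative vanishes in the first case
  -- by Fermat and in the second by the boundary condition.
  have hvx : v' x = 0 := by
    rcases hx.1.eq_or_lt with rfl | hl
    · exact hv'.left
    rcases hx.2.eq_or_lt with rfl | hr
    · exact hv'.right
    have hd := hv'.acd.hasDerivAt_of_continuousOn
      ((hv'.hasACDeriv_deriv hc).continuousOn hc.neg_le) ⟨hl, hr⟩
    refine IsLocalMin.hasDerivAt_eq_zero (Eventually.of_forall fun t => ?_) hd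
    change |u x| ≤ |u t|
    rw [hux]; exact abs_nonneg _
  have hz := hv'.eq_zero_of_initial hc hx hux hvx
  have : mass R w (fun x => |u x|) (fun x => |u x|) = 0 := by
    refine setIntegral_eq_zero_of_forall_eq_zero fun t ht => ?_
    simp [show |u t| = 0 from hz t (Ioo_subset_Icc_self ht)]
  linarith

/-- Existence of an eigenfunction minimizing the energy on the complement of an eigenfunction. -/
theorem Coefficients.exists_second (hc : Coefficients R w w' V)
    (he : IsEigenfunction R w V lam e e') (h1 : mass R w e e = 1) :
    ∃ lam₂ u v, IsEigenfunction R w V lam₂ u v ∧ mass R w u u = 1 ∧ mass R w e u = 0 ∧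
      ∀ y z, SobolevPair (-R) R y z → mass R w e y = 0 →
        lam₂ * mass R w y y ≤ energy R w V y z y z := by
  have hep := he.sobolevPair hc
  obtain ⟨lam₂, u, v, huv, hu1, heu, hE, hmin, hweak⟩ := hc.exists_weak_eigenpair hep
  obtain ⟨v', -, hv'⟩ := hc.exists_isEigenfunction (lam := lam₂) huv (fun y z hyz => by
    -- The constrained minimizer satisfies the weak equation only against functions orthogonal to e.
    -- A general y is projected; the removed multiple of e contributes nothing, as e is an
    -- eigenfunction and orthogonal to u.
    set t := mass R w e y with ht
    have hy' := hyz.add (hep.const_mul (-t))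
    have hey : mass R w e (fun x => y x + -t * e x) = 0 := by
      rw [mass_comm, hc.mass_add (hyz.memLp_left hc.neg_le)
        ((hep.const_mul (-t)).memLp_left hc.neg_le) (hep.memLp_left hc.neg_le),
        mass_const_mul, h1, mass_comm, ← ht]
      ring
    have e1 := hweak _ _ hy' hey
    rw [energy_comm, hc.energy_add hyz (hep.const_mul (-t)) huv, energy_const_mul,
      he.energy_eq hc huv, heu, mass_comm, hc.mass_add (hyz.memLp_left hc.neg_le)
        ((hep.const_mul (-t)).memLp_left hc.neg_le) (huv.memLp_left hc.neg_le),
        mass_const_mul, heu] at e1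
    rw [energy_comm, mass_comm (u := u)]
    linarith)
  exact ⟨lam₂, u, v', hv', hu1, heu, hmin⟩

end PrincipalEigenfunction

/-! ### Passage between functions with values in 𝕜 and pairs of real functions. -/

section Complexification

variable {𝕜 : Type*} [RCLike 𝕜] {R lam : ℝ} {w w' V u v r s z p p' : ℝ → ℝ} {Ψ Φ : ℝ → 𝕜}

/-- `r`, `s` represent the real and the imaginary part of `Ψ ∈ H¹(-R, R)`, and `v`, `z` those
of its weak derivative. -/
structure Represents (R : ℝ) (Ψ : ℝ → 𝕜) (r v s z : ℝ → ℝ) : Prop where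
  re : SobolevPair (-R) R r v
  im : SobolevPair (-R) R s z
  ae_eq : ∀ᵐ x ∂(volume.restrict (Ioo (-R) R)), RCLike.re (Ψ x) = r x ∧ RCLike.im (Ψ x) = s x ∧
    RCLike.re (weakDeriv (Ioo (-R) R) Ψ x) = v x ∧ RCLike.im (weakDeriv (Ioo (-R) R) Ψ x) = z x

lemma HasACDeriv.re_weakDeriv_ae_eq (hR : -R ≤ R) {Θ : ℝ → 𝕜} (h : HasWeakDeriv (Ioo (-R) R) Ψ Θ)
    (hr : HasACDeriv (-R) R r v)
    (hre : ∀ᵐ x ∂(volume.restrict (Ioo (-R) R)), RCLike.re (Ψ x) = r x) :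
    ∀ᵐ x ∂(volume.restrict (Ioo (-R) R)), RCLike.re (weakDeriv (Ioo (-R) R) Ψ x) = v x :=
  (h.hasWeakDeriv_weakDeriv.re.congr isOpen_Ioo hre (EventuallyEq.refl _ _)).ae_eq isOpen_Ioo
    (hr.hasWeakDeriv hR)

lemma HasACDeriv.im_weakDeriv_ae_eq (hR : -R ≤ R) {Θ : ℝ → 𝕜} (h : HasWeakDeriv (Ioo (-R) R) Ψ Θ)
    (hr : HasACDeriv (-R) R r v)
    (hre : ∀ᵐ x ∂(volume.restrict (Ioo (-R) R)), RCLike.im (Ψ x) = r x) :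
    ∀ᵐ x ∂(volume.restrict (Ioo (-R) R)), RCLike.im (weakDeriv (Ioo (-R) R) Ψ x) = v x :=
  (h.hasWeakDeriv_weakDeriv.im.congr isOpen_Ioo hre (EventuallyEq.refl _ _)).ae_eq isOpen_Ioo
    (hr.hasWeakDeriv hR)

lemma MemH1.exists_represents (hR : -R < R) (h : MemH1 (Ioo (-R) R) Ψ) :
    ∃ r v s z, Represents R Ψ r v s z := by
  obtain ⟨r, v, s, z, h1, h2, h3⟩ := h.exists_sobolevPair hR
  exact ⟨r, v, s, z, h1, h2, h3⟩

lemma SobolevPair.memH1_of_re_im (hR : -R ≤ R) (hr : SobolevPair (-R) R r v)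
    (hs : SobolevPair (-R) R s z)
    (h : ∀ᵐ x ∂(volume.restrict (Ioo (-R) R)), RCLike.re (Ψ x) = r x ∧ RCLike.im (Ψ x) = s x) :
    MemH1 (Ioo (-R) R) Ψ ∧ Represents R Ψ r v s z := by
  have h' : ∀ᵐ x ∂(volume.restrict (Ioo (-R) R)), Ψ x = r x + s x * RCLike.I := by
    filter_upwards [h] with x hx
    rw [← hx.1, ← hx.2, RCLike.re_add_im]
  have hd := hr.hasWeakDeriv_of_ae_eq hR hs h'
  refine ⟨hr.memH1_of_ae_eq hR hs h', hr, hs, ?_⟩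
  filter_upwards [h, hr.acd.re_weakDeriv_ae_eq hR hd (h.mono fun x hx => hx.1),
    hs.acd.im_weakDeriv_ae_eq hR hd (h.mono fun x hx => hx.2)] with x h1 h2 h3
  exact ⟨h1.1, h1.2, h2, h3⟩

lemma sobolevPair_zero : SobolevPair (-R) R (fun _ => 0) (fun _ => 0) :=
  ⟨HasACDeriv.const 0, MemLp.zero⟩

lemma SobolevPair.memH1_of_real (hR : -R ≤ R) (hr : SobolevPair (-R) R r v)
    (h : ∀ᵐ x ∂(volume.restrict (Ioo (-R) R)), Ψ x = (r x : 𝕜)) :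
    MemH1 (Ioo (-R) R) Ψ ∧ Represents R Ψ r v (fun _ => 0) (fun _ => 0) ∧
      ∀ᵐ x ∂(volume.restrict (Ioo (-R) R)), weakDeriv (Ioo (-R) R) Ψ x = (v x : 𝕜) := by
  obtain ⟨h1, h2⟩ := hr.memH1_of_re_im hR sobolevPair_zero (Ψ := Ψ) (by
    filter_upwards [h] with x hx
    simp [hx])
  refine ⟨h1, h2, ?_⟩
  filter_upwards [h2.ae_eq] with x hx
  apply RCLike.ext
  · rw [hx.2.2.1, RCLike.ofReal_re]
  · rw [hx.2.2.2, RCLike.ofReal_im]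

lemma mass_zero : mass R w (fun _ => 0) (fun _ => 0) = 0 := by simp [mass]

lemma energy_zero : energy R w V (fun _ => 0) (fun _ => 0) (fun _ => 0) (fun _ => 0) = 0 := by
  simp [energy]

lemma Represents.wNorm_eq (hc : Coefficients R w w' V) (h : Represents R Ψ r v s z) :
    wNorm R w Ψ = √(mass R w r r + mass R w s s) := by
  have hr := h.re.memLp_left hc.neg_le
  have hs := h.im.memLp_left hc.neg_le
  rw [wNorm, mass, mass, ← integral_add (hc.integrable_mass hr hr) (hc.integrable_mass hs hs)]
  congr 1
  refine integral_congr_ae ?_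
  filter_upwards [h.ae_eq] with x hx
  rw [RCLike.norm_sq_eq_def, hx.1, hx.2.1]
  ring

lemma Represents.mass_eq_one (hc : Coefficients R w w' V) (h : Represents R Ψ r v s z)
    (h1 : wNorm R w Ψ = 1) : mass R w r r + mass R w s s = 1 := by
  rwa [h.wNorm_eq hc, Real.sqrt_eq_one] at h1

lemma Represents.wNorm_weakDeriv_eq (hc : Coefficients R w w' V) (h : Represents R Ψ r v s z) :
    wNorm R w (weakDeriv (Ioo (-R) R) Ψ) = √(mass R w v v + mass R w z z) := by
  rw [wNorm, mass, mass, ← integral_add (hc.integrable_mass h.re.memLp h.re.memLp)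
    (hc.integrable_mass h.im.memLp h.im.memLp)]
  congr 1
  refine integral_congr_ae ?_
  filter_upwards [h.ae_eq] with x hx
  rw [RCLike.norm_sq_eq_def, hx.2.2.1, hx.2.2.2]
  ring

lemma Represents.wForm_eq (hc : Coefficients R w w' V) (h : Represents R Ψ r v s z) :
    wForm R w V Ψ Ψ = ((energy R w V r v r v + energy R w V s z s z : ℝ) : 𝕜) := by
  rw [wForm, energy, energy, ← integral_add (hc.integrable_energy h.re h.re)
    (hc.integrable_energy h.im h.im), ← integral_ofReal]
  refine integral_congr_ae ?_
  filter_upwards [h.ae_eq] with x hx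
  rw [mul_assoc (V x : 𝕜), RCLike.mul_conj, RCLike.mul_conj]
  simp only [← RCLike.ofReal_pow, RCLike.norm_sq_eq_def, hx.1, hx.2.1, hx.2.2.1, hx.2.2.2,
    ← RCLike.ofReal_mul, ← RCLike.ofReal_add]
  congr 1
  ring

lemma Represents.re_wForm_eq (hc : Coefficients R w w' V) (h : Represents R Ψ r v s z) :
    RCLike.re (wForm R w V Ψ Ψ) = energy R w V r v r v + energy R w V s z s z := by
  rw [h.wForm_eq hc, RCLike.ofReal_re]

lemma Represents.wInner_eq (hc : Coefficients R w w' V) (h : Represents R Ψ r v s z)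
    (hp : MemLp p 2 (volume.restrict (Ioo (-R) R)))
    (hΦ : ∀ᵐ x ∂(volume.restrict (Ioo (-R) R)), Φ x = (p x : 𝕜)) :
    wInner R w Ψ Φ = (mass R w r p : 𝕜) + mass R w s p * RCLike.I := by
  have i1 := hc.integrable_mass (h.re.memLp_left hc.neg_le) hp
  have i2 := hc.integrable_mass (h.im.memLp_left hc.neg_le) hp
  rw [wInner, mass, mass, ← integral_ofReal, ← integral_ofReal, ← integral_mul_const,
    ← integral_add (Integrable.ofReal i1) ((Integrable.ofReal i2).mul_const _)]
  refine integral_congr_ae ?_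
  filter_upwards [h.ae_eq, hΦ] with x hx hx2
  rw [hx2, ← RCLike.re_add_im (Ψ x), hx.1, hx.2.1]
  simp only [RCLike.conj_ofReal, RCLike.ofReal_mul]
  ring

lemma Represents.mass_eq_zero (hc : Coefficients R w w' V) (h : Represents R Ψ r v s z)
    (hp : MemLp p 2 (volume.restrict (Ioo (-R) R)))
    (hΦ : ∀ᵐ x ∂(volume.restrict (Ioo (-R) R)), Φ x = (p x : 𝕜)) (h0 : wInner R w Ψ Φ = 0) :
    mass R w p r = 0 ∧ mass R w p s = 0 := by
  rw [h.wInner_eq hc hp hΦ] at h0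
  have h1 := congrArg RCLike.re h0
  have h2 := congrArg RCLike.im h0
  rw [mass_comm, mass_comm (u := p)]
  simp only [map_add, RCLike.ofReal_re, RCLike.re_ofReal_mul, RCLike.I_re, mul_zero, add_zero,
    map_zero, RCLike.ofReal_im, zero_add, RCLike.im_ofReal_mul] at h1 h2
  refine ⟨h1, ?_⟩
  -- For real scalars I = 0 and the imaginary component of the equation is void, but then s itself
  -- vanishes almost everywhere.
  rcases RCLike.I_eq_zero_or_im_I_eq_one (K := 𝕜) with hI | hI
  · refine integral_eq_zero_of_ae ?_
    filter_upwards [h.ae_eq] with x hx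
    simp [← hx.2.1, RCLike.im_eq_zero hI]
  · rwa [hI, mul_one] at h2

lemma SobolevPair.weight_mul (hc : Coefficients R w w' V) (h : SobolevPair (-R) R r v) :
    SobolevPair (-R) R (fun x => w x * r x) (fun x => w' x * r x + w x * v x) := by
  refine ⟨hc.hasACDeriv.mul h.acd, MemLp.add ?_ ?_⟩
  · exact memLp_Ioo_of_continuousOn (hc.continuousOn_deriv.mul (h.continuousOn hc.neg_le)) 2
  · obtain ⟨C, hC⟩ := hc.ae_abs_le
    exact h.memLp.of_le_mul (c := C) (hc.aestronglyMeasurable.mul h.memLp.1) (by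
      filter_upwards [hC] with x hx
      rw [norm_mul]
      exact mul_le_mul_of_nonneg_right hx (norm_nonneg _))

/-- Real and imaginary part of an eigenfunction are real eigenfunctions. -/
theorem IsNormalizedEigenfunction.exists_isEigenfunction (hc : Coefficients R w w' V)
    (h : IsNormalizedEigenfunction R w V lam Ψ) :
    ∃ r v s z, Represents R Ψ r v s z ∧ IsEigenfunction R w V lam r v ∧
      IsEigenfunction R w V lam s z := by
  obtain ⟨⟨⟨hΨ, hΨ'⟩, g, hg, hga, hgl, hgr⟩, -, heq⟩ := h
  have hab := hc.neg_le
  obtain ⟨r, v, s, z, hrep⟩ := hΨ.exists_represents hc.neg_lt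
  obtain ⟨r₁, v₁, s₁, z₁, hrep'⟩ := hΨ'.exists_represents hc.neg_lt
  have hv : v =ᵐ[volume.restrict (Ioo (-R) R)] r₁ := by
    filter_upwards [hrep.ae_eq, hrep'.ae_eq] with x h1 h2
    rw [← h1.2.2.1, h2.1]
  have hz : z =ᵐ[volume.restrict (Ioo (-R) R)] s₁ := by
    filter_upwards [hrep.ae_eq, hrep'.ae_eq] with x h1 h2
    rw [← h1.2.2.2, h2.2.1]
  -- Two continuous representatives of the derivative agree up to the end points, which transfers
  -- the Neumann condition to the real representative.
  have hgre : EqOn (fun x => RCLike.re (g x)) r₁ (Icc (-R) R) := by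
    refine eqOn_Icc_of_ae_eq_Ioo hc.neg_lt ?_ (RCLike.continuous_re.comp_continuousOn hg)
      (hrep'.re.continuousOn hab)
    filter_upwards [hga, hrep'.ae_eq] with x h1 h2
    rw [h1, h2.1]
  have hgim : EqOn (fun x => RCLike.im (g x)) s₁ (Icc (-R) R) := by
    refine eqOn_Icc_of_ae_eq_Ioo hc.neg_lt ?_ (RCLike.continuous_im.comp_continuousOn hg)
      (hrep'.im.continuousOn hab)
    filter_upwards [hga, hrep'.ae_eq] with x h1 h2
    rw [h1, h2.2.1]
  have hr₁ := hrep'.re.weight_mul hc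
  have hs₁ := hrep'.im.weight_mul hc
  obtain ⟨-, hflux⟩ := hr₁.memH1_of_re_im hab hs₁
    (Ψ := fun y => (w y : 𝕜) * weakDeriv (Ioo (-R) R) Ψ y) (by
      filter_upwards [hrep'.ae_eq] with x hx
      simp [hx.1, hx.2.1])
  have hl := left_mem_Icc.2 hab
  have hr := right_mem_Icc.2 hab
  refine ⟨r, r₁, s, s₁, ⟨hrep.re.congr_deriv hv, hrep.im.congr_deriv hz, ?_⟩,
    ⟨hrep.re.acd.congr_deriv hv, hr₁.acd.congr_deriv ?_, ?_, ?_⟩,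
    ⟨hrep.im.acd.congr_deriv hz, hs₁.acd.congr_deriv ?_, ?_, ?_⟩⟩
  · filter_upwards [hrep.ae_eq, hv, hz] with x h1 h2 h3
    rw [← h2, ← h3]; exact h1
  · filter_upwards [heq, hrep.ae_eq, hflux.ae_eq, ae_restrict_mem measurableSet_Ioo]
      with x h1 h2 h3 h4
    have hw := (hc.pos x (Ioo_subset_Icc_self h4)).ne'
    have h5 := congrArg RCLike.re h1
    rw [wOp, ← RCLike.ofReal_inv, map_add, map_neg, RCLike.re_ofReal_mul, RCLike.re_ofReal_mul,
      RCLike.re_ofReal_mul, h3.2.2.1, h2.1] at h5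
    field_simp at h5
    linarith
  · rw [← hgre hl]; simp [hgl]
  · rw [← hgre hr]; simp [hgr]
  · filter_upwards [heq, hrep.ae_eq, hflux.ae_eq, ae_restrict_mem measurableSet_Ioo]
      with x h1 h2 h3 h4
    have hw := (hc.pos x (Ioo_subset_Icc_self h4)).ne'
    have h5 := congrArg RCLike.im h1
    rw [wOp, ← RCLike.ofReal_inv, map_add, map_neg, RCLike.im_ofReal_mul, RCLike.im_ofReal_mul,
      RCLike.im_ofReal_mul, h3.2.2.2, h2.2.1] at h5
    field_simp at h5
    linarith
  · rw [← hgim hl]; simp [hgl]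
  · rw [← hgim hr]; simp [hgr]

/-- Real eigenfunctions are eigenfunctions. -/
theorem IsEigenfunction.isNormalizedEigenfunction (hc : Coefficients R w w' V)
    (h : IsEigenfunction R w V lam u v) (h1 : mass R w u u = 1) :
    IsNormalizedEigenfunction R w V lam (fun x => (u x : 𝕜)) := by
  have hab := hc.neg_le
  have hu := h.sobolevPair hc
  obtain ⟨m1, rep1, d1⟩ := hu.memH1_of_real hab (Ψ := fun x => (u x : 𝕜))
    (Eventually.of_forall fun x => rfl)
  have hV : MemLp (fun x => (V x - lam) * u x - w' x / w x * v x) 2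
      (volume.restrict (Ioo (-R) R)) := by
    have hvc := (h.hasACDeriv_deriv hc).continuousOn hab
    refine MemLp.sub ?_ (memLp_Ioo_of_continuousOn ((hc.continuousOn_deriv.div hc.continuousOn
      fun x hx => (hc.pos x hx).ne').mul hvc) 2)
    obtain ⟨M, hM⟩ := hc.bounded
    refine (hu.memLp_left hab).of_le_mul (c := M + |lam|)
      ((hc.measurable.sub aestronglyMeasurable_const).mul (hu.memLp_left hab).1) ?_
    filter_upwards [hM] with x hx
    rw [norm_mul]
    refine mul_le_mul_of_nonneg_right ((norm_sub_le _ _).trans ?_) (norm_nonneg _)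
    exact add_le_add hx le_rfl
  have hv : SobolevPair (-R) R v _ := ⟨h.hasACDeriv_deriv hc, hV⟩
  obtain ⟨m2, -, -⟩ := hv.memH1_of_real hab d1
  have hflux : SobolevPair (-R) R (fun x => w x * v x) (fun x => (V x - lam) * w x * u x) :=
    (hv.weight_mul hc).congr_deriv (by
      filter_upwards [ae_restrict_mem measurableSet_Ioo] with x hx
      have := (hc.pos x (Ioo_subset_Icc_self hx)).ne'
      field_simp
      ring)
  obtain ⟨-, -, d3⟩ := hflux.memH1_of_real hab
    (Ψ := fun y => (w y : 𝕜) * weakDeriv (Ioo (-R) R) (fun x => (u x : 𝕜)) y) (by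
      filter_upwards [d1] with x hx
      rw [hx, RCLike.ofReal_mul])
  refine ⟨⟨⟨m1, m2⟩, fun x => (v x : 𝕜), ?_, ?_, ?_, ?_⟩, ?_, ?_⟩
  · exact RCLike.continuous_ofReal.comp_continuousOn (hv.continuousOn hab)
  · filter_upwards [d1] with x hx
    rw [hx]
  · simp [h.left]
  · simp [h.right]
  · rw [rep1.wNorm_eq hc, h1, mass_zero, add_zero, Real.sqrt_one]
  · filter_upwards [d3, ae_restrict_mem measurableSet_Ioo] with x h3 h4
    have hw := (hc.pos x (Ioo_subset_Icc_self h4)).ne'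
    rw [wOp, h3, ← RCLike.ofReal_inv, ← RCLike.ofReal_mul, ← RCLike.ofReal_mul,
      ← RCLike.ofReal_mul, ← RCLike.ofReal_neg, ← RCLike.ofReal_add]
    congr 1
    field_simp
    ring

/-- The first eigenvalue is the minimum of the energy. -/
theorem IsEigenfunction.isNthEigenvalue_one (hc : Coefficients R w w' V)
    (h : IsEigenfunction R w V lam u v) (h1 : mass R w u u = 1)
    (hmin : ∀ y z, SobolevPair (-R) R y z → lam * mass R w y y ≤ energy R w V y z y z) :
    IsNthEigenvalue 𝕜 R w V 1 lam := by
  refine ⟨⟨fun _ x => (u x : 𝕜), fun _ => lam,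
    fun _ => ⟨h.isNormalizedEigenfunction hc h1, le_rfl⟩,
    fun i j hij => absurd (Subsingleton.elim i j) hij⟩, ?_⟩
  rintro μ ⟨φ, ν, hφ, -⟩
  obtain ⟨hφ0, hν⟩ := hφ 0
  obtain ⟨r, v₁, s, z₁, hrep, hr, hs⟩ := hφ0.exists_isEigenfunction hc
  have hm := hrep.mass_eq_one hc hφ0.2.1
  have e1 := hr.energy_eq hc (hr.sobolevPair hc)
  have e2 := hs.energy_eq hc (hs.sobolevPair hc)
  have l1 := hmin _ _ (hr.sobolevPair hc)
  have l2 := hmin _ _ (hs.sobolevPair hc)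
  rw [e1] at l1
  rw [e2] at l2
  have : lam * (mass R w r r + mass R w s s) ≤ ν 0 * (mass R w r r + mass R w s s) := by linarith
  rw [hm] at this
  linarith

/-- Eigenfunctions to eigenvalues below the second one are multiples of the first eigenfunction. -/
lemma IsEigenfunction.eq_mass_mul (hc : Coefficients R w w' V)
    {ν lam₂ : ℝ} (hp : IsEigenfunction R w V lam p p') (hp1 : mass R w p p = 1)
    (hmin : ∀ y z, SobolevPair (-R) R y z → mass R w p y = 0 →
      lam₂ * mass R w y y ≤ energy R w V y z y z)
    (hr : IsEigenfunction R w V ν r v) (hν : ν < lam₂) :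
    ∀ x ∈ Icc (-R) R, r x = mass R w p r * p x := by
  have hrp := hr.sobolevPair hc
  have hpp := hp.sobolevPair hc
  have hrm := hrp.memLp_left hc.neg_le
  have hpm := hpp.memLp_left hc.neg_le
  set t := mass R w p r with ht
  have hd := hrp.add (hpp.const_mul (-t))
  have hdm := hd.memLp_left hc.neg_le
  have hcm := (hpp.const_mul (-t)).memLp_left hc.neg_le
  have hpd : mass R w p (fun x => r x + -t * p x) = 0 := by
    rw [mass_comm, hc.mass_add hrm hcm hpm, mass_const_mul, hp1, mass_comm, ← ht]
    ring
  have e1 : energy R w V r v p p' = ν * t := by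
    rw [hr.energy_eq hc hpp, mass_comm, ← ht]
  have e2 : energy R w V r v p p' = lam * t := by
    rw [energy_comm, hp.energy_eq hc hrp, ← ht]
  -- The component of r orthogonal to p has Rayleigh quotient ν, strictly below the minimum on the
  -- complement, so its mass is zero.
  have key : energy R w V (fun x => r x + -t * p x) (fun x => v x + -t * p' x)
      (fun x => r x + -t * p x) (fun x => v x + -t * p' x)
      = ν * mass R w (fun x => r x + -t * p x) (fun x => r x + -t * p x) := by
    rw [hc.energy_add hrp (hpp.const_mul (-t)) hd, energy_const_mul, hr.energy_eq hc hd,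
      hp.energy_eq hc hd, hpd, hc.mass_add hrm hcm hdm, mass_const_mul, hpd]
    ring
  have h0 := hmin _ _ hd hpd
  rw [key] at h0
  have hm0 : mass R w (fun x => r x + -t * p x) (fun x => r x + -t * p x) = 0 := by
    have := hc.mass_self_nonneg (fun x => r x + -t * p x)
    nlinarith
  intro x hx
  have := hc.eqOn_zero_of_mass_eq_zero (hd.continuousOn hc.neg_le) hm0 x hx
  linarith

/-- The second eigenvalue is the minimum of the energy on the orthogonal complement of the first
eigenfunction. -/
theorem IsEigenfunction.isNthEigenvalue_two (hc : Coefficients R w w' V)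
    {lam₂ : ℝ} (hp : IsEigenfunction R w V lam p p') (hp1 : mass R w p p = 1)
    (h : IsEigenfunction R w V lam₂ u v) (h1 : mass R w u u = 1) (hpu : mass R w p u = 0)
    (hle : lam ≤ lam₂) (hmin : ∀ y z, SobolevPair (-R) R y z → mass R w p y = 0 →
      lam₂ * mass R w y y ≤ energy R w V y z y z) :
    IsNthEigenvalue 𝕜 R w V 2 lam₂ := by
  have hpp := hp.sobolevPair hc
  have hpm := hpp.memLp_left hc.neg_le
  have hu := h.sobolevPair hc
  constructor
  · refine ⟨![fun x => (p x : 𝕜), fun x => (u x : 𝕜)], ![lam, lam₂], ?_, ?_⟩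
    · intro i
      fin_cases i
      · exact ⟨hp.isNormalizedEigenfunction hc hp1, hle⟩
      · exact ⟨h.isNormalizedEigenfunction hc h1, le_rfl⟩
    · have key : ∀ {a a' b b' : ℝ → ℝ}, SobolevPair (-R) R a a' → SobolevPair (-R) R b b' →
          mass R w a b = 0 → wInner R w (fun x => (a x : 𝕜)) (fun x => (b x : 𝕜)) = 0 := by
        intro a a' b b' ha hb hab
        obtain ⟨-, hrep, -⟩ := ha.memH1_of_real hc.neg_le (Ψ := fun x => (a x : 𝕜))
          (Eventually.of_forall fun x => rfl)
        rw [hrep.wInner_eq hc (hb.memLp_left hc.neg_le) (Eventually.of_forall fun x => rfl), hab]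
        simp [mass]
      intro i j hij
      fin_cases i <;> fin_cases j
      · exact absurd rfl hij
      · exact key hpp hu hpu
      · exact key hu hpp (by rw [mass_comm]; exact hpu)
      · exact absurd rfl hij
  · rintro μ ⟨φ, ν, hφ, hort⟩
    by_contra hcon
    push Not at hcon
    -- If all eigenvalues involved were below lam₂, both eigenfunctions would be scalar multiples of
    -- p, and two nonzero multiples are not orthogonal.
    have hmul : ∀ i, ∃ κ : 𝕜, ∀ᵐ x ∂(volume.restrict (Ioo (-R) R)), φ i x = κ * p x := by
      intro i
      obtain ⟨hi, hνi⟩ := hφ i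
      obtain ⟨r, v₁, s, z₁, hrep, hr, hs⟩ := hi.exists_isEigenfunction hc
      have er := hp.eq_mass_mul hc hp1 hmin hr (hνi.trans_lt hcon)
      have es := hp.eq_mass_mul hc hp1 hmin hs (hνi.trans_lt hcon)
      refine ⟨(mass R w p r : 𝕜) + mass R w p s * RCLike.I, ?_⟩
      filter_upwards [hrep.ae_eq, ae_restrict_mem measurableSet_Ioo] with x hx hxi
      rw [← RCLike.re_add_im (φ i x), hx.1, hx.2.1, er x (Ioo_subset_Icc_self hxi),
        es x (Ioo_subset_Icc_self hxi)]
      push_cast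
      ring
    choose κ hκ using hmul
    have hinner : ∀ i j, wInner R w (φ i) (φ j) = κ i * conj (κ j) := by
      intro i j
      have : (κ i * conj (κ j)) = κ i * conj (κ j) * (mass R w p p : 𝕜) := by
        rw [hp1, RCLike.ofReal_one, mul_one]
      rw [this, mass, ← integral_ofReal, ← integral_const_mul, wInner]
      refine integral_congr_ae ?_
      filter_upwards [hκ i, hκ j] with x h1 h2
      rw [h1, h2]
      simp only [map_mul, RCLike.conj_ofReal]
      ring
    have hne : ∀ i, κ i ≠ 0 := by
      intro i h0
      have h2 := (hφ i).1.2.1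
      rw [wNorm, Real.sqrt_eq_one] at h2
      have h3 : ∫ x in Ioo (-R) R, ‖φ i x‖ ^ 2 * w x = 0 := by
        refine integral_eq_zero_of_ae ?_
        filter_upwards [hκ i] with x hx
        simp [hx, h0]
      linarith
    have h01 := hort 0 1 (by decide)
    rw [hinner] at h01
    rcases mul_eq_zero.1 h01 with h | h
    · exact hne 0 h
    · exact hne 1 (by simpa using h)

end Complexification

/-! ### The first two eigenvalues and their variational characterization. -/

section SpectralTheorem

variable {𝕜 : Type*} [RCLike 𝕜] {R lam lam₁ lam₂ : ℝ} {w w' V u v p p' : ℝ → ℝ} {Ψ Φ : ℝ → 𝕜}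

/-- A first and a second real eigenpair, with their variational characterizations. -/
structure IsEigenbasis (R : ℝ) (w V : ℝ → ℝ) (lam₁ : ℝ) (p p' : ℝ → ℝ) (lam₂ : ℝ)
    (u v : ℝ → ℝ) : Prop where
  first : IsEigenfunction R w V lam₁ p p'
  second : IsEigenfunction R w V lam₂ u v
  mass_first : mass R w p p = 1
  mass_second : mass R w u u = 1
  mass_mixed : mass R w p u = 0
  first_le : ∀ y z, SobolevPair (-R) R y z → lam₁ * mass R w y y ≤ energy R w V y z y z
  second_le : ∀ y z, SobolevPair (-R) R y z → mass R w p y = 0 →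
    lam₂ * mass R w y y ≤ energy R w V y z y z

lemma IsEigenbasis.le (hc : Coefficients R w w' V) (h : IsEigenbasis R w V lam₁ p p' lam₂ u v) :
    lam₁ ≤ lam₂ := by
  have h1 := h.first_le _ _ (h.second.sobolevPair hc)
  rwa [h.second.energy_eq hc (h.second.sobolevPair hc), h.mass_second, mul_one, mul_one] at h1

lemma IsEigenbasis.isNthEigenvalue_one (hc : Coefficients R w w' V)
    (h : IsEigenbasis R w V lam₁ p p' lam₂ u v) : IsNthEigenvalue 𝕜 R w V 1 lam₁ :=
  h.first.isNthEigenvalue_one hc h.mass_first h.first_le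

lemma IsEigenbasis.isNthEigenvalue_two (hc : Coefficients R w w' V)
    (h : IsEigenbasis R w V lam₁ p p' lam₂ u v) : IsNthEigenvalue 𝕜 R w V 2 lam₂ :=
  h.first.isNthEigenvalue_two hc h.mass_first h.second h.mass_second h.mass_mixed (h.le hc)
    h.second_le

/-- A first eigenfunction can be completed by a second one. -/
lemma Coefficients.exists_eigenbasis_of_first (hc : Coefficients R w w' V)
    (h : IsEigenfunction R w V lam₁ p p') (h1 : mass R w p p = 1)
    (hmin : ∀ y z, SobolevPair (-R) R y z → lam₁ * mass R w y y ≤ energy R w V y z y z) :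
    ∃ lam₂ u v, IsEigenbasis R w V lam₁ p p' lam₂ u v := by
  obtain ⟨lam₂, u, v, h2, hu, hpu, hmin2⟩ := hc.exists_second h h1
  exact ⟨lam₂, u, v, h, h2, h1, hu, hpu, hmin, hmin2⟩

/-- Existence of a first and a second eigenpair, where the first eigenfunction is positive. -/
theorem Coefficients.exists_eigenbasis (hc : Coefficients R w w' V) :
    ∃ lam₁ p p' lam₂ u v, IsEigenbasis R w V lam₁ p p' lam₂ u v ∧
      ∀ x ∈ Icc (-R) R, 0 < p x := by
  obtain ⟨lam₁, p, p', h, h1, hpos, hmin⟩ := hc.exists_principal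
  obtain ⟨lam₂, u, v, hb⟩ := hc.exists_eigenbasis_of_first h h1 hmin
  exact ⟨lam₁, p, p', lam₂, u, v, hb, hpos⟩

lemma IsNthEigenvalue.unique {k : ℕ} {a b : ℝ} (h : IsNthEigenvalue 𝕜 R w V k a)
    (h' : IsNthEigenvalue 𝕜 R w V k b) : a = b := IsLeast.unique h h'

/-- A normalized positive first eigenfunction is the first member of an eigenbasis. -/
theorem Coefficients.exists_eigenbasis_of_positive (hc : Coefficients R w w' V)
    (hlam : IsNthEigenvalue 𝕜 R w V 1 lam₁) (hΨ : IsNormalizedEigenfunction R w V lam₁ Ψ)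
    (hpos : IsPositiveOn R Ψ) :
    ∃ p p' lam₂ u v, IsEigenbasis R w V lam₁ p p' lam₂ u v ∧ (∀ x ∈ Icc (-R) R, 0 ≤ p x) ∧
      Represents R Ψ p p' (fun _ => 0) (fun _ => 0) ∧
      ∀ᵐ x ∂(volume.restrict (Ioo (-R) R)), Ψ x = (p x : 𝕜) := by
  obtain ⟨lam₁', q, q', lam₂', y, z, hb, -⟩ := hc.exists_eigenbasis
  obtain rfl : lam₁ = lam₁' := hlam.unique (hb.isNthEigenvalue_one hc)
  obtain ⟨p, p', s, s', hrep, hp, -⟩ := hΨ.exists_isEigenfunction hc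
  have hpp := hp.sobolevPair hc
  have hs0 : ∀ᵐ x ∂(volume.restrict (Ioo (-R) R)), s x = 0 := by
    filter_upwards [hpos, hrep.ae_eq] with x h1 h2
    rw [← h2.2.1, h1.2]
  have hp1 : mass R w p p = 1 := by
    rw [← hrep.mass_eq_one hc hΨ.2.1, mass, mass, left_eq_add]
    refine integral_eq_zero_of_ae ?_
    filter_upwards [hs0] with x hx
    simp [hx]
  have hae : ∀ᵐ x ∂(volume.restrict (Ioo (-R) R)), Ψ x = (p x : 𝕜) := by
    filter_upwards [hpos, hrep.ae_eq] with x h1 h2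
    apply RCLike.ext
    · rw [h2.1, RCLike.ofReal_re]
    · rw [h1.2, RCLike.ofReal_im]
  obtain ⟨lam₂, u, v, hb'⟩ := hc.exists_eigenbasis_of_first hp hp1 hb.first_le
  refine ⟨p, p', lam₂, u, v, hb', ?_, (hpp.memH1_of_real hc.neg_le hae).2.1, hae⟩
  -- Positivity is known only almost everywhere; continuity extends the weak inequality to the
  -- closed interval.
  have habs : EqOn (fun x => |p x|) p (Icc (-R) R) := by
    refine eqOn_Icc_of_ae_eq_Ioo hc.neg_lt ?_ (hpp.continuousOn hc.neg_le).abs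
      (hpp.continuousOn hc.neg_le)
    filter_upwards [hpos, hrep.ae_eq] with x h1 h2
    exact abs_of_pos (h2.1 ▸ h1.1)
  intro x hx
  rw [← habs hx]
  exact abs_nonneg _

lemma IsEigenbasis.isGLB_one (hc : Coefficients R w w' V)
    (hb : IsEigenbasis R w V lam₁ p p' lam₂ u v) :
    IsGLB {b : ℝ | ∃ Ψ : ℝ → 𝕜, MemH1 (Ioo (-R) R) Ψ ∧ wNorm R w Ψ = 1 ∧
      b = RCLike.re (wForm R w V Ψ Ψ)} lam₁ := by
  refine IsLeast.isGLB ⟨?_, ?_⟩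
  · have hp := hb.first.sobolevPair hc
    obtain ⟨h1, h2, -⟩ := hp.memH1_of_real hc.neg_le (Ψ := fun x => (p x : 𝕜))
      (Eventually.of_forall fun x => rfl)
    refine ⟨_, h1, ?_, ?_⟩
    · rw [h2.wNorm_eq hc, hb.mass_first, mass_zero, add_zero, Real.sqrt_one]
    · rw [h2.re_wForm_eq hc, energy_zero, hb.first.energy_eq hc hp, hb.mass_first]
      ring
  · rintro b ⟨Ψ, hΨ, h1, rfl⟩
    obtain ⟨r, v, s, z, hrep⟩ := hΨ.exists_represents hc.neg_lt
    rw [hrep.re_wForm_eq hc]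
    have e1 := hb.first_le _ _ hrep.re
    have e2 := hb.first_le _ _ hrep.im
    have e3 := hrep.mass_eq_one hc h1
    calc lam₁ = lam₁ * (mass R w r r + mass R w s s) := by rw [e3, mul_one]
      _ ≤ _ := by linarith

lemma IsEigenbasis.isGLB_two (hc : Coefficients R w w' V)
    (hb : IsEigenbasis R w V lam₁ p p' lam₂ u v)
    (hΦ : ∀ᵐ x ∂(volume.restrict (Ioo (-R) R)), Φ x = (p x : 𝕜)) :
    IsGLB {b : ℝ | ∃ Ψ : ℝ → 𝕜, MemH1 (Ioo (-R) R) Ψ ∧ wNorm R w Ψ = 1 ∧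
      wInner R w Ψ Φ = 0 ∧ b = RCLike.re (wForm R w V Ψ Ψ)} lam₂ := by
  have hpm := (hb.first.sobolevPair hc).memLp_left hc.neg_le
  refine IsLeast.isGLB ⟨?_, ?_⟩
  · have hu := hb.second.sobolevPair hc
    obtain ⟨h1, h2, -⟩ := hu.memH1_of_real hc.neg_le (Ψ := fun x => (u x : 𝕜))
      (Eventually.of_forall fun x => rfl)
    refine ⟨_, h1, ?_, ?_, ?_⟩
    · rw [h2.wNorm_eq hc, hb.mass_second, mass_zero, add_zero, Real.sqrt_one]
    · rw [h2.wInner_eq hc hpm hΦ, mass_comm, hb.mass_mixed]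
      simp [mass]
    · rw [h2.re_wForm_eq hc, energy_zero, hb.second.energy_eq hc hu, hb.mass_second]
      ring
  · rintro b ⟨Ψ, hΨ, h1, h0, rfl⟩
    obtain ⟨r, v, s, z, hrep⟩ := hΨ.exists_represents hc.neg_lt
    rw [hrep.re_wForm_eq hc]
    obtain ⟨m1, m2⟩ := hrep.mass_eq_zero hc hpm hΦ h0
    have e1 := hb.second_le _ _ hrep.re m1
    have e2 := hb.second_le _ _ hrep.im m2
    have e3 := hrep.mass_eq_one hc h1
    calc lam₂ = lam₂ * (mass R w r r + mass R w s s) := by rw [e3, mul_one]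
      _ ≤ _ := by linarith

/-- A linear constraint is satisfied by some test function whose Rayleigh quotient is at most the
second eigenvalue. -/
theorem IsEigenbasis.exists_of_constraint (hc : Coefficients R w w' V)
    (hb : IsEigenbasis R w V lam₁ p p' lam₂ u v) (α β : ℝ) :
    ∃ s t : ℝ, s * α + t * β = 0 ∧
      0 < mass R w (fun x => s * p x + t * u x) (fun x => s * p x + t * u x) ∧
      energy R w V (fun x => s * p x + t * u x) (fun x => s * p' x + t * v x)
        (fun x => s * p x + t * u x) (fun x => s * p' x + t * v x) ≤
      lam₂ * mass R w (fun x => s * p x + t * u x) (fun x => s * p x + t * u x) := by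
  -- The coefficients (β, -α) satisfy the constraint; if both vanish, any vector does.
  obtain ⟨s, t, hst, hne⟩ : ∃ s t : ℝ, s * α + t * β = 0 ∧ 0 < s ^ 2 + t ^ 2 := by
    by_cases h0 : α = 0 ∧ β = 0
    · exact ⟨1, 0, by simp [h0.1], by norm_num⟩
    · refine ⟨β, -α, by ring, ?_⟩
      rw [neg_sq]
      rcases not_and_or.1 h0 with h1 | h1 <;> positivity
  have hp := hb.first.sobolevPair hc
  have hu := hb.second.sobolevPair hc
  have hsp := hp.const_mul s
  have htu := hu.const_mul t
  have hd := hsp.add htu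
  have hab := hc.neg_le
  have e1 : mass R w (fun x => s * p x + t * u x) p = s := by
    rw [hc.mass_add (hsp.memLp_left hab) (htu.memLp_left hab) (hp.memLp_left hab), mass_const_mul,
      mass_const_mul, hb.mass_first, mass_comm, hb.mass_mixed]
    ring
  have e2 : mass R w (fun x => s * p x + t * u x) u = t := by
    rw [hc.mass_add (hsp.memLp_left hab) (htu.memLp_left hab) (hu.memLp_left hab), mass_const_mul,
      mass_const_mul, hb.mass_second, hb.mass_mixed]
    ring
  have hmass : mass R w (fun x => s * p x + t * u x) (fun x => s * p x + t * u x)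
      = s ^ 2 + t ^ 2 := by
    rw [hc.mass_add (hsp.memLp_left hab) (htu.memLp_left hab) (hd.memLp_left hab), mass_const_mul,
      mass_const_mul, mass_comm, e1, mass_comm, e2]
    ring
  have hen : energy R w V (fun x => s * p x + t * u x) (fun x => s * p' x + t * v x)
      (fun x => s * p x + t * u x) (fun x => s * p' x + t * v x)
      = lam₁ * s ^ 2 + lam₂ * t ^ 2 := by
    rw [hc.energy_add hsp htu hd, energy_const_mul, energy_const_mul, hb.first.energy_eq hc hd,
      hb.second.energy_eq hc hd, mass_comm, e1, mass_comm, e2]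
    ring
  refine ⟨s, t, hst, by rwa [hmass], ?_⟩
  rw [hmass, hen]
  nlinarith [mul_le_mul_of_nonneg_right (hb.le hc) (sq_nonneg s)]

end SpectralTheorem

/-! ### Decay of positive solutions of y'' = Q y. -/

section Decay

lemma hasDerivAt_reflect {g : ℝ → ℝ} {d x : ℝ} (h : HasDerivAt g d (-x)) :
    HasDerivAt (fun t => g (-t)) (-d) x := by
  have := h.comp x (hasDerivAt_neg x)
  rwa [mul_neg_one] at this

/-- Decaying positive solutions of `y'' = Q y`, with `Q` uniformly positive near infinity, decay
at least quadratically together with their derivative. -/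
lemma exists_decay_of_ode {y y₁ Q : ℝ → ℝ} (hy : ∀ x, HasDerivAt y (y₁ x) x)
    (hy₁ : ∀ x, HasDerivAt y₁ (Q x * y x) x) (hpos : ∀ x, 0 < y x)
    (hlim : Tendsto y atTop (𝓝 0)) (hlim₁ : Tendsto y₁ atTop (𝓝 0)) {κ M X : ℝ} (hκ : 0 < κ)
    (hQ : ∀ x ≥ X, κ ^ 2 ≤ Q x) (hM : ∀ x ≥ X, Q x ≤ M) :
    ∃ K, ∀ x, 0 ≤ x → y x * (1 + x ^ 2) ≤ K ∧ |y₁ x| * (1 + x ^ 2) ≤ K := by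
  have hexp : ∀ k x : ℝ, HasDerivAt (fun x => Real.exp (k * x)) (k * Real.exp (k * x)) x := by
    intro k x
    have := ((hasDerivAt_id x).const_mul k).exp
    simpa [mul_comm] using this
  have hle_of_mono : ∀ {g : ℝ → ℝ}, MonotoneOn g (Ici X) → Tendsto g atTop (𝓝 0) →
      ∀ x ≥ X, g x ≤ 0 := by
    intro g hg hg0 x hx
    refine ge_of_tendsto hg0 ?_
    filter_upwards [eventually_ge_atTop x] with t ht
    exact hg hx (hx.trans ht) ht
  have hmono : ∀ {g g' : ℝ → ℝ}, (∀ x, HasDerivAt g (g' x) x) → (∀ x ≥ X, 0 ≤ g' x) →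
      MonotoneOn g (Ici X) := by
    intro g g' hg hg'
    refine monotoneOn_of_deriv_nonneg (convex_Ici X)
      (fun x _ => (hg x).continuousAt.continuousWithinAt)
      (fun x _ => (hg x).differentiableAt.differentiableWithinAt) fun x hx => ?_
    rw [interior_Ici] at hx
    rw [(hg x).deriv]
    exact hg' x (le_of_lt hx)
  -- The function (y' + κ y) exp(-κ x) has derivative (Q - κ²) y exp(-κ x) ≥ 0 and tends to 0, so it
  -- is nonpositive.
  have h1 : ∀ x ≥ X, y₁ x ≤ -(κ * y x) := by
    have hd : ∀ x, HasDerivAt (fun x => (y₁ x + κ * y x) * Real.exp (-κ * x))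
        ((Q x * y x + κ * y₁ x) * Real.exp (-κ * x) +
          (y₁ x + κ * y x) * (-κ * Real.exp (-κ * x))) x := fun x =>
      ((hy₁ x).add ((hy x).const_mul κ)).mul (hexp (-κ) x)
    have hm := hmono hd (fun x hx => by
      have e : (Q x * y x + κ * y₁ x) * Real.exp (-κ * x) +
          (y₁ x + κ * y x) * (-κ * Real.exp (-κ * x))
          = (Q x - κ ^ 2) * y x * Real.exp (-κ * x) := by ring
      rw [e]
      exact mul_nonneg (mul_nonneg (sub_nonneg.2 (hQ x hx)) (hpos x).le) (Real.exp_pos _).le)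
    have ht : Tendsto (fun x => (y₁ x + κ * y x) * Real.exp (-κ * x)) atTop (𝓝 0) := by
      have t1 : Tendsto (fun x => y₁ x + κ * y x) atTop (𝓝 0) := by
        simpa using hlim₁.add (hlim.const_mul κ)
      have t2 : Tendsto (fun x : ℝ => Real.exp (-κ * x)) atTop (𝓝 0) := by
        refine Real.tendsto_exp_atBot.comp ?_
        exact tendsto_id.const_mul_atTop_of_neg (neg_lt_zero.2 hκ)
      simpa using t1.mul t2
    intro x hx
    have := nonpos_of_mul_nonpos_left (hle_of_mono hm ht x hx) (Real.exp_pos _)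
    linarith
  -- Exponential decay of y, obtained by integrating the previous differential inequality.
  have h2 : ∀ x ≥ X, y x * Real.exp (κ * x) ≤ y X * Real.exp (κ * X) := by
    have hd : ∀ x, HasDerivAt (fun x => -(y x * Real.exp (κ * x)))
        (-(y₁ x * Real.exp (κ * x) + y x * (κ * Real.exp (κ * x)))) x := fun x =>
      ((hy x).mul (hexp κ x)).neg
    have hm := hmono hd (fun x hx => by
      have := mul_le_mul_of_nonneg_right (h1 x hx) (Real.exp_pos (κ * x)).le
      linarith)
    intro x hx
    have := hm (mem_Ici.2 le_rfl) hx hx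
    simpa using this
  have hM0 : 0 ≤ M := (sq_nonneg κ).trans ((hQ X le_rfl).trans (hM X le_rfl))
  -- Since y' ≤ 0 here and Q ≤ M, the function y'² - M y² is nondecreasing; its limit is 0, so it is
  -- nonpositive.
  have h3 : ∀ x ≥ X, |y₁ x| ≤ √M * y x := by
    have hd : ∀ x, HasDerivAt (fun x => y₁ x * y₁ x - M * (y x * y x))
        ((Q x * y x * y₁ x + y₁ x * (Q x * y x)) - M * (y₁ x * y x + y x * y₁ x)) x := fun x =>
      ((hy₁ x).mul (hy₁ x)).sub (((hy x).mul (hy x)).const_mul M)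
    have hm := hmono hd (fun x hx => by
      have e : (Q x * y x * y₁ x + y₁ x * (Q x * y x)) - M * (y₁ x * y x + y x * y₁ x)
          = 2 * (M - Q x) * y x * (-y₁ x) := by ring
      rw [e]
      have := h1 x hx
      have := hpos x
      have : 0 ≤ -y₁ x := by nlinarith
      have := sub_nonneg.2 (hM x hx)
      positivity)
    have ht : Tendsto (fun x => y₁ x * y₁ x - M * (y x * y x)) atTop (𝓝 0) := by
      simpa using (hlim₁.mul hlim₁).sub ((hlim.mul hlim).const_mul M)
    intro x hx
    have := hle_of_mono hm ht x hx
    refine abs_le_of_sq_le_sq ?_ (by have := hpos x; positivity)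
    rw [mul_pow, Real.sq_sqrt hM0]
    nlinarith
  obtain ⟨B, hB⟩ := (isCompact_Icc (a := 0) (b := X)).exists_bound_of_continuousOn
    (f := fun x => y x * (1 + x ^ 2)) (by
      have : Continuous y := continuous_iff_continuousAt.2 fun x => (hy x).continuousAt
      fun_prop)
  obtain ⟨B₁, hB₁⟩ := (isCompact_Icc (a := 0) (b := X)).exists_bound_of_continuousOn
    (f := fun x => |y₁ x| * (1 + x ^ 2)) (by
      have : Continuous y₁ := continuous_iff_continuousAt.2 fun x => (hy₁ x).continuousAt
      fun_prop)
  set A := y X * Real.exp (κ * X) * (1 + 2 / κ ^ 2) with hA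
  have hA0 : 0 ≤ A := by have := hpos X; positivity
  have h4 : ∀ x, 0 ≤ x → X ≤ x → y x * (1 + x ^ 2) ≤ A := by
    intro x hx0 hx
    have e1 : 1 + x ^ 2 ≤ (1 + 2 / κ ^ 2) * Real.exp (κ * x) := by
      have q := Real.quadratic_le_exp_of_nonneg (mul_nonneg hκ.le hx0)
      have q1 : 1 ≤ Real.exp (κ * x) := Real.one_le_exp (by positivity)
      have q2 : x ^ 2 ≤ 2 / κ ^ 2 * Real.exp (κ * x) := by
        rw [div_mul_eq_mul_div, le_div_iff₀ (by positivity)]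
        nlinarith [mul_nonneg hκ.le hx0]
      linarith
    calc y x * (1 + x ^ 2) ≤ y x * ((1 + 2 / κ ^ 2) * Real.exp (κ * x)) := by
          gcongr; exact (hpos x).le
      _ = y x * Real.exp (κ * x) * (1 + 2 / κ ^ 2) := by ring
      _ ≤ A := mul_le_mul_of_nonneg_right (h2 x hx) (by positivity)
  refine ⟨max (max |B| |B₁|) (max A (√M * A)), fun x hx0 => ?_⟩
  rcases le_total x X with hx | hx
  · have b1 := (le_abs_self _).trans (hB x ⟨hx0, hx⟩)
    have b2 := (le_abs_self _).trans (hB₁ x ⟨hx0, hx⟩)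
    exact ⟨b1.trans ((le_abs_self B).trans ((le_max_left _ _).trans (le_max_left _ _))),
      b2.trans ((le_abs_self B₁).trans ((le_max_right _ _).trans (le_max_left _ _)))⟩
  · have b1 := h4 x hx0 hx
    refine ⟨b1.trans ((le_max_left _ _).trans (le_max_right _ _)), ?_⟩
    refine le_trans ?_ ((le_max_right A (√M * A)).trans (le_max_right _ _))
    calc |y₁ x| * (1 + x ^ 2) ≤ √M * y x * (1 + x ^ 2) := by gcongr; exact h3 x hx
      _ = √M * (y x * (1 + x ^ 2)) := by ring
      _ ≤ √M * A := by gcongr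

end Decay

/-! ### The optimal profile: energy conservation, monotonicity, decay. -/

section Profile

variable {f θ : ℝ → ℝ}

lemma IsDoubleWell.hasDerivAt (hf : IsDoubleWell f) (x : ℝ) : HasDerivAt f (deriv f x) x :=
  (hf.smooth.differentiable (by simp) x).hasDerivAt

lemma IsDoubleWell.hasDerivAt_iteratedDeriv (hf : IsDoubleWell f) (n : ℕ) (x : ℝ) :
    HasDerivAt (iteratedDeriv n f) (iteratedDeriv (n + 1) f x) x := by
  rw [iteratedDeriv_succ]
  exact (hf.smooth.differentiable_iteratedDeriv n (by exact_mod_cast ENat.natCast_lt_top n) x).hasDerivAt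

lemma IsDoubleWell.continuous_iteratedDeriv (hf : IsDoubleWell f) (n : ℕ) :
    Continuous (iteratedDeriv n f) :=
  continuous_iff_continuousAt.2 fun x => (hf.hasDerivAt_iteratedDeriv n x).continuousAt

lemma IsDoubleWell.hasDerivAt_deriv (hf : IsDoubleWell f) (x : ℝ) :
    HasDerivAt (deriv f) (iteratedDeriv 2 f x) x := by
  have := hf.hasDerivAt_iteratedDeriv 1 x
  rwa [iteratedDeriv_one] at this

namespace IsOptimalProfile

lemma hasDerivAt (h : IsOptimalProfile f θ) (x : ℝ) : HasDerivAt θ (deriv θ x) x :=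
  (h.contDiff.differentiable (by simp) x).hasDerivAt

lemma hasDerivAt_deriv (h : IsOptimalProfile f θ) (x : ℝ) :
    HasDerivAt (deriv θ) (deriv f (θ x)) x := by
  have h1 : Differentiable ℝ (deriv θ) :=
    ((contDiff_succ_iff_deriv (n := 1)).1 (by exact_mod_cast h.contDiff)).2.2.differentiable
      (by simp)
  have h2 := (h1 x).hasDerivAt
  have h3 := h.ode x
  rw [iteratedDeriv_succ, iteratedDeriv_one] at h3
  rwa [show deriv (deriv θ) x = deriv f (θ x) by linarith] at h2

lemma continuous (h : IsOptimalProfile f θ) : Continuous θ := h.contDiff.continuous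

lemma continuous_deriv (h : IsOptimalProfile f θ) : Continuous (deriv θ) :=
  continuous_iff_continuousAt.2 fun x => (h.hasDerivAt_deriv x).continuousAt

lemma hasDerivAt_deriv2 (h : IsOptimalProfile f θ) (hf : IsDoubleWell f) (x : ℝ) :
    HasDerivAt (fun x => deriv f (θ x)) (iteratedDeriv 2 f (θ x) * deriv θ x) x :=
  (hf.hasDerivAt_deriv (θ x)).comp x (h.hasDerivAt x)

/-- Conservation of energy. -/
lemma deriv_sq (h : IsOptimalProfile f θ) (hf : IsDoubleWell f) (x : ℝ) :
    deriv θ x ^ 2 = 2 * (f (θ x) - f 1) := by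
  have hd : ∀ x, HasDerivAt (fun x => deriv θ x ^ 2 - 2 * f (θ x)) 0 x := by
    intro x
    have h1 := ((h.hasDerivAt_deriv x).pow 2).sub
      (((hf.hasDerivAt (θ x)).comp x (h.hasDerivAt x)).const_mul 2)
    convert! h1 using 1
    simp only [Nat.cast_ofNat, Nat.add_one_sub_one, pow_one]
    ring
  have hconst : ∀ x y, deriv θ x ^ 2 - 2 * f (θ x) = deriv θ y ^ 2 - 2 * f (θ y) :=
    is_const_of_deriv_eq_zero (fun x => (hd x).differentiableAt) fun x => (hd x).deriv
  -- Mean value points supply a sequence tending to infinity along which θ' tends to 0; this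
  -- identifies the conserved constant without any prior knowledge of the limit of θ'.
  have hmv : ∀ n : ℕ, ∃ c ∈ Ioo (n : ℝ) (n + 1), deriv θ c = θ (n + 1) - θ n := by
    intro n
    obtain ⟨c, hc, e⟩ := exists_deriv_eq_slope θ (show (n : ℝ) < n + 1 by linarith)
      h.continuous.continuousOn (fun x _ => (h.hasDerivAt x).differentiableAt.differentiableWithinAt)
    refine ⟨c, hc, ?_⟩
    rw [e]; simp
  choose c hc hc' using hmv
  have hctop : Tendsto c atTop atTop :=
    tendsto_atTop_mono (fun n => (hc n).1.le) tendsto_natCast_atTop_atTop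
  have l1 : Tendsto (fun n => deriv θ (c n)) atTop (𝓝 0) := by
    simp_rw [hc']
    have a1 := h.lim_top.comp (tendsto_natCast_atTop_atTop (R := ℝ))
    have a2 := h.lim_top.comp (tendsto_atTop_add_const_right atTop (1 : ℝ)
      (tendsto_natCast_atTop_atTop (R := ℝ)))
    simpa using a2.sub a1
  have l2 : Tendsto (fun n => f (θ (c n))) atTop (𝓝 (f 1)) :=
    (hf.smooth.continuous.tendsto 1).comp (h.lim_top.comp hctop)
  have l3 := (l1.pow 2).sub (l2.const_mul 2)
  have l4 : Tendsto (fun n => deriv θ (c n) ^ 2 - 2 * f (θ (c n))) atTop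
      (𝓝 (deriv θ x ^ 2 - 2 * f (θ x))) := by
    simp_rw [fun n => hconst (c n) x]
    exact tendsto_const_nhds
  have := tendsto_nhds_unique l4 l3
  linarith

/-- The pair θ', θ'' solves the linear system of y'' = f''(θ) y, so vanishing data at one point
propagate by Gronwall. -/
lemma eq_of_deriv_eq_zero (h : IsOptimalProfile f θ) (hf : IsDoubleWell f) {c : ℝ}
    (h1 : deriv θ c = 0) (h2 : deriv f (θ c) = 0) (x : ℝ) : deriv θ x = 0 := by
  set a := min c x - 1
  set b := max c x + 1
  have hc : c ∈ Icc a b := ⟨by have := min_le_left c x; simp only [a]; linarith,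
    by have := le_max_left c x; simp only [b]; linarith⟩
  have hx : x ∈ Icc a b := ⟨by have := min_le_right c x; simp only [a]; linarith,
    by have := le_max_right c x; simp only [b]; linarith⟩
  have hab : a ≤ b := hc.1.trans hc.2
  have cQ : Continuous fun x => iteratedDeriv 2 f (θ x) :=
    (hf.continuous_iteratedDeriv 2).comp h.continuous
  have cf : Continuous fun x => deriv f (θ x) :=
    continuous_iff_continuousAt.2 fun x => (h.hasDerivAt_deriv2 hf x).continuousAt
  obtain ⟨M, hM⟩ := (isCompact_Icc (a := a) (b := b)).exists_bound_of_continuousOn cQ.continuousOn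
  have hy : HasACDeriv a b (deriv θ) (fun x => deriv f (θ x)) :=
    HasACDeriv.of_hasDerivAt hab (fun x _ => h.hasDerivAt_deriv x) cf.continuousOn
  have hy₁ : HasACDeriv a b (fun x => deriv f (θ x)) _ :=
    HasACDeriv.of_hasDerivAt hab (fun x _ => h.hasDerivAt_deriv2 hf x)
      (cQ.mul h.continuous_deriv).continuousOn
  have key := ((hy.mul hy).add (hy₁.mul hy₁)).eq_zero_of_gronwall hab (L := 1 + M)
    (Eventually.of_forall fun t ht => by
      have hq := abs_le.1 (hM t (Ioo_subset_Icc_self ht))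
      set p := deriv θ t
      set q := deriv f (θ t)
      set Q := iteratedDeriv 2 f (θ t)
      have e : q * p + p * q + (Q * p * q + q * (Q * p)) = (1 + Q) * (2 * (p * q)) := by ring
      rw [e, abs_mul]
      refine mul_le_mul ?_ ?_ (abs_nonneg _) (by linarith [hq.1, hq.2])
      · rw [abs_le]; constructor <;> linarith [hq.1, hq.2]
      · rw [abs_le]; constructor <;> nlinarith [sq_nonneg (p + q), sq_nonneg (p - q)])
    (fun t _ => add_nonneg (mul_self_nonneg _) (mul_self_nonneg _)) hc (by simp [h1, h2]) x hx
  nlinarith [mul_self_nonneg (deriv θ x), mul_self_nonneg (deriv f (θ x))]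

/-- Where the profile met the value k, energy conservation would force θ' = 0; the profile would
then be constant, against θ(0) = 0. -/
lemma ne_of_isCritical (h : IsOptimalProfile f θ) (hf : IsDoubleWell f) {k : ℝ} (hk : k ≠ 0)
    (h1 : f k = f 1) (h2 : deriv f k = 0) (x : ℝ) : θ x ≠ k := by
  intro hx
  have e1 : deriv θ x = 0 := by
    have := h.deriv_sq hf x
    rw [hx, h1, sub_self, mul_zero] at this
    exact pow_eq_zero_iff (two_ne_zero) |>.1 this
  have e2 := h.eq_of_deriv_eq_zero hf e1 (by rw [hx]; exact h2)
  have e3 := is_const_of_deriv_eq_zero (fun x => (h.hasDerivAt x).differentiableAt) e2 x 0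
  rw [hx, h.zero] at e3
  exact hk e3

/-- The range is connected, contains 0 and misses both wells. -/
lemma mem_Ioo (h : IsOptimalProfile f θ) (hf : IsDoubleWell f) (x : ℝ) : θ x ∈ Ioo (-1 : ℝ) 1 := by
  have n1 := h.ne_of_isCritical hf one_ne_zero rfl hf.deriv_one
  have n2 := h.ne_of_isCritical hf (neg_ne_zero.2 one_ne_zero) hf.equal_depth hf.deriv_neg_one
  have hconn := isPreconnected_univ.image θ h.continuous.continuousOn
  rw [image_univ] at hconn
  have m0 : (0 : ℝ) ∈ range θ := ⟨0, h.zero⟩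
  have mx : θ x ∈ range θ := ⟨x, rfl⟩
  constructor
  · by_contra hcon
    obtain ⟨t, ht⟩ := hconn.Icc_subset mx m0 ⟨not_lt.1 hcon, by norm_num⟩
    exact n2 t ht
  · by_contra hcon
    obtain ⟨t, ht⟩ := hconn.Icc_subset m0 mx ⟨by norm_num, not_lt.1 hcon⟩
    exact n1 t ht

/-- By energy conservation θ' has no zero between the wells, so it has one sign; the negative one
contradicts the limit 1 at infinity. -/
lemma deriv_pos (h : IsOptimalProfile f θ) (hf : IsDoubleWell f) (x : ℝ) : 0 < deriv θ x := by
  have hne : ∀ x, deriv θ x ≠ 0 := by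
    intro x h0
    have h1 := h.deriv_sq hf x
    have h2 := hf.above _ (h.mem_Ioo hf x)
    rw [h0] at h1
    norm_num at h1
    linarith
  by_contra hcon
  have hneg : ∀ t, deriv θ t ≤ 0 := by
    intro t
    by_contra ht
    have hconn := isPreconnected_univ.image (deriv θ) h.continuous_deriv.continuousOn
    rw [image_univ] at hconn
    obtain ⟨s, hs⟩ := hconn.Icc_subset (mem_range_self x) (mem_range_self t)
      ⟨not_lt.1 hcon, (not_le.1 ht).le⟩
    exact hne s hs
  have hanti : Antitone θ := antitone_of_deriv_nonpos (fun x => (h.hasDerivAt x).differentiableAt)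
    hneg
  have : (1 : ℝ) ≤ 0 := by
    refine le_of_tendsto h.lim_top ?_
    filter_upwards [eventually_ge_atTop 0] with t ht
    rw [← h.zero]
    exact hanti ht
  linarith

lemma tendsto_deriv_of (h : IsOptimalProfile f θ) (hf : IsDoubleWell f) {l : Filter ℝ} {k : ℝ}
    (hl : Tendsto θ l (𝓝 k)) (hk : f k = f 1) : Tendsto (deriv θ) l (𝓝 0) := by
  have h1 : Tendsto (fun x => deriv θ x ^ 2) l (𝓝 0) := by
    simp_rw [h.deriv_sq hf]
    have := (((hf.smooth.continuous.tendsto k).comp hl).sub_const (f 1)).const_mul 2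
    simpa [hk] using this
  have h2 := h1.sqrt
  rw [Real.sqrt_zero] at h2
  refine h2.congr fun x => ?_
  rw [Real.sqrt_sq (h.deriv_pos hf x).le]

lemma tendsto_deriv2_of (hf : IsDoubleWell f) {l : Filter ℝ} {k : ℝ}
    (hl : Tendsto θ l (𝓝 k)) (hk : deriv f k = 0) :
    Tendsto (fun x => deriv f (θ x)) l (𝓝 0) := by
  rw [← hk]
  exact (((hf.hasDerivAt_deriv k).continuousAt).tendsto).comp hl

lemma tendsto_potential (hf : IsDoubleWell f) {l : Filter ℝ} {k : ℝ}
    (hl : Tendsto θ l (𝓝 k)) :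
    Tendsto (fun x => iteratedDeriv 2 f (θ x)) l (𝓝 (iteratedDeriv 2 f k)) :=
  ((hf.continuous_iteratedDeriv 2).tendsto k).comp hl

/-- On the range of the profile all derivatives of the potential are bounded. -/
lemma exists_bound (h : IsOptimalProfile f θ) (hf : IsDoubleWell f) (n : ℕ) :
    ∃ M, 0 < M ∧ ∀ x, |iteratedDeriv n f (θ x)| ≤ M := by
  obtain ⟨M, hM⟩ := (isCompact_Icc (a := (-1 : ℝ)) (b := 1)).exists_bound_of_continuousOn
    (hf.continuous_iteratedDeriv n).continuousOn
  exact ⟨|M| + 1, by positivity, fun x => (hM _ (Ioo_subset_Icc_self (h.mem_Ioo hf x))).trans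
    (by linarith [le_abs_self M])⟩

/-- The decay lemma for θ' at both ends, the left one after reflection. The decay is exponential,
but a quadratic rate suffices for every integral and boundary term below. -/
lemma exists_decay (h : IsOptimalProfile f θ) (hf : IsDoubleWell f) :
    ∃ K, 0 < K ∧ ∀ x, deriv θ x ≤ K * (1 + x ^ 2)⁻¹ ∧ |deriv f (θ x)| ≤ K * (1 + x ^ 2)⁻¹ := by
  obtain ⟨M, hM0, hM⟩ := h.exists_bound hf 2
  have hp := hf.deriv2_one
  have hn := hf.deriv2_neg_one
  obtain ⟨X₁, hX₁⟩ := eventually_atTop.1 ((tendsto_potential hf h.lim_top).eventually_const_le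
    (half_lt_self hp))
  obtain ⟨X₂, hX₂⟩ := eventually_atBot.1 ((tendsto_potential hf h.lim_bot).eventually_const_le
    (half_lt_self hn))
  obtain ⟨K₁, hK₁⟩ := exists_decay_of_ode h.hasDerivAt_deriv (h.hasDerivAt_deriv2 hf)
    (h.deriv_pos hf) (h.tendsto_deriv_of hf h.lim_top rfl)
    (tendsto_deriv2_of hf h.lim_top hf.deriv_one)
    (κ := √(iteratedDeriv 2 f 1 / 2)) (X := X₁) (M := M)
    (by positivity) (fun x hx => by rw [Real.sq_sqrt (by positivity)]; exact hX₁ x hx)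
    (fun x _ => (le_abs_self _).trans (hM x))
  obtain ⟨K₂, hK₂⟩ := exists_decay_of_ode (y := fun x => deriv θ (-x))
    (y₁ := fun x => -deriv f (θ (-x))) (Q := fun x => iteratedDeriv 2 f (θ (-x)))
    (fun x => hasDerivAt_reflect (h.hasDerivAt_deriv (-x)))
    (fun x => by simpa using (hasDerivAt_reflect (h.hasDerivAt_deriv2 hf (-x))).fun_neg)
    (fun x => h.deriv_pos hf (-x))
    ((h.tendsto_deriv_of hf h.lim_bot hf.equal_depth).comp tendsto_neg_atTop_atBot)
    (by simpa using ((tendsto_deriv2_of hf h.lim_bot hf.deriv_neg_one).comp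
      tendsto_neg_atTop_atBot).neg)
    (κ := √(iteratedDeriv 2 f (-1) / 2)) (X := -X₂) (M := M)
    (by positivity) (fun x hx => by
      rw [Real.sq_sqrt (by positivity)]; exact hX₂ (-x) (by linarith))
    (fun x _ => (le_abs_self _).trans (hM _))
  refine ⟨max 1 (max K₁ K₂), by positivity, fun x => ?_⟩
  have hx : 0 < 1 + x ^ 2 := by positivity
  rw [← div_eq_mul_inv, le_div_iff₀ hx, le_div_iff₀ hx]
  rcases le_total 0 x with h0 | h0
  · obtain ⟨a1, a2⟩ := hK₁ x h0
    have : K₁ ≤ max 1 (max K₁ K₂) := (le_max_left _ _).trans (le_max_right _ _)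
    exact ⟨a1.trans this, a2.trans this⟩
  · obtain ⟨a1, a2⟩ := hK₂ (-x) (by linarith)
    have : K₂ ≤ max 1 (max K₁ K₂) := (le_max_right _ _).trans (le_max_right _ _)
    simp only [neg_neg, neg_sq, abs_neg] at a1 a2
    exact ⟨a1.trans this, a2.trans this⟩

end IsOptimalProfile

end Profile

/-! ### Positive solutions and definiteness of the energy. -/

section PositiveSolutions

/-- A positive solution of `G'' = Q G` forces the energy to be definite on functions that
vanish somewhere, provided that the boundary terms have the right sign. -/
lemma SobolevPair.eq_zero_of_positive_solution {a b : ℝ} (hab : a ≤ b) {G G₁ Q u v : ℝ → ℝ}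
    (hG : ∀ x, HasDerivAt G (G₁ x) x) (hG₁ : ∀ x, HasDerivAt G₁ (Q x * G x) x)
    (hQ : Continuous Q) (hpos : ∀ x ∈ Icc a b, 0 < G x) (hu : SobolevPair a b u v)
    (hbd : G₁ a / G a * (u a * u a) ≤ G₁ b / G b * (u b * u b))
    {c : ℝ} (hc : c ∈ Icc a b) (huc : u c = 0)
    (hE : ∫ x in Ioo a b, (v x * v x + Q x * u x * u x) ≤ 0) : ∀ x ∈ Icc a b, u x = 0 := by
  have hGc : Continuous G := continuous_iff_continuousAt.2 fun x => (hG x).continuousAt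
  have hG₁c : Continuous G₁ := continuous_iff_continuousAt.2 fun x => (hG₁ x).continuousAt
  set η : ℝ → ℝ := fun x => G₁ x / G x with hη
  have hηc : ContinuousOn η (Icc a b) :=
    hG₁c.continuousOn.div hGc.continuousOn fun x hx => (hpos x hx).ne'
  -- The logarithmic derivative of G solves the Riccati equation η' = Q - η², so u'² + Q u² = (u' -
  -- η u)² + (η u²)'.
  have hηd : HasACDeriv a b η (fun x => Q x - η x ^ 2) := by
    refine HasACDeriv.of_hasDerivAt hab (fun x hx => ?_) (hQ.continuousOn.sub (hηc.pow 2))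
    have h0 := (hpos x hx).ne'
    convert! (hG₁ x).div (hG x) h0 using 1
    simp only [hη]; field_simp
  have huc' := hu.continuousOn hab
  have hprod := hηd.mul (hu.acd.mul hu.acd)
  have e1 := hprod.setIntegral_eq_sub hab
  have hum := hu.memLp_left hab
  have hdm : MemLp (fun x => v x - η x * u x) 2 (volume.restrict (Ioo a b)) :=
    hu.memLp.sub (memLp_Ioo_of_continuousOn (hηc.mul huc') 2)
  have e2 : ∫ x in Ioo a b, (v x * v x + Q x * u x * u x)
      = (∫ x in Ioo a b, (v x - η x * u x) * (v x - η x * u x)) +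
        ∫ x in Ioo a b, ((Q x - η x ^ 2) * (u x * u x) + η x * (v x * u x + u x * v x)) := by
    have i4 : IntegrableOn (fun x => (v x - η x * u x) * (v x - η x * u x)) (Ioo a b) :=
      hdm.integrable_mul hdm
    rw [← integral_add i4 (hprod.integrableOn hab)]
    refine integral_congr_ae (Eventually.of_forall fun x => ?_)
    simp only; ring
  have e3 : ∫ x in Ioo a b, (v x - η x * u x) * (v x - η x * u x) = 0 := by
    refine le_antisymm ?_ (integral_nonneg fun x => mul_self_nonneg _)
    rw [e2, e1] at hE
    linarith
  have e4 := (integral_eq_zero_iff_of_nonneg (fun x => mul_self_nonneg _)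
    (hdm.integrable_mul hdm)).1 e3
  rw [EventuallyEq, ae_restrict_iff' measurableSet_Ioo] at e4
  obtain ⟨L, hL⟩ := isCompact_Icc.exists_bound_of_continuousOn hηc
  intro x hx
  -- The square vanishes, hence u' = η u almost everywhere, and the zero at c spreads over the whole
  -- interval.
  have key := (hu.acd.mul hu.acd).eq_zero_of_gronwall hab (L := 2 * L) (by
    filter_upwards [e4] with t ht hti
    have h1 : v t = η t * u t := by
      have := ht hti
      simp only [Pi.zero_apply, mul_self_eq_zero] at this
      linarith
    rw [h1, show η t * u t * u t + u t * (η t * u t) = (2 * η t) * (u t * u t) by ring,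
      abs_mul, abs_mul, abs_of_nonneg (mul_self_nonneg (u t)), abs_two]
    gcongr
    · exact mul_self_nonneg _
    · exact hL t (Ioo_subset_Icc_self hti))
    (fun t _ => mul_self_nonneg _) hc (by simp [huc]) x hx
  exact mul_self_eq_zero.1 key

/-- If `y'' = Q y` has a positive solution decaying at infinity, then it has positive solutions
that are nondecreasing at any given large point. -/
lemma exists_growing_solution {y y₁ Q : ℝ → ℝ} (hy : ∀ x, HasDerivAt y (y₁ x) x)
    (hy₁ : ∀ x, HasDerivAt y₁ (Q x * y x) x) (hpos : ∀ x, 0 < y x)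
    (hlim : Tendsto y atTop (𝓝 0)) (hlim₁ : Tendsto y₁ atTop (𝓝 0)) {X : ℝ} (hX : 0 ≤ X)
    (hQ : ∀ x ≥ X, 0 ≤ Q x) :
    ∃ ρ₀, X ≤ ρ₀ ∧ ∀ ρ ≥ ρ₀, ∃ G G₁ : ℝ → ℝ, (∀ x, HasDerivAt G (G₁ x) x) ∧
      (∀ x, HasDerivAt G₁ (Q x * G x) x) ∧ (∀ x ∈ Icc 0 ρ, 0 < G x) ∧ 0 ≤ G₁ ρ := by
  have hyc : Continuous y := continuous_iff_continuousAt.2 fun x => (hy x).continuousAt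
  have hic : Continuous fun x => (y x ^ 2)⁻¹ :=
    (hyc.pow 2).inv₀ fun x => (pow_pos (hpos x) 2).ne'
  -- Reduction of order: y ∫ y⁻² is a second solution whose Wronskian with y is 1.
  set A : ℝ → ℝ := fun x => ∫ t in (0 : ℝ)..x, (y t ^ 2)⁻¹ with hA
  have hAd : ∀ x, HasDerivAt A ((y x ^ 2)⁻¹) x := fun x =>
    (hic.integral_hasStrictDerivAt 0 x).hasDerivAt
  have hA0 : ∀ x, 0 ≤ x → 0 ≤ A x := fun x hx =>
    intervalIntegral.integral_nonneg hx fun t _ => inv_nonneg.2 (sq_nonneg _)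
  set H : ℝ → ℝ := fun x => y x * A x with hH
  set H₁ : ℝ → ℝ := fun x => y₁ x * A x + (y x)⁻¹ with hH₁
  have hHd : ∀ x, HasDerivAt H (H₁ x) x := by
    intro x
    have h0 := (hpos x).ne'
    convert! (hy x).mul (hAd x) using 1
    simp only [hH₁]; field_simp
  have hH₁d : ∀ x, HasDerivAt H₁ (Q x * H x) x := by
    intro x
    have h0 := (hpos x).ne'
    convert! ((hy₁ x).mul (hAd x)).add ((hy x).inv h0) using 1
    simp only [hH]; field_simp; ring
  have hwr : ∀ x, H₁ x * y x - H x * y₁ x = 1 := by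
    intro x
    have h0 := (hpos x).ne'
    simp only [hH, hH₁]; field_simp; ring
  have hHnn : ∀ x, 0 ≤ x → 0 ≤ H x := fun x hx => mul_nonneg (hpos x).le (hA0 x hx)
  have hmono : MonotoneOn H₁ (Ici X) := by
    refine monotoneOn_of_deriv_nonneg (convex_Ici X)
      (fun x _ => (hH₁d x).continuousAt.continuousWithinAt)
      (fun x _ => (hH₁d x).differentiableAt.differentiableWithinAt) fun x hx => ?_
    rw [interior_Ici] at hx
    rw [(hH₁d x).deriv]
    exact mul_nonneg (hQ x (le_of_lt hx)) (hHnn x (hX.trans (le_of_lt hx)))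
  -- If H' stayed nonpositive beyond X, then H and H' would be bounded there, and the Wronskian 1
  -- would tend to 0 with y and y'.
  obtain ⟨ρ₀, hρ₀, hpos₀⟩ : ∃ ρ₀, X ≤ ρ₀ ∧ 0 < H₁ ρ₀ := by
    by_contra hcon
    push Not at hcon
    have hanti : AntitoneOn H (Ici X) := by
      refine antitoneOn_of_deriv_nonpos (convex_Ici X)
        (fun x _ => (hHd x).continuousAt.continuousWithinAt)
        (fun x _ => (hHd x).differentiableAt.differentiableWithinAt) fun x hx => ?_
      rw [interior_Ici] at hx
      rw [(hHd x).deriv]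
      exact hcon x (le_of_lt hx)
    have t1 : Tendsto (fun x => |H₁ X| * y x + H X * |y₁ x|) atTop (𝓝 0) := by
      simpa using (hlim.const_mul |H₁ X|).add (hlim₁.abs.const_mul (H X))
    have : (1 : ℝ) ≤ 0 := by
      refine ge_of_tendsto t1 ?_
      filter_upwards [eventually_ge_atTop X] with x hx
      rw [← hwr x]
      have a1 : |H₁ x| ≤ |H₁ X| := by
        rw [abs_of_nonpos (hcon x hx), abs_of_nonpos (hcon X le_rfl)]
        exact neg_le_neg (hmono (mem_Ici.2 le_rfl) hx hx)
      have a2 : H x ≤ H X := hanti (mem_Ici.2 le_rfl) hx hx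
      have a3 : H₁ x * y x ≤ |H₁ X| * y x :=
        mul_le_mul_of_nonneg_right ((le_abs_self _).trans a1) (hpos x).le
      have a4 : -(H x * y₁ x) ≤ H X * |y₁ x| := by
        calc -(H x * y₁ x) = H x * (-y₁ x) := by ring
          _ ≤ H x * |y₁ x| := mul_le_mul_of_nonneg_left (neg_le_abs _) (hHnn x (hX.trans hx))
          _ ≤ H X * |y₁ x| := mul_le_mul_of_nonneg_right a2 (abs_nonneg _)
      linarith
    linarith
  refine ⟨ρ₀, hρ₀, fun ρ hρ => ?_⟩
  have hρpos : 0 < H₁ ρ := hpos₀.trans_le (hmono hρ₀ (hρ₀.trans hρ) hρ)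
  -- H vanishes at 0, so a multiple of y is added for strict positivity; this multiple is small
  -- enough to keep the slope at ρ nonnegative.
  set k := H₁ ρ / (|y₁ ρ| + 1) with hk
  have hk0 : 0 < k := by positivity
  refine ⟨fun x => H x + k * y x, fun x => H₁ x + k * y₁ x,
    fun x => (hHd x).add ((hy x).const_mul k), fun x => ?_, fun x hx => ?_, ?_⟩
  · convert! (hH₁d x).add ((hy₁ x).const_mul k) using 1
    ring
  · exact add_pos_of_nonneg_of_pos (hHnn x hx.1) (mul_pos hk0 (hpos x))
  · have h1 : k * |y₁ ρ| ≤ H₁ ρ := by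
      rw [hk, div_mul_eq_mul_div, div_le_iff₀ (by positivity)]
      nlinarith [abs_nonneg (y₁ ρ)]
    have h2 := mul_le_mul_of_nonneg_left (neg_abs_le (y₁ ρ)) hk0.le
    simp only
    linarith

end PositiveSolutions

/-! ### Neumann bracketing. -/

section Bracketing

variable {R ρ lam₁ lam₂ κ : ℝ} {w w' V p p' u v e : ℝ → ℝ}

/-- Neumann bracketing: a spectral gap on a smaller interval and a lower bound of the potential
outside of it bound the second eigenvalue. -/
theorem IsEigenbasis.le_second_of_bracketing (hc : Coefficients R w w' V)
    (hb : IsEigenbasis R w V lam₁ p p' lam₂ u v) (hρ : 1 ≤ ρ) (hρR : ρ ≤ R)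
    (he : ContinuousOn e (Icc (-ρ) ρ))
    (hin : ∀ y z, SobolevPair (-ρ) ρ y z → mass ρ (fun _ => 1) e y = 0 →
      κ * mass ρ w y y ≤ energy ρ w V y z y z)
    (hout : ∀ᵐ x ∂(volume.restrict (Ioo (-R) R)), x ∉ Ioo (-ρ) ρ → κ ≤ V x) : κ ≤ lam₂ := by
  have hab := hc.neg_le
  have hp := hb.first.sobolevPair hc
  have hu := hb.second.sobolevPair hc
  -- The combination is made orthogonal to e on the small interval with weight 1. Its Rayleigh
  -- quotient on the large interval is at most lam₂ and, split at ±ρ, at least κ.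
  obtain ⟨s, t, hst, hm, hle⟩ := hb.exists_of_constraint hc (mass ρ (fun _ => 1) e p)
    (mass ρ (fun _ => 1) e u)
  have hd := (hp.const_mul s).add (hu.const_mul t)
  set y : ℝ → ℝ := fun x => s * p x + t * u x with hy
  set z : ℝ → ℝ := fun x => s * p' x + t * v x
  have hdρ := hd.mono (neg_le_neg hρR) (by linarith) hρR
  have hsub : Icc (-ρ) ρ ⊆ Icc (-R) R := Icc_subset_Icc (neg_le_neg hρR) hρR
  have hsub' : Ioo (-ρ) ρ ⊆ Ioo (-R) R := Ioo_subset_Ioo (neg_le_neg hρR) hρR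
  have hey : mass ρ (fun _ => 1) e y = 0 := by
    rw [← hst]
    simp only [mass, mul_one, hy, mul_add]
    have i1 : ∀ {g : ℝ → ℝ}, ContinuousOn g (Icc (-ρ) ρ) →
        IntegrableOn (fun x => e x * g x) (Ioo (-ρ) ρ) := fun hg =>
      (memLp_Ioo_of_continuousOn (he.mul hg) 1).integrable le_rfl
    have j1 : IntegrableOn (fun x => e x * (s * p x)) (Ioo (-ρ) ρ) :=
      i1 (g := fun x => s * p x) (continuousOn_const.mul ((hp.continuousOn hab).mono hsub))
    have j2 : IntegrableOn (fun x => e x * (t * u x)) (Ioo (-ρ) ρ) :=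
      i1 (g := fun x => t * u x) (continuousOn_const.mul ((hu.continuousOn hab).mono hsub))
    rw [integral_add j1 j2, ← integral_const_mul,
      ← integral_const_mul]
    congr 1 <;> exact integral_congr_ae (Eventually.of_forall fun x => by simp only; ring)
  have h1 := hin y z hdρ hey
  have i1 := hc.integrable_energy hd hd
  have i2 := (hc.integrable_mass (hd.memLp_left hab) (hd.memLp_left hab)).const_mul κ
  have key : κ * mass R w y y ≤ energy R w V y z y z := by
    have h2 : κ * mass R w y y - energy R w V y z y z
        = ∫ x in Ioo (-R) R, (κ * (y x * y x * w x) - (z x * z x + V x * y x * y x) * w x) := by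
      rw [mass, energy, ← integral_const_mul, ← integral_sub i2 i1]
    have h3 : κ * mass ρ w y y - energy ρ w V y z y z
        = ∫ x in Ioo (-ρ) ρ, (κ * (y x * y x * w x) - (z x * z x + V x * y x * y x) * w x) := by
      rw [mass, energy, ← integral_const_mul,
        ← integral_sub (IntegrableOn.mono_set i2 hsub') (i1.mono_set hsub')]
    have h4 := integral_inter_add_sdiff (s := Ioo (-R) R) (t := Ioo (-ρ) ρ) (μ := volume)
      (f := fun x => κ * (y x * y x * w x) - (z x * z x + V x * y x * y x) * w x)
      measurableSet_Ioo (i2.sub i1)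
    rw [inter_eq_right.2 hsub'] at h4
    have h5 : ∫ x in Ioo (-R) R \ Ioo (-ρ) ρ,
        (κ * (y x * y x * w x) - (z x * z x + V x * y x * y x) * w x) ≤ 0 := by
      refine setIntegral_nonpos_of_ae_restrict ?_
      rw [EventuallyLE, ae_restrict_iff' (measurableSet_Ioo.diff measurableSet_Ioo)]
      rw [ae_restrict_iff' measurableSet_Ioo] at hout
      filter_upwards [hout] with x hx hxi
      have hV := hx hxi.1 hxi.2
      have hw := hc.pos x (Ioo_subset_Icc_self hxi.1)
      have e1 : κ * (y x * y x * w x) - (z x * z x + V x * y x * y x) * w x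
          = -(((V x - κ) * (y x * y x) + z x * z x) * w x) := by ring
      rw [e1, Pi.zero_apply, neg_nonpos]
      have := mul_nonneg (sub_nonneg.2 hV) (mul_self_nonneg (y x))
      have := mul_self_nonneg (z x)
      positivity
    linarith
  exact le_of_mul_le_mul_right (key.trans hle) hm

end Bracketing

/-! ### A uniform spectral gap for the unperturbed operators. -/

section UnperturbedGap

variable {𝕜 : Type*} [RCLike 𝕜] {f θ : ℝ → ℝ} {R : ℝ}

lemma IsOptimalProfile.coefficients (h : IsOptimalProfile f θ) (hf : IsDoubleWell f)
    (hR : 1 ≤ R) :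
    Coefficients R (fun _ => 1) (fun _ => 0) (fun x => iteratedDeriv 2 f (θ x)) where
  one_le := hR
  hasDerivAt := fun x _ => hasDerivAt_const x 1
  continuousOn_deriv := continuousOn_const
  pos := fun _ _ => one_pos
  measurable := ((hf.continuous_iteratedDeriv 2).comp h.continuous).aestronglyMeasurable
  bounded := by
    obtain ⟨M, -, hM⟩ := h.exists_bound hf 2
    exact ⟨M, Eventually.of_forall hM⟩

/-- The second eigenvalue of the unperturbed operator on large intervals is positive. -/
lemma IsOptimalProfile.second_pos (h : IsOptimalProfile f θ) (hf : IsDoubleWell f) :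
    ∃ ρ₀, ∀ ρ, ρ₀ ≤ ρ → 1 ≤ ρ → ∀ {lam₁ lam₂ : ℝ} {p p' u v : ℝ → ℝ},
      IsEigenbasis ρ (fun _ => 1) (fun x => iteratedDeriv 2 f (θ x)) lam₁ p p' lam₂ u v →
      0 < lam₂ := by
  obtain ⟨X₁, hX₁⟩ := eventually_atTop.1 ((tendsto_potential hf h.lim_top).eventually_const_le
    hf.deriv2_one)
  obtain ⟨X₂, hX₂⟩ := eventually_atBot.1 ((tendsto_potential hf h.lim_bot).eventually_const_le
    hf.deriv2_neg_one)
  obtain ⟨ρ₁, hρ₁, hG⟩ := exists_growing_solution h.hasDerivAt_deriv (h.hasDerivAt_deriv2 hf)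
    (h.deriv_pos hf) (h.tendsto_deriv_of hf h.lim_top rfl)
    (tendsto_deriv2_of hf h.lim_top hf.deriv_one) (le_max_right X₁ 0)
    (fun x hx => hX₁ x ((le_max_left X₁ 0).trans hx))
  obtain ⟨ρ₂, hρ₂, hG'⟩ := exists_growing_solution (y := fun x => deriv θ (-x))
    (y₁ := fun x => -deriv f (θ (-x))) (Q := fun x => iteratedDeriv 2 f (θ (-x)))
    (fun x => hasDerivAt_reflect (h.hasDerivAt_deriv (-x)))
    (fun x => by simpa using (hasDerivAt_reflect (h.hasDerivAt_deriv2 hf (-x))).fun_neg)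
    (fun x => h.deriv_pos hf (-x))
    ((h.tendsto_deriv_of hf h.lim_bot hf.equal_depth).comp tendsto_neg_atTop_atBot)
    (by simpa using ((tendsto_deriv2_of hf h.lim_bot hf.deriv_neg_one).comp
      tendsto_neg_atTop_atBot).neg) (le_max_right (-X₂) 0)
    (fun x hx => hX₂ (-x) (by linarith [(le_max_left (-X₂) 0).trans hx]))
  refine ⟨max ρ₁ ρ₂, fun ρ hρ h1 lam₁ lam₂ p p' u v hb => ?_⟩
  have hc := h.coefficients hf h1
  have hQ : Continuous fun x => iteratedDeriv 2 f (θ x) :=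
    (hf.continuous_iteratedDeriv 2).comp h.continuous
  -- The constraint is vanishing at 0, which decouples the two half intervals.
  obtain ⟨s, t, hst, hm, hle⟩ := hb.exists_of_constraint hc (p 0) (u 0)
  have hd := ((hb.first.sobolevPair hc).const_mul s).add ((hb.second.sobolevPair hc).const_mul t)
  set y : ℝ → ℝ := fun x => s * p x + t * u x with hy
  set z : ℝ → ℝ := fun x => s * p' x + t * v x
  by_contra hcon
  have hE0 : energy ρ (fun _ => 1) (fun x => iteratedDeriv 2 f (θ x)) y z y z ≤ 0 :=
    hle.trans (mul_nonpos_of_nonpos_of_nonneg (not_lt.1 hcon) hm.le)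
  obtain ⟨G, G₁, g1, g2, g3, g4⟩ := hG ρ ((le_max_left _ _).trans hρ)
  obtain ⟨H, H₁, k1, k2, k3, k4⟩ := hG' ρ ((le_max_right _ _).trans hρ)
  have hρ0 : 0 ≤ ρ := by linarith
  have hr := hd.mono (a := -ρ) (b := ρ) (c := 0) (d := ρ) (by linarith) hρ0 le_rfl
  have hl := hd.mono (a := -ρ) (b := ρ) (c := -ρ) (d := 0) le_rfl (by linarith) hρ0
  -- The inner boundary term is zero because y vanishes at 0; the outer one has the right sign as G
  -- grows at ρ.
  have hgr := SobolevPair.eq_zero_of_positive_solution hρ0 g1 g2 hQ g3 hr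
    (by rw [hy]; simp only [hst, mul_zero]
        exact mul_nonneg (div_nonneg g4 (g3 ρ ⟨hρ0, le_rfl⟩).le) (mul_self_nonneg _))
    (left_mem_Icc.2 hρ0) hst
  have hgl := SobolevPair.eq_zero_of_positive_solution (a := -ρ) (b := 0) (by linarith)
    (G := fun x => H (-x)) (G₁ := fun x => -H₁ (-x)) (Q := fun x => iteratedDeriv 2 f (θ x))
    (fun x => hasDerivAt_reflect (k1 (-x)))
    (fun x => by simpa using (hasDerivAt_reflect (k2 (-x))).fun_neg) hQ
    (fun x hx => k3 (-x) ⟨by linarith [hx.2], by linarith [hx.1]⟩) hl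
    (by rw [hy]; simp only [hst, mul_zero, neg_neg]
        exact mul_nonpos_of_nonpos_of_nonneg (div_nonpos_of_nonpos_of_nonneg (neg_nonpos.2 k4)
          (k3 ρ ⟨hρ0, le_rfl⟩).le) (mul_self_nonneg _))
    (right_mem_Icc.2 (by linarith)) hst
  have hint := hc.integrable_energy hd hd
  simp only [mul_one] at hint
  have hsplit : energy ρ (fun _ => 1) (fun x => iteratedDeriv 2 f (θ x)) y z y z
      = (∫ x in Ioo (-ρ) 0, (z x * z x + iteratedDeriv 2 f (θ x) * y x * y x)) +
        ∫ x in Ioo 0 ρ, (z x * z x + iteratedDeriv 2 f (θ x) * y x * y x) := by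
    have hne : -ρ ≤ ρ := by linarith
    have hi : IntervalIntegrable (fun x => z x * z x + iteratedDeriv 2 f (θ x) * y x * y x)
        volume (-ρ) ρ := (intervalIntegrable_iff_integrableOn_Ioo_of_le hne).2 hint
    simp only [energy, mul_one, ← integral_Ioc_eq_integral_Ioo]
    rw [← intervalIntegral.integral_of_le hne, ← intervalIntegral.integral_of_le hρ0,
      ← intervalIntegral.integral_of_le (by linarith : -ρ ≤ 0)]
    refine (intervalIntegral.integral_add_adjacent_intervals (hi.mono_set ?_)
      (hi.mono_set ?_)).symm
    · rw [uIcc_of_le hne, uIcc_of_le (by linarith)]; exact Icc_subset_Icc_right hρ0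
    · rw [uIcc_of_le hne, uIcc_of_le hρ0]; exact Icc_subset_Icc_left (by linarith)
  have hzero : ∀ {a b : ℝ}, (∀ x ∈ Icc a b, y x = 0) →
      0 ≤ ∫ x in Ioo a b, (z x * z x + iteratedDeriv 2 f (θ x) * y x * y x) := by
    intro a b h0
    refine setIntegral_nonneg measurableSet_Ioo fun x hx => ?_
    rw [h0 x (Ioo_subset_Icc_self hx)]
    have := mul_self_nonneg (z x)
    simpa using this
  have hall : ∀ x ∈ Icc (-ρ) ρ, y x = 0 := by
    rw [hsplit] at hE0
    -- One half carries nonpositive energy, so y vanishes there; the energy of that half is then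
    -- nonnegative, which leaves nonpositive energy for the other half.
    have hone : (∀ x ∈ Icc 0 ρ, y x = 0) ∧ ∀ x ∈ Icc (-ρ) 0, y x = 0 := by
      rcases le_or_gt (∫ x in Ioo 0 ρ, (z x * z x + iteratedDeriv 2 f (θ x) * y x * y x)) 0
        with hA | hA
      · have z1 := hgr hA
        have := hzero z1
        exact ⟨z1, hgl (by linarith)⟩
      · have z1 := hgl (by linarith)
        have := hzero z1
        exact ⟨hgr (by linarith), z1⟩
    intro x hx
    rcases le_total 0 x with h0 | h0
    · exact hone.1 x ⟨h0, hx.2⟩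
    · exact hone.2 x ⟨hx.1, h0⟩
  have : mass ρ (fun _ => 1) y y = 0 := by
    refine setIntegral_eq_zero_of_forall_eq_zero fun x hx => ?_
    rw [hall x (Ioo_subset_Icc_self hx)]; simp
  exact hm.ne' this

/-- Far away from the origin the potential is close to its limits. -/
lemma IsOptimalProfile.exists_outer_bound (h : IsOptimalProfile f θ) (hf : IsDoubleWell f)
    {m : ℝ} (h1 : m < iteratedDeriv 2 f 1) (h2 : m < iteratedDeriv 2 f (-1)) :
    ∃ X, ∀ ρ ≥ X, ∀ x ∉ Ioo (-ρ) ρ, m ≤ iteratedDeriv 2 f (θ x) := by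
  obtain ⟨X₁, hX₁⟩ := eventually_atTop.1 ((tendsto_potential hf h.lim_top).eventually_const_le h1)
  obtain ⟨X₂, hX₂⟩ := eventually_atBot.1 ((tendsto_potential hf h.lim_bot).eventually_const_le h2)
  refine ⟨max X₁ (-X₂), fun ρ hρ x hx => ?_⟩
  rcases le_or_gt x (-ρ) with h0 | h0
  · exact hX₂ x (by linarith [(le_max_right X₁ (-X₂)).trans hρ])
  · refine hX₁ x (((le_max_left X₁ (-X₂)).trans hρ).trans ?_)
    by_contra hcon
    exact hx ⟨h0, not_le.1 hcon⟩

/-- Existence of a uniform spectral gap of the unperturbed operators. -/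
theorem IsOptimalProfile.exists_isUnperturbedGap (h : IsOptimalProfile f θ)
    (hf : IsDoubleWell f) : ∃ ν, IsUnperturbedGap 𝕜 f θ ν := by
  obtain ⟨ρ₀, hρ₀⟩ := h.second_pos hf
  set m := min (iteratedDeriv 2 f 1) (iteratedDeriv 2 f (-1)) / 2 with hm
  have hmin : 0 < min (iteratedDeriv 2 f 1) (iteratedDeriv 2 f (-1)) :=
    lt_min hf.deriv2_one hf.deriv2_neg_one
  have hm0 : 0 < m := half_pos hmin
  obtain ⟨X, hX⟩ := h.exists_outer_bound hf (m := m)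
    ((half_lt_self hmin).trans_le (min_le_left _ _))
    ((half_lt_self hmin).trans_le (min_le_right _ _))
  set ρ := max (max ρ₀ X) 1 with hρ
  have hρ1 : 1 ≤ ρ := le_max_right _ _
  have hcρ := h.coefficients hf hρ1
  obtain ⟨lam₁, p, p', lam₂, u, v, hb, -⟩ := hcρ.exists_eigenbasis
  have hlam := hρ₀ ρ ((le_max_left _ _).trans (le_max_left _ _)) hρ1 hb
  -- The bound ε ≤ δ'/ρ guarantees that the interval contains (-ρ, ρ). Bracketing then uses the
  -- fixed eigenvalue lam₂ inside and the bound m of the potential outside.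
  refine ⟨min lam₂ m, lt_min hlam hm0, fun δ' hδ' => ⟨δ' / ρ, by positivity, fun ε hε => ?_⟩⟩
  have hR : ρ ≤ δ' / ε := by
    rw [le_div_iff₀ hε.1, mul_comm]
    exact (le_div_iff₀ (by positivity)).1 hε.2
  have hc := h.coefficients hf (hρ1.trans hR)
  obtain ⟨l₁, q, q', l₂, y, z, hb', -⟩ := hc.exists_eigenbasis
  refine ⟨l₂, hb'.isNthEigenvalue_two hc, ?_⟩
  refine hb'.le_second_of_bracketing hc hρ1 hR (e := p)
    ((hb.first.sobolevPair hcρ).continuousOn hcρ.neg_le) (fun y z hyz h0 => ?_) ?_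
  · exact (mul_le_mul_of_nonneg_right (min_le_left _ _) (hcρ.mass_self_nonneg y)).trans
      (hb.second_le y z hyz h0)
  · refine Eventually.of_forall fun x hx => (min_le_right _ _).trans ?_
    exact hX ρ ((le_max_right _ _).trans (le_max_left _ _)) x hx

/-- The spectral gap inequality on a fixed large interval. -/
theorem IsUnperturbedGap.exists_gap_inequality {ν : ℝ} (hν : IsUnperturbedGap 𝕜 f θ ν)
    (h : IsOptimalProfile f θ) (hf : IsDoubleWell f) :
    ∃ ρ₀, ∀ ρ, ρ₀ ≤ ρ → 1 ≤ ρ → ∃ e : ℝ → ℝ, ContinuousOn e (Icc (-ρ) ρ) ∧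
      ∀ y z, SobolevPair (-ρ) ρ y z → mass ρ (fun _ => 1) e y = 0 →
        ν * mass ρ (fun _ => 1) y y ≤
          energy ρ (fun _ => 1) (fun x => iteratedDeriv 2 f (θ x)) y z y z := by
  -- The gap property is used only with δ' = 1 and ε = 1/ρ, which gives the interval of radius ρ.
  obtain ⟨ε₀, hε₀, H⟩ := hν.2 1 one_pos
  refine ⟨1 / ε₀, fun ρ h0 h1 => ?_⟩
  have hρ : 0 < ρ := by linarith
  obtain ⟨lam, hlam, hle⟩ := H (1 / ρ) ⟨by positivity, by
    rw [div_le_iff₀ hρ]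
    have := (div_le_iff₀ hε₀).1 h0
    linarith⟩
  rw [one_div_one_div] at hlam
  have hc := h.coefficients hf h1
  obtain ⟨lam₁, p, p', lam₂, u, v, hb, -⟩ := hc.exists_eigenbasis
  obtain rfl : lam = lam₂ := hlam.unique (hb.isNthEigenvalue_two hc)
  refine ⟨p, (hb.first.sobolevPair hc).continuousOn hc.neg_le, fun y z hyz h0 => ?_⟩
  exact (mul_le_mul_of_nonneg_right hle (hc.mass_self_nonneg y)).trans (hb.second_le y z hyz h0)

end UnperturbedGap

/-! ### The inverse of the stretched variable. -/

section StretchedVariable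

variable {δ ε C₀ z : ℝ} {h : ℝ → ℝ}

lemma C2Bounded.exists_deriv {δ K : ℝ} {g : ℝ → ℝ} (hδ : 0 < δ) (hg : C2Bounded δ K g) :
    ∃ g₁ : ℝ → ℝ, (∀ r ∈ Ioo (-δ) δ, HasDerivAt g (g₁ r) r) ∧
      (∀ r ∈ Icc (-δ) δ, |g r| ≤ K) ∧ (∀ r ∈ Icc (-δ) δ, |g₁ r| ≤ K) ∧
      (∀ x ∈ Icc (-δ) δ, ∀ y ∈ Icc (-δ) δ, |g y - g x| ≤ K * |y - x|) ∧
      (∀ x ∈ Icc (-δ) δ, ∀ y ∈ Icc (-δ) δ, |g₁ y - g₁ x| ≤ K * |y - x|) ∧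
      ContinuousOn g₁ (Icc (-δ) δ) := by
  obtain ⟨hc, hb⟩ := hg
  have hu : UniqueDiffOn ℝ (Icc (-δ) δ) := uniqueDiffOn_Icc (by linarith)
  have hd : DifferentiableOn ℝ g (Icc (-δ) δ) := hc.differentiableOn (by norm_num)
  have hc1 : ContDiffOn ℝ 1 (derivWithin g (Icc (-δ) δ)) (Icc (-δ) δ) :=
    hc.derivWithin hu (by norm_num)
  have hd1 := hc1.differentiableOn (by norm_num)
  have b0 := fun r hr => hb 0 (by norm_num) r hr
  have b1 := fun r hr => hb 1 (by norm_num) r hr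
  have b2 := fun r hr => hb 2 le_rfl r hr
  simp only [iteratedDerivWithin_zero] at b0
  simp only [iteratedDerivWithin_one] at b1
  rw [show (2 : ℕ) = 1 + 1 from rfl, iteratedDerivWithin_succ, iteratedDerivWithin_one] at b2
  refine ⟨derivWithin g (Icc (-δ) δ), fun r hr => ?_, b0, b1, fun x hx y hy => ?_,
    fun x hx y hy => ?_, hc1.continuousOn⟩
  · exact (hd r (Ioo_subset_Icc_self hr)).hasDerivWithinAt.hasDerivAt
      (Icc_mem_nhds hr.1 hr.2)
  · exact (convex_Icc _ _).norm_image_sub_le_of_norm_hasDerivWithin_le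
      (fun t ht => (hd t ht).hasDerivWithinAt) b1 hx hy
  · exact (convex_Icc _ _).norm_image_sub_le_of_norm_hasDerivWithin_le
      (fun t ht => (hd1 t ht).hasDerivWithinAt) b2 hx hy

/-- Intermediate value theorem. The shift ε h is at most δ/16, less than the margin δ/8 between 7δ/8
and δ, so z is attained and its preimage stays away from the end points. -/
lemma FEps_spec (hε : 0 < ε) (hδ : 0 < δ) (hεδ : ε * C₀ ≤ δ / 16) (hh : C2Bounded δ C₀ h)
    (hz : |ε * z| ≤ 7 * δ / 8) :
    FEps δ ε h z ∈ Ioo (-δ) δ ∧ |FEps δ ε h z - ε * z| ≤ ε * C₀ ∧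
      rhoEps ε h (FEps δ ε h z) = z := by
  obtain ⟨h₁, -, hb, -⟩ := hh.exists_deriv hδ
  have hle : -δ ≤ δ := by linarith
  have hcont : ContinuousOn (rhoEps ε h) (Icc (-δ) δ) :=
    (continuousOn_id.sub (continuousOn_const.mul hh.1.continuousOn)).div_const ε
  have hz' := abs_le.1 hz
  have e1 := abs_le.1 (hb δ (right_mem_Icc.2 hle))
  have e2 := abs_le.1 (hb (-δ) (left_mem_Icc.2 hle))
  have hmem : z ∈ rhoEps ε h '' Icc (-δ) δ := by
    refine intermediate_value_Icc hle hcont ⟨?_, ?_⟩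
    · rw [rhoEps, div_le_iff₀ hε]
      nlinarith
    · rw [rhoEps, le_div_iff₀ hε]
      nlinarith
  have hF : FEps δ ε h z ∈ Icc (-δ) δ := Function.invFunOn_mem hmem
  have hr : rhoEps ε h (FEps δ ε h z) = z := Function.invFunOn_eq hmem
  have h1 : FEps δ ε h z - ε * z = ε * h (FEps δ ε h z) := by
    rw [rhoEps, div_eq_iff hε.ne'] at hr
    linarith
  have h2 : |FEps δ ε h z - ε * z| ≤ ε * C₀ := by
    rw [h1, abs_mul, abs_of_pos hε]
    exact mul_le_mul_of_nonneg_left (hb _ hF) hε.le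
  have h3 := abs_le.1 h2
  exact ⟨⟨by linarith, by linarith⟩, h2, hr⟩

/-- Subtracting the equations F = ε z + ε h(F) at two points, the h term is absorbed since ε C₀ ≤
1/2. Supplies the continuity that the derivative of the inverse requires. -/
lemma abs_FEps_sub_le (hε : 0 < ε) (hδ : 0 < δ) (hεδ : ε * C₀ ≤ δ / 16) (hε2 : ε * C₀ ≤ 1 / 2)
    (hh : C2Bounded δ C₀ h) {y : ℝ} (hz : |ε * z| ≤ 7 * δ / 8) (hy : |ε * y| ≤ 7 * δ / 8) :
    |FEps δ ε h y - FEps δ ε h z| ≤ 2 * ε * |y - z| := by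
  obtain ⟨h₁, -, -, -, hlip, -⟩ := hh.exists_deriv hδ
  obtain ⟨my, -, ry⟩ := FEps_spec hε hδ hεδ hh hy
  obtain ⟨mz, -, rz⟩ := FEps_spec hε hδ hεδ hh hz
  have hl := hlip _ (Ioo_subset_Icc_self mz) _ (Ioo_subset_Icc_self my)
  rw [rhoEps, div_eq_iff hε.ne'] at ry rz
  set a := FEps δ ε h y
  set b := FEps δ ε h z
  have e : a - b = ε * (y - z) + ε * (h a - h b) := by linarith
  have h1 : |a - b| ≤ ε * |y - z| + ε * |h a - h b| := by
    calc |a - b| ≤ |ε * (y - z)| + |ε * (h a - h b)| := by rw [e]; exact abs_add_le _ _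
      _ = _ := by rw [abs_mul, abs_mul, abs_of_pos hε]
  nlinarith [abs_nonneg (a - b), abs_nonneg (y - z)]

lemma hasDerivAt_FEps (hε : 0 < ε) (hδ : 0 < δ) (hεδ : ε * C₀ ≤ δ / 16) (hε2 : ε * C₀ ≤ 1 / 2)
    (hh : C2Bounded δ C₀ h) {h₁ : ℝ → ℝ} (hd : ∀ r ∈ Ioo (-δ) δ, HasDerivAt h (h₁ r) r)
    (hb : ∀ r ∈ Icc (-δ) δ, |h₁ r| ≤ C₀) (hz : |ε * z| < 7 * δ / 8) :
    HasDerivAt (FEps δ ε h) (ε / (1 - ε * h₁ (FEps δ ε h z))) z := by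
  have hev : ∀ᶠ y in 𝓝 z, |ε * y| < 7 * δ / 8 :=
    (by fun_prop : Continuous fun y : ℝ => |ε * y|).continuousAt.eventually_lt_const hz
  obtain ⟨mz, -, -⟩ := FEps_spec hε hδ hεδ hh hz.le
  have hcont : ContinuousAt (FEps δ ε h) z := by
    rw [ContinuousAt, tendsto_iff_dist_tendsto_zero]
    refine squeeze_zero' (Eventually.of_forall fun _ => dist_nonneg)
      (hev.mono fun y hy => (abs_FEps_sub_le hε hδ hεδ hε2 hh hz.le hy.le : dist _ _ ≤ _)) ?_
    have : ContinuousAt (fun y : ℝ => 2 * ε * |y - z|) z := by fun_prop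
    simpa [ContinuousAt] using this
  have h1 := abs_le.1 (hb _ (Ioo_subset_Icc_self mz))
  have hpos : 0 < 1 - ε * h₁ (FEps δ ε h z) := by nlinarith
  have hρ : HasDerivAt (rhoEps ε h) ((1 - ε * h₁ (FEps δ ε h z)) / ε) (FEps δ ε h z) :=
    ((hasDerivAt_id _).sub ((hd _ mz).const_mul ε)).div_const ε
  have := hρ.of_local_left_inverse hcont (div_pos hpos hε).ne'
    (hev.mono fun y hy => (FEps_spec hε hδ hεδ hh hy.le).2.2)
  rwa [inv_div] at this

end StretchedVariable

/-! ### Expansion of weight and potential around the profile. -/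

section Perturbation

/-- Quantitative closeness of the weight and the potential of a Neumann problem on `(-R, R)` to
the linearization at the profile `θ`. -/
structure ProfilePerturbation (f θ θ₁ : ℝ → ℝ) (c K ε p j γ R : ℝ) (w w' V : ℝ → ℝ) : Prop where
  coefficients : Coefficients R w w' V
  le_weight : ∀ x ∈ Icc (-R) R, c ≤ w x
  weight_le : ∀ x ∈ Icc (-R) R, w x ≤ K
  weight_sub : ∀ x ∈ Icc (-R) R, |w x - j| ≤ K * ε * (1 + |x|)
  deriv_le : ∀ x ∈ Icc (-R) R, |w' x| ≤ K * ε
  deriv_sub : ∀ x ∈ Icc (-R) R, |w' x - ε * γ| ≤ K * ε ^ 2 * (1 + |x|)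
  potential_sub : ∀ᵐ x ∂(volume.restrict (Ioo (-R) R)),
    |V x - iteratedDeriv 2 f (θ x)| ≤ K * ε
  potential_sub_sub : ∀ᵐ x ∂(volume.restrict (Ioo (-R) R)),
    |V x - iteratedDeriv 2 f (θ x) - ε * p * (iteratedDeriv 3 f (θ x) * θ₁ x)|
      ≤ K * ε ^ 2 * (1 + |x|)
  abs_p_le : |p| ≤ K
  abs_slope_le : |γ| ≤ K
  le_center : c ≤ j
  center_le : j ≤ K

/-- The profile takes values in (-1, 1); the interval [-2, 2] leaves room for a correction of size
at most 1. -/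
lemma IsDoubleWell.exists_taylor {f : ℝ → ℝ} (hf : IsDoubleWell f) : ∃ M, 0 < M ∧
    ∀ a ∈ Icc (-2 : ℝ) 2, ∀ b ∈ Icc (-2 : ℝ) 2,
      |iteratedDeriv 2 f b - iteratedDeriv 2 f a| ≤ M * |b - a| ∧
      |iteratedDeriv 2 f b - iteratedDeriv 2 f a - iteratedDeriv 3 f a * (b - a)|
        ≤ M * |b - a| ^ 2 := by
  have hlip : ∀ n, ∃ M, 0 < M ∧ ∀ a ∈ Icc (-2 : ℝ) 2, ∀ b ∈ Icc (-2 : ℝ) 2,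
      |iteratedDeriv n f b - iteratedDeriv n f a| ≤ M * |b - a| := by
    intro n
    obtain ⟨M, hM⟩ := (isCompact_Icc (a := (-2 : ℝ)) (b := 2)).exists_bound_of_continuousOn
      (hf.continuous_iteratedDeriv (n + 1)).continuousOn
    exact ⟨|M| + 1, by positivity, fun a ha b hb =>
      (convex_Icc _ _).norm_image_sub_le_of_norm_hasDerivWithin_le
        (fun t _ => (hf.hasDerivAt_iteratedDeriv n t).hasDerivWithinAt)
        (fun t ht => (hM t ht).trans (by linarith [le_abs_self M])) ha hb⟩
  obtain ⟨M₂, hM₂, h2⟩ := hlip 2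
  obtain ⟨M₃, hM₃, h3⟩ := hlip 3
  refine ⟨max M₂ M₃, lt_max_of_lt_left hM₂, fun a ha b hb => ⟨(h2 a ha b hb).trans (by
    gcongr; exact le_max_left _ _), ?_⟩⟩
  have hsub : uIcc a b ⊆ Icc (-2 : ℝ) 2 := (ordConnected_Icc).uIcc_subset ha hb
  have := (convex_uIcc a b).norm_image_sub_le_of_norm_hasDerivWithin_le
    (f := fun t => iteratedDeriv 2 f t - iteratedDeriv 3 f a * t)
    (f' := fun t => iteratedDeriv 3 f t - iteratedDeriv 3 f a * 1) (C := M₃ * |b - a|)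
    (fun t _ => ((hf.hasDerivAt_iteratedDeriv 2 t).sub
      ((hasDerivAt_id t).const_mul _)).hasDerivWithinAt)
    (fun t ht => by
      rw [mul_one]
      exact (h3 a ha t (hsub ht)).trans
        (mul_le_mul_of_nonneg_left (abs_sub_left_of_mem_uIcc ht) hM₃.le))
    left_mem_uIcc right_mem_uIcc
  simp only [Real.norm_eq_abs] at this
  calc _ = |iteratedDeriv 2 f b - iteratedDeriv 3 f a * b
        - (iteratedDeriv 2 f a - iteratedDeriv 3 f a * a)| := by congr 1; ring
    _ ≤ M₃ * |b - a| * |b - a| := this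
    _ = M₃ * |b - a| ^ 2 := by ring
    _ ≤ _ := by gcongr; exact le_max_right _ _

lemma aemeasurable_comp_mul {ε δ R : ℝ} (hε : 0 < ε) (hR : ε * R ≤ δ) {q : ℝ → ℝ}
    (hq : AEMeasurable q (volume.restrict (Icc (-δ) δ))) :
    AEMeasurable (fun x => q (ε * x)) (volume.restrict (Ioo (-R) R)) := by
  suffices hqm : Measure.QuasiMeasurePreserving (fun x => ε * x) (volume.restrict (Ioo (-R) R))
      (volume.restrict (Icc (-δ) δ)) from hq.comp_quasiMeasurePreserving hqm
  refine ⟨measurable_const_mul ε, ?_⟩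
  have h1 : volume.restrict (Ioo (-R) R)
      ≤ volume.restrict ((fun x => ε * x) ⁻¹' Icc (-δ) δ) := by
    have hs : Ioo (-R) R ⊆ (fun x => ε * x) ⁻¹' Icc (-δ) δ := fun x hx => by
      have h2 := hx.1
      have h3 := hx.2
      exact mem_preimage.2 ⟨by nlinarith, by nlinarith⟩
    exact Measure.restrict_mono hs le_rfl
  refine (Measure.map_mono h1 (measurable_const_mul ε)).absolutelyContinuous.trans ?_
  rw [← Measure.restrict_map (measurable_const_mul ε) measurableSet_Icc,
    Real.map_volume_mul_left hε.ne']
  exact (Measure.smul_absolutelyContinuous).restrict _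


/-- Chain rule with F' = ε / (1 - ε h'(F)) and F = ε x + O(ε); the slope γ is J'(0). The factor 1 +
|x| comes from the Lipschitz bounds of J and J' at distance |F| from 0. -/
lemma weight_estimates {δ δ' C₀ c₁ C₂ ε : ℝ} {h J : ℝ → ℝ} (hδ : 0 < δ) (hδ' : δ' ≤ 3 * δ / 4)
    (hδ'0 : 0 < δ') (hC₀ : 0 < C₀) (hC₂ : 0 < C₂) (hε : 0 < ε)
    (hεδ : ε * C₀ ≤ δ / 16) (hε2 : ε * C₀ ≤ 1 / 2) (hJ : C2Bounded δ C₂ J)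
    (hJc : ∀ r ∈ Icc (-δ) δ, c₁ ≤ J r) (hh : C2Bounded δ C₀ h) :
    ∃ (w' : ℝ → ℝ) (γ : ℝ), |γ| ≤ C₂ ∧ ContinuousOn w' (Icc (-(δ' / ε)) (δ' / ε)) ∧
      ∀ x ∈ Icc (-(δ' / ε)) (δ' / ε), HasDerivAt (JEps δ ε h J) (w' x) x ∧
        c₁ ≤ JEps δ ε h J x ∧ JEps δ ε h J x ≤ C₂ ∧
        |JEps δ ε h J x - J 0| ≤ C₂ * (1 + C₀) * ε * (1 + |x|) ∧ |w' x| ≤ 2 * C₂ * ε ∧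
        |w' x - ε * γ| ≤ C₂ * (1 + 3 * C₀) * ε ^ 2 * (1 + |x|) := by
  obtain ⟨h₁, hd, hb0, hb1, -, -, hc1⟩ := hh.exists_deriv hδ
  obtain ⟨J₁, Jd, Jb0, Jb1, Jl, Jl1, Jc1⟩ := hJ.exists_deriv hδ
  have hz0 : (0 : ℝ) ∈ Icc (-δ) δ := ⟨by linarith, hδ.le⟩
  have hsm : ∀ x ∈ Icc (-(δ' / ε)) (δ' / ε), |ε * x| < 7 * δ / 8 := by
    intro x hx
    have h1 : |x| ≤ δ' / ε := abs_le.2 hx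
    rw [le_div_iff₀ hε] at h1
    rw [abs_mul, abs_of_pos hε]
    linarith
  have hspec := fun x hx => FEps_spec hε hδ hεδ hh (hsm x hx).le
  have hpos : ∀ r ∈ Icc (-δ) δ, 1 / 2 ≤ 1 - ε * h₁ r := fun r hr => by
    have := (abs_le.1 (hb1 r hr)).2
    nlinarith
  have hFd := fun x hx => hasDerivAt_FEps hε hδ hεδ hε2 hh hd hb1 (hsm x hx)
  have hFc : ContinuousOn (FEps δ ε h) (Icc (-(δ' / ε)) (δ' / ε)) :=
    fun x hx => (hFd x hx).continuousAt.continuousWithinAt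
  have hmaps : MapsTo (FEps δ ε h) (Icc (-(δ' / ε)) (δ' / ε)) (Icc (-δ) δ) :=
    fun x hx => Ioo_subset_Icc_self (hspec x hx).1
  refine ⟨fun x => J₁ (FEps δ ε h x) * (ε / (1 - ε * h₁ (FEps δ ε h x))), J₁ 0,
    Jb1 0 hz0, ?_, fun x hx => ?_⟩
  · refine (Jc1.comp hFc hmaps).mul (continuousOn_const.div
      (continuousOn_const.sub (continuousOn_const.mul (hc1.comp hFc hmaps))) fun x hx => ?_)
    have := hpos _ (hmaps hx)
    exact (by linarith : (0 : ℝ) < 1 - ε * h₁ (FEps δ ε h x)).ne'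
  obtain ⟨m, hFe, -⟩ := hspec x hx
  have m' := Ioo_subset_Icc_self m
  have hp := hpos _ m'
  have b1 := hb1 _ m'
  have j1 := Jb1 _ m'
  have l0 := Jl 0 hz0 _ m'
  have l1 := Jl1 0 hz0 _ m'
  have hD := hFd x hx
  have jd := Jd _ m
  have jc := hJc _ m'
  have jb := (le_abs_self _).trans (Jb0 _ m')
  simp only [JEps]
  have hcomp : HasDerivAt (fun z => J (FEps δ ε h z))
      (J₁ (FEps δ ε h x) * (ε / (1 - ε * h₁ (FEps δ ε h x)))) x := jd.comp x hD
  generalize FEps δ ε h x = F at *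
  have hF : |F| ≤ ε * (|x| + C₀) := by
    have : |F| ≤ |F - ε * x| + |ε * x| := by simpa using abs_add_le (F - ε * x) (ε * x)
    rw [abs_mul ε, abs_of_pos hε] at this
    linarith
  rw [sub_zero] at l0 l1
  have hx0 := abs_nonneg x
  refine ⟨hcomp, jc, jb, l0.trans ?_, ?_, ?_⟩
  · have : C₂ * |F| ≤ C₂ * (ε * (|x| + C₀)) := by gcongr
    have h2 : 0 ≤ C₂ * ε * (1 + C₀ * |x|) := by positivity
    linarith
  · rw [abs_mul, abs_div, abs_of_pos hε, abs_of_pos (by linarith : 0 < 1 - ε * h₁ F)]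
    have : ε / (1 - ε * h₁ F) ≤ 2 * ε := by
      rw [div_le_iff₀ (by linarith)]; nlinarith
    calc _ ≤ C₂ * (2 * ε) := by gcongr
      _ = _ := by ring
  · have e : J₁ F * (ε / (1 - ε * h₁ F)) - ε * J₁ 0
        = ε * ((J₁ F - J₁ 0) + J₁ F * (ε * h₁ F / (1 - ε * h₁ F))) := by
      have : 1 - ε * h₁ F ≠ 0 := by linarith
      field_simp; ring
    have t1 : |ε * h₁ F / (1 - ε * h₁ F)| ≤ 2 * (ε * C₀) := by
      rw [abs_div, abs_of_pos (by linarith : 0 < 1 - ε * h₁ F), div_le_iff₀ (by linarith), abs_mul,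
        abs_of_pos hε]
      have : ε * |h₁ F| ≤ ε * C₀ := by gcongr
      have : 0 ≤ ε * C₀ := by positivity
      nlinarith
    have t2 : |(J₁ F - J₁ 0) + J₁ F * (ε * h₁ F / (1 - ε * h₁ F))|
        ≤ C₂ * (ε * (|x| + C₀)) + C₂ * (2 * (ε * C₀)) := by
      refine (abs_add_le _ _).trans (add_le_add (l1.trans (by gcongr)) ?_)
      rw [abs_mul]
      gcongr
    rw [e, abs_mul, abs_of_pos hε]
    calc _ ≤ ε * (C₂ * (ε * (|x| + C₀)) + C₂ * (2 * (ε * C₀))) := by gcongr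
      _ ≤ C₂ * (1 + 3 * C₀) * ε ^ 2 * (1 + |x|) := by
        have h2 : 0 ≤ C₂ * ε ^ 2 * (1 + 3 * C₀ * |x|) := by positivity
        linarith

lemma ae_abs_le_of_eLpNorm_top_le {θ₁ : ℝ → ℝ} {C₄ : ℝ} (hC₄ : 0 ≤ C₄)
    (h₁ : eLpNorm θ₁ ∞ volume ≤ ENNReal.ofReal C₄) : ∀ᵐ x, |θ₁ x| ≤ C₄ := by
  rw [eLpNorm_exponent_top] at h₁
  filter_upwards [ae_le_eLpNormEssSup (f := θ₁) (μ := volume)] with x hx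
  have := hx.trans h₁
  rwa [← ofReal_norm, ENNReal.ofReal_le_ofReal_iff hC₄] at this

/-- At r = ε x the factor ε/(ε + |r|) is 1/(1 + |x|), so q grows at most linearly in x. As ε |x| ≤
δ', the term ε² q is still O(ε) uniformly; Taylor expansion to first order isolates the θ₁ term. -/
lemma potential_estimates {f θ θ₁ q : ℝ → ℝ} (hf : IsDoubleWell f) (hθ : IsOptimalProfile f θ)
    {δ δ' C₃ C₄ : ℝ} (hδ : δ' ≤ 3 * δ / 4) (hδ' : 0 < δ') (hC₃ : 0 < C₃) (hC₄ : 0 < C₄)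
    {M M₃ : ℝ} (hM₃ : ∀ x, |iteratedDeriv 3 f (θ x)| ≤ M₃)
    (hM : ∀ a ∈ Icc (-2 : ℝ) 2, ∀ b ∈ Icc (-2 : ℝ) 2,
      |iteratedDeriv 2 f b - iteratedDeriv 2 f a| ≤ M * |b - a| ∧
      |iteratedDeriv 2 f b - iteratedDeriv 2 f a - iteratedDeriv 3 f a * (b - a)|
        ≤ M * |b - a| ^ 2) (hM0 : 0 < M)
    {ε p : ℝ} (hε : 0 < ε) (hε1 : ε * (C₃ * (C₄ + 1 + δ')) ≤ 1) (hε2 : ε ≤ 1)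
    (h₁ : eLpNorm θ₁ ∞ volume ≤ ENNReal.ofReal C₄)
    (hq : ∀ r ∈ Icc (-δ) δ, |p| + ε / (ε + |r|) * |q r| ≤ C₃) :
    ∀ᵐ x ∂(volume.restrict (Ioo (-(δ' / ε)) (δ' / ε))),
      |iteratedDeriv 2 f (phiEps θ θ₁ ε p q (ε * x)) - iteratedDeriv 2 f (θ x)|
        ≤ M * (C₃ * (C₄ + 1 + δ')) * ε ∧
      |iteratedDeriv 2 f (phiEps θ θ₁ ε p q (ε * x)) - iteratedDeriv 2 f (θ x)
          - ε * p * (iteratedDeriv 3 f (θ x) * θ₁ x)|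
        ≤ (M * (C₃ * (C₄ + 1 + δ')) ^ 2 + M₃ * C₃) * ε ^ 2 * (1 + |x|) := by
  have hae := ae_abs_le_of_eLpNorm_top_le hC₄.le h₁
  rw [ae_restrict_iff' measurableSet_Ioo]
  filter_upwards [hae] with x hx hxi
  have hxa : ε * |x| ≤ δ' := by
    have : |x| ≤ δ' / ε := (abs_lt.2 hxi).le
    rw [le_div_iff₀ hε] at this
    linarith
  have hxm : ε * x ∈ Icc (-δ) δ := by
    rw [mem_Icc, ← abs_le, abs_mul, abs_of_pos hε]; linarith
  have hqx := hq _ hxm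
  have hx0 := abs_nonneg x
  rw [abs_mul, abs_of_pos hε, show ε / (ε + ε * |x|) = (1 + |x|)⁻¹ by field_simp] at hqx
  have hp : |p| ≤ C₃ := by
    have : 0 ≤ (1 + |x|)⁻¹ * |q (ε * x)| := by positivity
    linarith
  have hqb : |q (ε * x)| ≤ C₃ * (1 + |x|) := by
    have h2 : (1 + |x|)⁻¹ * |q (ε * x)| ≤ C₃ := by linarith [abs_nonneg p]
    rwa [inv_mul_le_iff₀ (by positivity), mul_comm (1 + |x|)] at h2
  set A := C₃ * (C₄ + 1 + δ') with hA
  have hη : phiEps θ θ₁ ε p q (ε * x) - θ x = ε * p * θ₁ x + q (ε * x) * ε ^ 2 := by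
    rw [phiEps, mul_div_cancel_left₀ _ hε.ne']; ring
  have hηb : |phiEps θ θ₁ ε p q (ε * x) - θ x| ≤ A * ε := by
    rw [hη]
    calc _ ≤ |ε * p * θ₁ x| + |q (ε * x) * ε ^ 2| := abs_add_le _ _
      _ = ε * |p| * |θ₁ x| + |q (ε * x)| * ε ^ 2 := by
        rw [abs_mul, abs_mul, abs_mul, abs_of_pos hε, abs_of_pos (pow_pos hε 2)]
      _ ≤ ε * C₃ * C₄ + C₃ * (1 + |x|) * ε ^ 2 := by gcongr
      _ = ε * C₃ * C₄ + C₃ * ε * (ε + ε * |x|) := by ring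
      _ ≤ ε * C₃ * C₄ + C₃ * ε * (1 + δ') := by gcongr
      _ = A * ε := by rw [hA]; ring
  have hθm := hθ.mem_Ioo hf x
  have h1 : θ x ∈ Icc (-2 : ℝ) 2 := ⟨by linarith [hθm.1], by linarith [hθm.2]⟩
  have hηb' := abs_le.1 (hηb.trans (by linarith : A * ε ≤ 1))
  have h2 : phiEps θ θ₁ ε p q (ε * x) ∈ Icc (-2 : ℝ) 2 :=
    ⟨by linarith [hθm.1], by linarith [hθm.2]⟩
  obtain ⟨k1, k2⟩ := hM _ h1 _ h2
  refine ⟨k1.trans ?_, ?_⟩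
  · calc _ ≤ M * (A * ε) := by gcongr
      _ = _ := by ring
  · have hsplit : iteratedDeriv 2 f (phiEps θ θ₁ ε p q (ε * x)) - iteratedDeriv 2 f (θ x)
          - ε * p * (iteratedDeriv 3 f (θ x) * θ₁ x)
        = (iteratedDeriv 2 f (phiEps θ θ₁ ε p q (ε * x)) - iteratedDeriv 2 f (θ x)
          - iteratedDeriv 3 f (θ x) * (phiEps θ θ₁ ε p q (ε * x) - θ x))
          + iteratedDeriv 3 f (θ x) * (q (ε * x) * ε ^ 2) := by rw [hη]; ring
    rw [hsplit]
    have h3 := hM₃ x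
    have h30 : 0 ≤ M₃ := (abs_nonneg _).trans h3
    calc _ ≤ M * |phiEps θ θ₁ ε p q (ε * x) - θ x| ^ 2
          + |iteratedDeriv 3 f (θ x)| * (|q (ε * x)| * ε ^ 2) := by
          refine (abs_add_le _ _).trans (add_le_add k2 ?_)
          rw [abs_mul, abs_mul, abs_of_pos (pow_pos hε 2)]
      _ ≤ M * (A * ε) ^ 2 + M₃ * (C₃ * (1 + |x|) * ε ^ 2) := by gcongr
      _ ≤ _ := by
        have : 0 ≤ M * A ^ 2 * ε ^ 2 * |x| := by positivity
        linarith

/-- The order of the quantifiers matters: K is chosen before δ, and only the threshold for ε depends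
on δ. -/
theorem exists_profilePerturbation {f θ : ℝ → ℝ} (hf : IsDoubleWell f)
    (hθ : IsOptimalProfile f θ) {δ' C₀ c₁ C₂ C₃ C₄ : ℝ} (hδ' : 0 < δ') (hC₀ : 0 < C₀)
    (hc₁ : 0 < c₁) (hC₂ : 0 < C₂) (hC₃ : 0 < C₃) (hC₄ : 0 < C₄) :
    ∃ K, 0 < K ∧ ∀ δ : ℝ, 0 < δ → δ' ≤ 3 * δ / 4 → ∃ ε₀ : ℝ, 0 < ε₀ ∧
      ∀ J θ₁ : ℝ → ℝ, C2Bounded δ C₂ J → (∀ r ∈ Icc (-δ) δ, c₁ ≤ J r) →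
        MemLp θ₁ ∞ volume → eLpNorm θ₁ ∞ volume ≤ ENNReal.ofReal C₄ →
      ∀ ε ∈ Ioc 0 ε₀, ∀ (h : ℝ → ℝ) (p : ℝ) (q : ℝ → ℝ), C2Bounded δ C₀ h →
        AEMeasurable q (volume.restrict (Icc (-δ) δ)) →
        (∀ r ∈ Icc (-δ) δ, |p| + ε / (ε + |r|) * |q r| ≤ C₃) →
      ∃ w' γ, ProfilePerturbation f θ θ₁ c₁ K ε p (J 0) γ (δ' / ε) (JEps δ ε h J) w'
        (fun z => iteratedDeriv 2 f (phiEps θ θ₁ ε p q (ε * z))) := by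
  obtain ⟨M, hM0, hM⟩ := hf.exists_taylor
  obtain ⟨M₂, hM₂0, hM₂⟩ := hθ.exists_bound hf 2
  obtain ⟨M₃, hM₃0, hM₃⟩ := hθ.exists_bound hf 3
  set A := C₃ * (C₄ + 1 + δ') with hA
  have hA0 : 0 < A := by positivity
  -- A sum that dominates every constant of the weight and potential estimates and the bounds for p,
  -- γ and J(0).
  set K := C₂ * (2 + 3 * C₀) + (M * A + M * A ^ 2 + M₃ * C₃) + C₃ with hK
  have k1 : C₂ ≤ K := by
    have : 0 ≤ C₂ * (1 + 3 * C₀) + (M * A + M * A ^ 2 + M₃ * C₃) + C₃ := by positivity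
    linarith
  have k2 : C₂ * (1 + C₀) ≤ K := by
    have : 0 ≤ C₂ * (1 + 2 * C₀) + (M * A + M * A ^ 2 + M₃ * C₃) + C₃ := by positivity
    linarith
  have k3 : 2 * C₂ ≤ K := by
    have : 0 ≤ C₂ * (3 * C₀) + (M * A + M * A ^ 2 + M₃ * C₃) + C₃ := by positivity
    linarith
  have k4 : C₂ * (1 + 3 * C₀) ≤ K := by
    have : 0 ≤ (M * A + M * A ^ 2 + M₃ * C₃) + C₃ := by positivity
    linarith
  have k5 : M * A ≤ K := by
    have : 0 ≤ C₂ * (2 + 3 * C₀) + (M * A ^ 2 + M₃ * C₃) + C₃ := by positivity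
    linarith
  have k6 : M * A ^ 2 + M₃ * C₃ ≤ K := by
    have : 0 ≤ C₂ * (2 + 3 * C₀) + M * A + C₃ := by positivity
    linarith
  have k7 : C₃ ≤ K := by
    have : 0 ≤ C₂ * (2 + 3 * C₀) + (M * A + M * A ^ 2 + M₃ * C₃) := by positivity
    linarith
  refine ⟨K, by positivity, fun δ hδ hδδ => ?_⟩
  refine ⟨min (min (δ / 16 / C₀) (1 / 2 / C₀)) (min (min 1 δ') (1 / A)),
    by positivity, ?_⟩
  intro J θ₁ hJ hJc hθ₁ hθ₁n ε hε h p q hh hq hqb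
  obtain ⟨hε0, hε1⟩ := hε
  simp only [le_min_iff, le_div_iff₀ hC₀, le_div_iff₀ hA0] at hε1
  obtain ⟨⟨a1, a2⟩, ⟨a3, a4⟩, a5⟩ := hε1
  obtain ⟨w', γ, hγ, hw'c, hw⟩ :=
    weight_estimates hδ hδδ hδ' hC₀ hC₂ hε0 a1 a2 hJ hJc hh
  have hV := potential_estimates hf hθ hδδ hδ' hC₃ hC₄ hM₃ hM hM0 hε0 a5 a3 hθ₁n hqb
  have hz0 : (0 : ℝ) ∈ Icc (-δ) δ := ⟨by linarith, hδ.le⟩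
  have hJ0 := (le_abs_self _).trans ((hJ.exists_deriv hδ).choose_spec.2.1 0 hz0)
  refine ⟨w', γ, ⟨(one_le_div hε0).2 a4, fun x hx => (hw x hx).1, hw'c,
    fun x hx => hc₁.trans_le (hw x hx).2.1, ?_, M₂ + M * A * ε, ?_⟩,
    fun x hx => (hw x hx).2.1, fun x hx => (hw x hx).2.2.1.trans k1,
    fun x hx => (hw x hx).2.2.2.1.trans (by gcongr),
    fun x hx => (hw x hx).2.2.2.2.1.trans (by gcongr),
    fun x hx => (hw x hx).2.2.2.2.2.trans (by gcongr), ?_, ?_, ?_, hγ.trans k1, hJc 0 hz0,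
    hJ0.trans k1⟩
  · refine ((hf.continuous_iteratedDeriv 2).measurable.comp_aemeasurable ?_).aestronglyMeasurable
    have e : (fun z => phiEps θ θ₁ ε p q (ε * z))
        = fun z => θ z + ε * p * θ₁ z + q (ε * z) * ε ^ 2 := by
      funext z
      rw [phiEps, mul_div_cancel_left₀ _ hε0.ne']
    rw [e]
    have hqm := aemeasurable_comp_mul (R := δ' / ε) hε0
      (by rw [mul_div_cancel₀ _ hε0.ne']; linarith) hq
    exact (hθ.continuous.aemeasurable.add
      (hθ₁.aestronglyMeasurable.aemeasurable.restrict.const_mul _)).add (hqm.mul_const _)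
  · filter_upwards [hV] with x hx
    have := abs_add_le (iteratedDeriv 2 f (phiEps θ θ₁ ε p q (ε * x)) - iteratedDeriv 2 f (θ x))
      (iteratedDeriv 2 f (θ x))
    rw [sub_add_cancel] at this
    linarith [hx.1, hM₂ x]
  · filter_upwards [hV] with x hx using hx.1.trans (by gcongr)
  · filter_upwards [hV] with x hx using hx.2.trans (by gcongr)
  · have := hqb 0 hz0
    have h2 : 0 ≤ ε / (ε + |0|) * |q 0| := by positivity
    linarith

end Perturbation

/-! ### Lower bound for the second eigenvalue. -/

section SecondEigenvalue

variable {f θ θ₁ : ℝ → ℝ} {c K ε p j γ R ρ : ℝ} {w w' V : ℝ → ℝ}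

lemma Coefficients.mono_radius (hc : Coefficients R w w' V) (hρ : 1 ≤ ρ) (hρR : ρ ≤ R) :
    Coefficients ρ w w' V := by
  have hsub : Icc (-ρ) ρ ⊆ Icc (-R) R := Icc_subset_Icc (neg_le_neg hρR) hρR
  have hsub' : Ioo (-ρ) ρ ⊆ Ioo (-R) R := Ioo_subset_Ioo (neg_le_neg hρR) hρR
  obtain ⟨M, hM⟩ := hc.bounded
  exact ⟨hρ, fun x hx => hc.hasDerivAt x (hsub hx), hc.continuousOn_deriv.mono hsub,
    fun x hx => hc.pos x (hsub hx), hc.measurable.mono_set hsub',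
    M, ae_restrict_of_ae_restrict_of_subset hsub' hM⟩

/-- Stability of a spectral gap on a fixed interval under perturbation of weight and potential. -/
lemma ProfilePerturbation.half_gap_le (H : ProfilePerturbation f θ θ₁ c K ε p j γ R w w' V)
    (hf : IsDoubleWell f) (hθ : IsOptimalProfile f θ) (hρ : 1 ≤ ρ) (hρR : ρ ≤ R) (hK : 0 < K)
    (hε : 0 < ε) {ν k : ℝ} (hν : 0 < ν)
    (hk : ∀ x, |iteratedDeriv 2 f (θ x)| ≤ k) (h1 : K * ε * (1 + ρ) ≤ 1)
    (h2 : K * ε * (1 + ρ) ≤ c)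
    (h3 : K * ε * (1 + ρ) * (2 * k + 2 * ν + 1 + K) ≤ c * ν / 2) {y z : ℝ → ℝ}
    (hy : SobolevPair (-ρ) ρ y z)
    (hgap : ν * mass ρ (fun _ => 1) y y ≤
      energy ρ (fun _ => 1) (fun x => iteratedDeriv 2 f (θ x)) y z y z) :
    ν / 2 * mass ρ w y y ≤ energy ρ w V y z y z := by
  have hc := H.coefficients.mono_radius hρ hρR
  have hc₁ := hθ.coefficients hf hρ
  have hyL := hy.memLp_left hc.neg_le
  set s := K * ε * (1 + ρ) with hs
  have hk0 : 0 ≤ k := (abs_nonneg _).trans (hk 0)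
  have hKs : K * ε ≤ s := by
    have : 0 ≤ K * ε * ρ := by positivity
    linarith
  have hKε : 0 < K * ε := by positivity
  have i1 := hc.integrable_energy hy hy
  have i2 := (hc.integrable_mass hyL hyL).const_mul (ν / 2)
  have i3 := (hc₁.integrable_energy hy hy).const_mul (j - s)
  have i4 := (hc₁.integrable_mass hyL hyL).const_mul ((j - s) * k - (k + K * ε + ν / 2) * (j + s))
  have hV := ae_restrict_of_ae_restrict_of_subset
    (Ioo_subset_Ioo (neg_le_neg hρR) hρR) H.potential_sub
  have hmono : ∫ x in Ioo (-ρ) ρ, ((j - s) * ((z x * z x + iteratedDeriv 2 f (θ x) * y x * y x) * 1)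
      + ((j - s) * k - (k + K * ε + ν / 2) * (j + s)) * (y x * y x * 1))
      ≤ ∫ x in Ioo (-ρ) ρ, ((z x * z x + V x * y x * y x) * w x
        - ν / 2 * (y x * y x * w x)) := by
    refine integral_mono_ae (i3.add i4) (i1.sub i2) ?_
    filter_upwards [hV, ae_restrict_mem measurableSet_Ioo] with x hx hxi
    have hxR : x ∈ Icc (-R) R := Icc_subset_Icc (neg_le_neg hρR) hρR (Ioo_subset_Icc_self hxi)
    have hw := abs_le.1 ((H.weight_sub x hxR).trans
      (by rw [hs]; gcongr; exact (abs_lt.2 hxi).le : _ ≤ s))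
    have hw0 := H.coefficients.pos x hxR
    have hfk := abs_le.1 (hk x)
    have hx' := abs_le.1 hx
    set F := iteratedDeriv 2 f (θ x)
    have hy0 := mul_self_nonneg (y x)
    have hz0 := mul_self_nonneg (z x)
    -- The unperturbed density may be negative; adding k makes it nonnegative, so that w can be
    -- replaced by its lower bound. The added term is removed again with the upper bound of w.
    have t1 : (j - s) * (z x * z x + (F + k) * (y x * y x))
        ≤ w x * (z x * z x + (F + k) * (y x * y x)) := by
      refine mul_le_mul_of_nonneg_right (by linarith) (add_nonneg hz0 (mul_nonneg ?_ hy0))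
      linarith
    have t2 : (k + K * ε + ν / 2) * w x * (y x * y x)
        ≤ (k + K * ε + ν / 2) * (j + s) * (y x * y x) := by
      gcongr
      linarith
    have t3 : (F - K * ε) * (y x * y x * w x) ≤ V x * (y x * y x * w x) := by
      refine mul_le_mul_of_nonneg_right (by linarith) (by positivity)
    linarith
  have e1 := integral_add i3 i4
  have e2 := integral_sub i1 i2
  rw [integral_const_mul, integral_const_mul] at e1
  rw [integral_const_mul] at e2
  rw [e1, e2] at hmono
  have hm0 : 0 ≤ mass ρ (fun _ => 1) y y := hc₁.mass_self_nonneg y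
  -- What is left of the gap: j ν / 2 minus terms of size O(s), nonnegative by the smallness
  -- hypothesis.
  have hcoef : 0 ≤ (j - s) * (ν + k) - (k + K * ε + ν / 2) * (j + s) := by
    have hj := H.le_center
    have hjK := H.center_le
    have u1 : K * ε * (j + s) ≤ s * (K + 1) := by
      refine mul_le_mul hKs (by linarith) (by linarith) (hKε.le.trans hKs)
    have u2 : c * ν / 2 ≤ j * ν / 2 := by gcongr
    have u3 : 0 ≤ s * ν / 2 := by
      have : 0 ≤ s := hKε.le.trans hKs
      positivity
    nlinarith
  have f1 : mass ρ (fun _ => 1) y y = ∫ x in Ioo (-ρ) ρ, y x * y x * 1 := rfl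
  have f2 : energy ρ (fun _ => 1) (fun x => iteratedDeriv 2 f (θ x)) y z y z
    = ∫ x in Ioo (-ρ) ρ, (z x * z x + iteratedDeriv 2 f (θ x) * y x * y x) * 1 := rfl
  rw [← f1, ← f2] at hmono
  have hE := mul_le_mul_of_nonneg_left hgap (by linarith [H.le_center] : 0 ≤ j - s)
  have := mul_nonneg hcoef hm0
  simp only [mass, energy] at *
  linarith

/-- The radius ρ depends only on the unperturbed problem. On (-ρ, ρ) half the gap survives; outside,
f''(θ₀) ≥ m/2 loses at most m/4 to the perturbation. -/
theorem exists_second_eigenvalue_bound {𝕜 : Type*} [RCLike 𝕜] {ν : ℝ} (hf : IsDoubleWell f)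
    (hθ : IsOptimalProfile f θ) (hν : IsUnperturbedGap 𝕜 f θ ν) (hc0 : 0 < c) (hK : 0 < K)
    {δ' : ℝ} (hδ' : 0 < δ') :
    ∃ ε₀, 0 < ε₀ ∧ ∀ ε ∈ Ioc 0 ε₀, ∀ (θ₁ : ℝ → ℝ) (p j γ : ℝ) (w w' V : ℝ → ℝ),
      ProfilePerturbation f θ θ₁ c K ε p j γ (δ' / ε) w w' V →
      ∀ (lam₁ lam₂ : ℝ) (e e' u v : ℝ → ℝ), IsEigenbasis (δ' / ε) w V lam₁ e e' lam₂ u v →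
        min (ν / 2) (min (iteratedDeriv 2 f 1) (iteratedDeriv 2 f (-1)) / 4) ≤ lam₂ := by
  set m := min (iteratedDeriv 2 f 1) (iteratedDeriv 2 f (-1)) with hm
  have hm0 : 0 < m := lt_min hf.deriv2_one hf.deriv2_neg_one
  obtain ⟨ρ₀, hρ₀⟩ := hν.exists_gap_inequality hθ hf
  obtain ⟨X, hX⟩ := hθ.exists_outer_bound hf (m := m / 2)
    ((half_lt_self hm0).trans_le (min_le_left _ _))
    ((half_lt_self hm0).trans_le (min_le_right _ _))
  obtain ⟨k, hk0, hk⟩ := hθ.exists_bound hf 2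
  have hν0 := hν.1
  set ρ := max (max ρ₀ X) 1 with hρ
  have hρ1 : 1 ≤ ρ := le_max_right _ _
  obtain ⟨g, hg, hgap⟩ := hρ₀ ρ ((le_max_left _ _).trans (le_max_left _ _)) hρ1
  set D := 2 * k + 2 * ν + 1 + K with hD
  have hD0 : 0 < D := by positivity
  set s₀ := min (min 1 c) (min (c * ν / 2 / D) (m / 4)) with hs₀
  have hs0 : 0 < s₀ := by positivity
  refine ⟨min (s₀ / (K * (1 + ρ))) (δ' / ρ), by positivity, ?_⟩
  intro ε hε θ₁ p j γ w w' V H lam₁ lam₂ e e' u v hb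
  obtain ⟨hε0, hε1⟩ := hε
  simp only [le_min_iff, le_div_iff₀ (by positivity : 0 < K * (1 + ρ)),
    le_div_iff₀ (by positivity : 0 < ρ)] at hε1
  obtain ⟨a1, a2⟩ := hε1
  have hs : K * ε * (1 + ρ) ≤ s₀ := by linarith
  obtain ⟨⟨b1, b2⟩, b3, b4⟩ : (K * ε * (1 + ρ) ≤ 1 ∧ K * ε * (1 + ρ) ≤ c) ∧
      K * ε * (1 + ρ) ≤ c * ν / 2 / D ∧ K * ε * (1 + ρ) ≤ m / 4 := by
    simpa only [hs₀, le_min_iff] using hs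
  rw [le_div_iff₀ hD0] at b3
  have hρR : ρ ≤ δ' / ε := by rw [le_div_iff₀ hε0]; linarith
  refine hb.le_second_of_bracketing H.coefficients hρ1 hρR hg (fun y z hyz hy0 => ?_) ?_
  · refine (mul_le_mul_of_nonneg_right (min_le_left _ _)
      ((H.coefficients.mono_radius hρ1 hρR).mass_self_nonneg y)).trans ?_
    exact H.half_gap_le hf hθ hρ1 hρR hK hε0 hν0 hk b1 b2 b3 hyz (hgap y z hyz hy0)
  · filter_upwards [H.potential_sub] with x hx hxo
    have h1 := hX ρ ((le_max_right _ _).trans (le_max_left _ _)) x hxo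
    have h2 := (abs_le.1 hx).1
    have h3 : 0 ≤ K * ε * ρ := by positivity
    refine (min_le_right _ _).trans ?_
    linarith

end SecondEigenvalue

/-! ### The energy form evaluated at the derivative of the profile. -/

section ProfileEnergy

variable {f θ θ₁ : ℝ → ℝ} {c K ε p j γ R : ℝ} {w w' V : ℝ → ℝ}

lemma abs_integral_le_of_decay {s : Set ℝ} {F : ℝ → ℝ} {A : ℝ} (hA : 0 ≤ A)
    (hF : ∀ᵐ x ∂(volume.restrict s), |F x| ≤ A * (1 + x ^ 2)⁻¹) :
    |∫ x in s, F x| ≤ A * Real.pi := by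
  have hi := integrable_inv_one_add_sq.const_mul A
  calc |∫ x in s, F x| ≤ ∫ x in s, A * (1 + x ^ 2)⁻¹ :=
        norm_integral_le_of_norm_le (f := F) hi.integrableOn hF
    _ ≤ ∫ x, A * (1 + x ^ 2)⁻¹ :=
        setIntegral_le_integral hi (Eventually.of_forall fun x => by positivity)
    _ = A * Real.pi := by rw [integral_const_mul, integral_univ_inv_one_add_sq]

lemma one_add_abs_mul_inv_le (x : ℝ) : (1 + |x|) * (1 + x ^ 2)⁻¹ ≤ 2 := by
  rw [← div_eq_mul_inv, div_le_iff₀ (by positivity)]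
  nlinarith [sq_abs x, sq_nonneg (|x| - 1), abs_nonneg x]

lemma inv_one_add_sq_le_one (x : ℝ) : (1 + x ^ 2)⁻¹ ≤ 1 :=
  inv_le_one_of_one_le₀ (by nlinarith [sq_nonneg x])

/-- One of the two decaying factors absorbs the linear growth of the perturbation; the other keeps
the product integrable over ℝ, uniformly in R. -/
lemma one_add_abs_mul_mul_le {K₀ a b x : ℝ} (ha : |a| ≤ K₀ * (1 + x ^ 2)⁻¹)
    (hb : |b| ≤ K₀ * (1 + x ^ 2)⁻¹) (hK₀ : 0 ≤ K₀) :
    (1 + |x|) * (|a| * |b|) ≤ 2 * K₀ ^ 2 * (1 + x ^ 2)⁻¹ := by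
  have h0 : 0 < (1 + x ^ 2)⁻¹ := by positivity
  calc (1 + |x|) * (|a| * |b|)
      ≤ (1 + |x|) * (K₀ * (1 + x ^ 2)⁻¹ * (K₀ * (1 + x ^ 2)⁻¹)) := by gcongr
    _ = K₀ ^ 2 * (1 + x ^ 2)⁻¹ * ((1 + |x|) * (1 + x ^ 2)⁻¹) := by ring
    _ ≤ K₀ ^ 2 * (1 + x ^ 2)⁻¹ * 2 := by gcongr; exact one_add_abs_mul_inv_le x
    _ = _ := by ring

lemma mul_le_of_decay {K₀ a b x : ℝ} (ha : |a| ≤ K₀ * (1 + x ^ 2)⁻¹)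
    (hb : |b| ≤ K₀ * (1 + x ^ 2)⁻¹) (hK₀ : 0 ≤ K₀) :
    |a| * |b| ≤ K₀ ^ 2 * (1 + x ^ 2)⁻¹ := by
  have h0 : 0 < (1 + x ^ 2)⁻¹ := by positivity
  calc |a| * |b| ≤ K₀ * (1 + x ^ 2)⁻¹ * (K₀ * (1 + x ^ 2)⁻¹) := by gcongr
    _ = K₀ ^ 2 * (1 + x ^ 2)⁻¹ * (1 + x ^ 2)⁻¹ := by ring
    _ ≤ K₀ ^ 2 * (1 + x ^ 2)⁻¹ * 1 := by gcongr; exact inv_one_add_sq_le_one x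
    _ = _ := by ring

lemma IsOptimalProfile.sobolevPair_deriv (hθ : IsOptimalProfile f θ) (hf : IsDoubleWell f)
    (hR : 0 ≤ R) : SobolevPair (-R) R (deriv θ) (fun x => deriv f (θ x)) := by
  have hc : Continuous fun x => deriv f (θ x) := by
    have := (hf.continuous_iteratedDeriv 1).comp hθ.continuous
    rwa [iteratedDeriv_one] at this
  exact ⟨HasACDeriv.of_hasDerivAt (by linarith) (fun x _ => hθ.hasDerivAt_deriv x) hc.continuousOn,
    memLp_Ioo_of_continuousOn hc.continuousOn 2⟩

/-- The energy of the derivative of the profile against a test function, integrated by parts. -/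
lemma Coefficients.energy_deriv_profile (hc : Coefficients R w w' V) (hθ : IsOptimalProfile f θ)
    (hf : IsDoubleWell f) {y z : ℝ → ℝ} (hy : SobolevPair (-R) R y z) :
    IntegrableOn (fun x => -(w' x * deriv f (θ x) * y x)
        + (V x - iteratedDeriv 2 f (θ x)) * deriv θ x * y x * w x) (Ioo (-R) R) ∧
    energy R w V (deriv θ) (fun x => deriv f (θ x)) y z
      = (w R * deriv f (θ R) * y R - w (-R) * deriv f (θ (-R)) * y (-R))
        + ∫ x in Ioo (-R) R, (-(w' x * deriv f (θ x) * y x)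
          + (V x - iteratedDeriv 2 f (θ x)) * deriv θ x * y x * w x) := by
  have hab := hc.neg_le
  have hg := hθ.sobolevPair_deriv hf (by linarith [hc.one_le] : 0 ≤ R)
  have hg₁ : HasACDeriv (-R) R (fun x => deriv f (θ x))
      (fun x => iteratedDeriv 2 f (θ x) * deriv θ x) := by
    refine HasACDeriv.of_hasDerivAt hab
      (fun x _ => (hf.hasDerivAt_deriv (θ x)).comp x (hθ.hasDerivAt x)) ?_
    exact (((hf.continuous_iteratedDeriv 2).comp hθ.continuous).mul
      hθ.continuous_deriv).continuousOn
  have hw := HasACDeriv.of_hasDerivAt hab hc.hasDerivAt hc.continuousOn_deriv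
  have key := SobolevPair.integral_by_parts hab (hw.mul hg₁) hy.acd
  have hint := ((hw.mul hg₁).mul hy.acd).integrableOn hab
  have i1 := hc.integrable_energy hg hy
  refine ⟨(i1.sub hint).congr (Eventually.of_forall fun x => ?_), ?_⟩
  · simp only [Pi.sub_apply]; ring
  rw [← key, energy, ← sub_eq_iff_eq_add', ← integral_sub i1 hint]
  exact integral_congr_ae (Eventually.of_forall fun x => by simp only; ring)

variable {K₀ : ℝ}

/-- Young's inequality with a non-optimal constant; η stays free so that the last term can be
absorbed by coercivity later. -/
lemma abs_young {a b η : ℝ} (hη : 0 < η) : |a * b| ≤ a ^ 2 / η + η * b ^ 2 := by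
  have h1 : (a ^ 2 / η) * η = a ^ 2 := div_mul_cancel₀ _ hη.ne'
  have h2 : 0 ≤ a ^ 2 / η := by positivity
  rw [abs_mul]
  have h3 : (|a| * |b|) ^ 2 ≤ (a ^ 2 / η + η * b ^ 2) ^ 2 := by
    rw [mul_pow, sq_abs, sq_abs]
    have h4 : 0 ≤ η * b ^ 2 := by positivity
    have h5 : a ^ 2 * b ^ 2 = (a ^ 2 / η) * (η * b ^ 2) := by rw [← mul_assoc, h1]
    rw [h5]
    nlinarith [mul_nonneg h2 h4, sq_nonneg (a ^ 2 / η), sq_nonneg (η * b ^ 2)]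
  exact le_of_sq_le_sq h3 (by positivity)


lemma ProfilePerturbation.abs_weight_le (H : ProfilePerturbation f θ θ₁ c K ε p j γ R w w' V)
    {x : ℝ} (hx : x ∈ Icc (-R) R) : |w x| ≤ K := by
  rw [abs_of_pos (H.coefficients.pos x hx)]
  exact H.weight_le x hx

lemma inv_one_add_sq_le {δ' : ℝ} (hε : 0 < ε) (hδ' : 0 < δ') :
    (1 + (δ' / ε) ^ 2)⁻¹ ≤ ε ^ 2 / δ' ^ 2 := by
  rw [inv_le_comm₀ (by positivity) (by positivity), inv_div, div_pow]
  linarith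

/-- Almost orthogonality of the derivative of the profile in the energy form. -/
lemma exists_energy_deriv_profile_le (hf : IsDoubleWell f) (hθ : IsOptimalProfile f θ)
    (hK : 0 < K) {δ' : ℝ} (hδ' : 0 < δ') :
    ∃ A, 0 < A ∧ ∀ (ε : ℝ) (θ₁ : ℝ → ℝ) (p j γ : ℝ) (w w' V : ℝ → ℝ), 0 < ε →
      ProfilePerturbation f θ θ₁ c K ε p j γ (δ' / ε) w w' V →
      ∀ y z, SobolevPair (-(δ' / ε)) (δ' / ε) y z → ∀ η, 0 < η →
        |energy (δ' / ε) w V (deriv θ) (fun x => deriv f (θ x)) y z| ≤ A * ε ^ 2 / η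
          + 6 * η * ((∫ x in Ioo (-(δ' / ε)) (δ' / ε), y x ^ 2)
            + ∫ x in Ioo (-(δ' / ε)) (δ' / ε), z x ^ 2) := by
  obtain ⟨K₀, hK₀, hdec⟩ := hθ.exists_decay hf
  have hd1 : ∀ x, |deriv θ x| ≤ K₀ * (1 + x ^ 2)⁻¹ := fun x => by
    rw [abs_of_pos (hθ.deriv_pos hf x)]; exact (hdec x).1
  have hd2 := fun x => (hdec x).2
  refine ⟨2 * (K * K₀ / δ') ^ 2 + (K ^ 2 * K₀ ^ 2 + K ^ 4 * K₀ ^ 2) * Real.pi, by positivity, ?_⟩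
  intro ε θ₁ p j γ w w' V hε H y z hy η hη
  set R := δ' / ε with hR
  have hc := H.coefficients
  have hab := hc.neg_le
  have hεδ : ε / δ' ≤ 1 := by
    have := hc.one_le
    rw [hR, one_le_div hε] at this
    rwa [div_le_one hδ']
  -- One power of ε is enough for the boundary terms, as Young's inequality squares it.
  have hRinv : (1 + R ^ 2)⁻¹ ≤ ε / δ' := by
    refine (inv_one_add_sq_le hε hδ').trans ?_
    rw [← div_pow]
    have : 0 < ε / δ' := by positivity
    nlinarith
  have htr : ∀ t ∈ Icc (-R) R, y t ^ 2 ≤ 2 * ((∫ x in Ioo (-R) R, y x ^ 2)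
      + ∫ x in Ioo (-R) R, z x ^ 2) := fun t ht => by
    have := hy.sq_le (by linarith [hc.one_le]) ht
    linarith
  have hbd : ∀ t ∈ Icc (-R) R, t ^ 2 = R ^ 2 → |w t * deriv f (θ t) * y t|
      ≤ (K * K₀ / δ') ^ 2 * ε ^ 2 / η + η * (2 * ((∫ x in Ioo (-R) R, y x ^ 2)
      + ∫ x in Ioo (-R) R, z x ^ 2)) := by
    intro t ht htR
    refine (abs_young hη).trans (add_le_add ?_ (by gcongr; exact htr t ht))
    have h1 := hd2 t
    rw [htR] at h1
    have h2 : |w t * deriv f (θ t)| ≤ K * (K₀ * (ε / δ')) := by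
      rw [abs_mul]
      exact mul_le_mul (H.abs_weight_le ht) (h1.trans (by gcongr)) (abs_nonneg _) hK.le
    rw [← sq_abs]
    calc |w t * deriv f (θ t)| ^ 2 / η ≤ (K * (K₀ * (ε / δ'))) ^ 2 / η := by gcongr
      _ = _ := by ring
  have hint : |∫ x in Ioo (-R) R, (-(w' x * deriv f (θ x) * y x)
          + (V x - iteratedDeriv 2 f (θ x)) * deriv θ x * y x * w x)|
      ≤ (K ^ 2 * K₀ ^ 2 + K ^ 4 * K₀ ^ 2) * Real.pi * ε ^ 2 / η
        + 2 * η * ∫ x in Ioo (-R) R, y x ^ 2 := by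
    set D := (K ^ 2 * K₀ ^ 2 + K ^ 4 * K₀ ^ 2) * ε ^ 2 / η with hD
    have hD0 : 0 ≤ D := by positivity
    have i0 := (hy.memLp_left hab).integrable_sq
    have i1 : IntegrableOn (fun x : ℝ => D * (1 + x ^ 2)⁻¹) (Ioo (-R) R) :=
      (integrable_inv_one_add_sq.const_mul D).integrableOn
    have e1 := integral_add i1 (i0.const_mul (2 * η))
    have e2 := (le_abs_self _).trans (abs_integral_le_of_decay (s := Ioo (-R) R)
      (F := fun x : ℝ => D * (1 + x ^ 2)⁻¹) hD0 (Eventually.of_forall fun x => by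
      rw [abs_of_nonneg (by positivity)]))
    rw [integral_const_mul (2 * η)] at e1
    have e3 : |∫ x in Ioo (-R) R, (-(w' x * deriv f (θ x) * y x)
          + (V x - iteratedDeriv 2 f (θ x)) * deriv θ x * y x * w x)|
        ≤ ∫ x in Ioo (-R) R, (D * (1 + x ^ 2)⁻¹ + 2 * η * y x ^ 2) := by
      refine norm_integral_le_of_norm_le (f := fun x => -(w' x * deriv f (θ x) * y x)
        + (V x - iteratedDeriv 2 f (θ x)) * deriv θ x * y x * w x)
        (i1.add (i0.const_mul (2 * η))) ?_
      filter_upwards [H.potential_sub, ae_restrict_mem measurableSet_Ioo] with x hx hxi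
      have hxi' := Ioo_subset_Icc_self hxi
      have b1 := hd1 x
      have b2 := hd2 x
      have q0 : 0 < (1 + x ^ 2)⁻¹ := by positivity
      have q1 := inv_one_add_sq_le_one x
      have c1 : (w' x * deriv f (θ x)) ^ 2 ≤ K ^ 2 * K₀ ^ 2 * ε ^ 2 * (1 + x ^ 2)⁻¹ := by
        rw [← sq_abs, abs_mul]
        calc (|w' x| * |deriv f (θ x)|) ^ 2 ≤ (K * ε * (K₀ * (1 + x ^ 2)⁻¹)) ^ 2 := by
              gcongr; exact H.deriv_le x hxi'
          _ = K ^ 2 * K₀ ^ 2 * ε ^ 2 * (1 + x ^ 2)⁻¹ * (1 + x ^ 2)⁻¹ := by ring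
          _ ≤ K ^ 2 * K₀ ^ 2 * ε ^ 2 * (1 + x ^ 2)⁻¹ * 1 := by gcongr
          _ = _ := mul_one _
      have c2 : ((V x - iteratedDeriv 2 f (θ x)) * deriv θ x * w x) ^ 2
          ≤ K ^ 4 * K₀ ^ 2 * ε ^ 2 * (1 + x ^ 2)⁻¹ := by
        rw [← sq_abs, abs_mul, abs_mul]
        calc (|V x - iteratedDeriv 2 f (θ x)| * |deriv θ x| * |w x|) ^ 2
            ≤ (K * ε * (K₀ * (1 + x ^ 2)⁻¹) * K) ^ 2 := by
              gcongr; exact H.abs_weight_le hxi'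
          _ = K ^ 4 * K₀ ^ 2 * ε ^ 2 * (1 + x ^ 2)⁻¹ * (1 + x ^ 2)⁻¹ := by ring
          _ ≤ K ^ 4 * K₀ ^ 2 * ε ^ 2 * (1 + x ^ 2)⁻¹ * 1 := by gcongr
          _ = _ := mul_one _
      have y1 := abs_young (a := w' x * deriv f (θ x)) (b := y x) hη
      have y2 := abs_young (a := (V x - iteratedDeriv 2 f (θ x)) * deriv θ x * w x)
        (b := y x) hη
      simp only [Real.norm_eq_abs]
      calc _ ≤ |w' x * deriv f (θ x) * y x|
            + |(V x - iteratedDeriv 2 f (θ x)) * deriv θ x * w x * y x| := by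
            refine (abs_add_le _ _).trans (le_of_eq ?_)
            rw [abs_neg]; congr 2; ring
        _ ≤ K ^ 2 * K₀ ^ 2 * ε ^ 2 * (1 + x ^ 2)⁻¹ / η + η * y x ^ 2
            + (K ^ 4 * K₀ ^ 2 * ε ^ 2 * (1 + x ^ 2)⁻¹ / η + η * y x ^ 2) :=
          add_le_add (y1.trans (by gcongr)) (y2.trans (by gcongr))
        _ = _ := by rw [hD]; ring
    refine e3.trans ?_
    rw [e1]
    have : D * Real.pi
        = (K ^ 2 * K₀ ^ 2 + K ^ 4 * K₀ ^ 2) * Real.pi * ε ^ 2 / η := by rw [hD]; ring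
    linarith
  rw [(hc.energy_deriv_profile hθ hf hy).2]
  have f1 := hbd R (right_mem_Icc.2 hab) rfl
  have f2 := hbd (-R) (left_mem_Icc.2 hab) (by ring)
  have hz0 : 0 ≤ ∫ x in Ioo (-R) R, z x ^ 2 := integral_nonneg fun x => sq_nonneg _
  have hz1 := mul_nonneg hη.le hz0
  have f3 := abs_add_le (w R * deriv f (θ R) * y R - w (-R) * deriv f (θ (-R)) * y (-R))
    (∫ x in Ioo (-R) R, (-(w' x * deriv f (θ x) * y x)
          + (V x - iteratedDeriv 2 f (θ x)) * deriv θ x * y x * w x))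
  have f4 := abs_sub (w R * deriv f (θ R) * y R) (w (-R) * deriv f (θ (-R)) * y (-R))
  have f5 : (2 * (K * K₀ / δ') ^ 2 + (K ^ 2 * K₀ ^ 2 + K ^ 4 * K₀ ^ 2) * Real.pi) * ε ^ 2 / η
      = 2 * ((K * K₀ / δ') ^ 2 * ε ^ 2 / η)
        + (K ^ 2 * K₀ ^ 2 + K ^ 4 * K₀ ^ 2) * Real.pi * ε ^ 2 / η := by ring
  linarith

/-- The energy of the derivative of the profile is of second order. -/
lemma exists_energy_deriv_profile_self_le (hf : IsDoubleWell f) (hθ : IsOptimalProfile f θ)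
    (hK : 0 < K) {δ' C₄ : ℝ} (hδ' : 0 < δ') (hC₄ : 0 < C₄) :
    ∃ A, 0 < A ∧ ∀ (ε : ℝ) (θ₁ : ℝ → ℝ) (p j γ : ℝ) (w w' V : ℝ → ℝ), 0 < ε →
      AEStronglyMeasurable θ₁ volume → (∀ᵐ x, |θ₁ x| ≤ C₄) →
      ∫ x, iteratedDeriv 3 f (θ x) * deriv θ x ^ 2 * θ₁ x = 0 →
      ProfilePerturbation f θ θ₁ c K ε p j γ (δ' / ε) w w' V → 0 < c →
        |energy (δ' / ε) w V (deriv θ) (fun x => deriv f (θ x)) (deriv θ)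
          (fun x => deriv f (θ x))| ≤ A * ε ^ 2 := by
  obtain ⟨K₀, hK₀, hdec⟩ := hθ.exists_decay hf
  obtain ⟨M, hM0, hM⟩ := hθ.exists_bound hf 3
  have hd1 : ∀ x, |deriv θ x| ≤ K₀ * (1 + x ^ 2)⁻¹ := fun x => by
    rw [abs_of_pos (hθ.deriv_pos hf x)]; exact (hdec x).1
  have hd2 := fun x => (hdec x).2
  set A₁ := (K + K ^ 2 + K ^ 2 * M * C₄) * (2 * K₀ ^ 2) with hA₁
  set A₂ := M * C₄ * (2 * K₀ ^ 2) / δ' with hA₂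
  refine ⟨2 * (K * K₀ ^ 2 / δ' ^ 2) + A₁ * Real.pi + K * (K₀ ^ 2 / δ') + K ^ 2 * (A₂ * Real.pi),
    by positivity, ?_⟩
  intro ε θ₁ p j γ w w' V hε hθ₁m hθ₁b horth H hc0
  set R := δ' / ε with hR
  have hc := H.coefficients
  have hab := hc.neg_le
  have hR0 : 0 ≤ R := by linarith [hc.one_le]
  have hg := hθ.sobolevPair_deriv hf hR0
  have hgc := hθ.continuous_deriv
  have hg₁c : Continuous fun x => deriv f (θ x) := by
    have := (hf.continuous_iteratedDeriv 1).comp hθ.continuous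
    rwa [iteratedDeriv_one] at this
  have hRinv : (1 + R ^ 2)⁻¹ ≤ ε ^ 2 / δ' ^ 2 := inv_one_add_sq_le hε hδ'
  have hj0 : 0 < j := hc0.trans_le H.le_center
  have hbd : ∀ t ∈ Icc (-R) R, t ^ 2 = R ^ 2 →
      |w t * deriv f (θ t) * deriv θ t| ≤ K * K₀ ^ 2 / δ' ^ 2 * ε ^ 2 := by
    intro t ht htR
    have h1 := mul_le_of_decay (hd2 t) (hd1 t) hK₀.le
    rw [htR] at h1
    rw [mul_assoc, abs_mul, abs_mul]
    calc |w t| * (|deriv f (θ t)| * |deriv θ t|) ≤ K * (K₀ ^ 2 * (ε ^ 2 / δ' ^ 2)) := by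
          refine mul_le_mul (H.abs_weight_le ht) (h1.trans (by gcongr)) (by positivity) hK.le
      _ = _ := by ring
  obtain ⟨iT, hT⟩ := hc.energy_deriv_profile hθ hf hg
  have iS1 : IntegrableOn (fun x => deriv f (θ x) * deriv θ x) (Ioo (-R) R) :=
    (memLp_Ioo_of_continuousOn (hg₁c.mul hgc).continuousOn 1).integrable le_rfl
  have hS2b : ∀ᵐ x, |iteratedDeriv 3 f (θ x) * deriv θ x ^ 2 * θ₁ x|
      ≤ M * C₄ * (|deriv θ x| * |deriv θ x|) := by
    filter_upwards [hθ₁b] with x hx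
    rw [abs_mul, abs_mul, abs_pow]
    calc _ ≤ M * |deriv θ x| ^ 2 * C₄ := by gcongr; exact hM x
      _ = _ := by ring
  have iS2 : Integrable fun x => iteratedDeriv 3 f (θ x) * deriv θ x ^ 2 * θ₁ x := by
    refine (integrable_inv_one_add_sq.const_mul (M * C₄ * K₀ ^ 2)).mono'
      ((((hf.continuous_iteratedDeriv 3).comp hθ.continuous).mul
        (hgc.pow 2)).aestronglyMeasurable.mul hθ₁m) ?_
    filter_upwards [hS2b] with x hx
    refine hx.trans ?_
    rw [mul_assoc (M * C₄)]
    exact mul_le_mul_of_nonneg_left (mul_le_of_decay (hd1 x) (hd1 x) hK₀.le) (by positivity)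
  -- The integrand is half the derivative of θ'², so only its values at ±R remain.
  have hS1 : |∫ x in Ioo (-R) R, deriv f (θ x) * deriv θ x| ≤ K₀ ^ 2 / δ' * ε := by
    have h1 := SobolevPair.integral_by_parts hab hg.acd hg.acd
    have h2 : ∫ x in Ioo (-R) R, (deriv f (θ x) * deriv θ x + deriv θ x * deriv f (θ x))
        = 2 * ∫ x in Ioo (-R) R, deriv f (θ x) * deriv θ x := by
      rw [← integral_const_mul]
      exact integral_congr_ae (Eventually.of_forall fun x => by simp only; ring)
    have h3 : ∀ t, t ^ 2 = R ^ 2 → |deriv θ t * deriv θ t| ≤ K₀ ^ 2 / δ' * ε := by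
      intro t ht
      have h4 := mul_le_of_decay (hd1 t) (hd1 t) hK₀.le
      have hεδ : ε / δ' ≤ 1 := by
        have := hc.one_le
        rw [hR, one_le_div hε] at this
        rwa [div_le_one hδ']
      have h5 : (ε / δ') ^ 2 ≤ ε / δ' := by
        have : 0 < ε / δ' := by positivity
        nlinarith
      rw [ht, ← abs_mul] at h4
      calc _ ≤ K₀ ^ 2 * (ε ^ 2 / δ' ^ 2) := h4.trans (by gcongr)
        _ = K₀ ^ 2 * (ε / δ') ^ 2 := by rw [div_pow]
        _ ≤ K₀ ^ 2 * (ε / δ') := by gcongr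
        _ = _ := by ring
    have h6 := abs_le.1 (h3 R rfl)
    have h7 := abs_le.1 (h3 (-R) (by ring))
    rw [abs_le]
    constructor <;> linarith
  -- The integral over ℝ is zero, so the integral over the interval is minus the tail; there |x| ≥
  -- δ'/ε, and 1 ≤ (ε/δ')(1 + |x|) gains the factor ε.
  have hS2 : |∫ x in Ioo (-R) R, iteratedDeriv 3 f (θ x) * deriv θ x ^ 2 * θ₁ x|
      ≤ A₂ * Real.pi * ε := by
    have h1 := integral_add_compl (measurableSet_Ioo (a := -R) (b := R)) iS2
    rw [horth] at h1
    rw [eq_neg_of_add_eq_zero_left h1, abs_neg]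
    have h2 := abs_integral_le_of_decay (s := (Ioo (-R) R)ᶜ) (A := A₂ * ε) (F := fun x =>
      iteratedDeriv 3 f (θ x) * deriv θ x ^ 2 * θ₁ x) (by positivity) (by
      rw [ae_restrict_iff' measurableSet_Ioo.compl]
      filter_upwards [hS2b] with x hx hxo
      have h3 : R ≤ |x| := by
        by_contra hlt
        exact hxo (abs_lt.1 (not_le.1 hlt))
      have h4 : 1 ≤ ε / δ' * (1 + |x|) := by
        rw [hR, div_le_iff₀ hε] at h3
        rw [div_mul_eq_mul_div, one_le_div hδ']
        linarith
      calc _ ≤ M * C₄ * (|deriv θ x| * |deriv θ x|) := hx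
        _ = M * C₄ * (1 * (|deriv θ x| * |deriv θ x|)) := by ring
        _ ≤ M * C₄ * (ε / δ' * (1 + |x|) * (|deriv θ x| * |deriv θ x|)) := by gcongr
        _ = M * C₄ * (ε / δ') * ((1 + |x|) * (|deriv θ x| * |deriv θ x|)) := by ring
        _ ≤ M * C₄ * (ε / δ') * (2 * K₀ ^ 2 * (1 + x ^ 2)⁻¹) := by
          gcongr ?_ * ?_
          exact one_add_abs_mul_mul_le (hd1 x) (hd1 x) hK₀.le
        _ = _ := by rw [hA₂]; ring)
    linarith
  -- The part of the integrand of order ε, with the weight frozen at the center; the rest is O(ε²)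
  -- with at most linear growth against the decaying factors.
  set S : ℝ → ℝ := fun x => -(ε * γ) * (deriv f (θ x) * deriv θ x)
    + ε * p * j * (iteratedDeriv 3 f (θ x) * deriv θ x ^ 2 * θ₁ x) with hS
  have iS : IntegrableOn S (Ioo (-R) R) :=
    (iS1.const_mul _).add (iS2.integrableOn.const_mul _)
  have hSint : ∫ x in Ioo (-R) R, S x = -(ε * γ) * (∫ x in Ioo (-R) R, deriv f (θ x) * deriv θ x)
      + ε * p * j * ∫ x in Ioo (-R) R, iteratedDeriv 3 f (θ x) * deriv θ x ^ 2 * θ₁ x := by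
    rw [← integral_const_mul, ← integral_const_mul,
      ← integral_add (iS1.const_mul _) (iS2.integrableOn.const_mul _)]
  have hSb : |∫ x in Ioo (-R) R, S x|
      ≤ (K * (K₀ ^ 2 / δ') + K ^ 2 * (A₂ * Real.pi)) * ε ^ 2 := by
    rw [hSint]
    refine (abs_add_le _ _).trans ?_
    rw [abs_mul, abs_mul, abs_neg, abs_mul, abs_mul, abs_mul, abs_of_pos hε, abs_of_pos hj0]
    calc _ ≤ ε * K * (K₀ ^ 2 / δ' * ε) + ε * K * K * (A₂ * Real.pi * ε) := by
          gcongr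
          · exact H.abs_slope_le
          · exact H.abs_p_le
          · exact H.center_le
      _ = _ := by ring
  have hEb : |∫ x in Ioo (-R) R, ((-(w' x * deriv f (θ x) * deriv θ x)
      + (V x - iteratedDeriv 2 f (θ x)) * deriv θ x * deriv θ x * w x) - S x)|
      ≤ A₁ * ε ^ 2 * Real.pi := by
    refine abs_integral_le_of_decay (F := fun x => (-(w' x * deriv f (θ x) * deriv θ x)
      + (V x - iteratedDeriv 2 f (θ x)) * deriv θ x * deriv θ x * w x) - S x)
      (by positivity) ?_
    filter_upwards [H.potential_sub_sub, ae_restrict_mem measurableSet_Ioo,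
      ae_restrict_of_ae hθ₁b] with x hx hxi hxθ
    have hxi' := Ioo_subset_Icc_self hxi
    have d1 := one_add_abs_mul_mul_le (hd2 x) (hd1 x) hK₀.le
    have d2 := one_add_abs_mul_mul_le (hd1 x) (hd1 x) hK₀.le
    have e : (-(w' x * deriv f (θ x) * deriv θ x)
      + (V x - iteratedDeriv 2 f (θ x)) * deriv θ x * deriv θ x * w x) - S x
      = -((w' x - ε * γ) * (deriv f (θ x) * deriv θ x))
        + (V x - iteratedDeriv 2 f (θ x) - ε * p * (iteratedDeriv 3 f (θ x) * θ₁ x))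
          * (deriv θ x * deriv θ x) * w x
        + ε * p * (iteratedDeriv 3 f (θ x) * θ₁ x) * (w x - j) * (deriv θ x * deriv θ x) := by
      rw [hS]; ring
    have t1 : |(w' x - ε * γ) * (deriv f (θ x) * deriv θ x)|
        ≤ K * ε ^ 2 * (2 * K₀ ^ 2 * (1 + x ^ 2)⁻¹) := by
      rw [abs_mul, abs_mul]
      calc _ ≤ K * ε ^ 2 * (1 + |x|) * (|deriv f (θ x)| * |deriv θ x|) := by
            gcongr; exact H.deriv_sub x hxi'
        _ = K * ε ^ 2 * ((1 + |x|) * (|deriv f (θ x)| * |deriv θ x|)) := by ring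
        _ ≤ _ := by gcongr ?_ * ?_
    have t2 : |(V x - iteratedDeriv 2 f (θ x) - ε * p * (iteratedDeriv 3 f (θ x) * θ₁ x))
          * (deriv θ x * deriv θ x) * w x| ≤ K ^ 2 * ε ^ 2 * (2 * K₀ ^ 2 * (1 + x ^ 2)⁻¹) := by
      rw [abs_mul, abs_mul, abs_mul (deriv θ x)]
      calc _ ≤ K * ε ^ 2 * (1 + |x|) * (|deriv θ x| * |deriv θ x|) * K := by
            gcongr; exact H.abs_weight_le hxi'
        _ = K ^ 2 * ε ^ 2 * ((1 + |x|) * (|deriv θ x| * |deriv θ x|)) := by ring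
        _ ≤ _ := by gcongr ?_ * ?_
    have t3 : |ε * p * (iteratedDeriv 3 f (θ x) * θ₁ x) * (w x - j) * (deriv θ x * deriv θ x)|
        ≤ K ^ 2 * M * C₄ * ε ^ 2 * (2 * K₀ ^ 2 * (1 + x ^ 2)⁻¹) := by
      rw [abs_mul, abs_mul, abs_mul, abs_mul, abs_mul, abs_mul (deriv θ x), abs_of_pos hε]
      calc _ ≤ ε * K * (M * C₄) * (K * ε * (1 + |x|)) * (|deriv θ x| * |deriv θ x|) := by
            gcongr
            · exact H.abs_p_le
            · exact hM x
            · exact H.weight_sub x hxi'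
        _ = K ^ 2 * M * C₄ * ε ^ 2 * ((1 + |x|) * (|deriv θ x| * |deriv θ x|)) := by ring
        _ ≤ _ := by gcongr ?_ * ?_
    rw [e]
    refine (abs_add_three _ _ _).trans ?_
    rw [abs_neg]
    refine (add_le_add (add_le_add t1 t2) t3).trans (le_of_eq ?_)
    rw [hA₁]; ring
  rw [integral_sub iT iS] at hEb
  rw [hT]
  have g1 := abs_le.1 (hbd R (right_mem_Icc.2 hab) rfl)
  have g2 := abs_le.1 (hbd (-R) (left_mem_Icc.2 hab) (by ring))
  have g3 := abs_le.1 hEb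
  have g4 := abs_le.1 hSb
  rw [abs_le]
  constructor <;> linarith

end ProfileEnergy

/-! ### The first eigenpair. -/

section FirstEigenvalue

variable {f θ θ₁ : ℝ → ℝ} {c K ε p j γ R : ℝ} {w w' V y z : ℝ → ℝ}

lemma Coefficients.mass_combination_le (hc : Coefficients R w w' V)
    (hy : MemLp y 2 (volume.restrict (Ioo (-R) R)))
    (hz : MemLp z 2 (volume.restrict (Ioo (-R) R))) (s t : ℝ) :
    mass R w (fun x => s * y x + t * z x) (fun x => s * y x + t * z x)
      ≤ 2 * s ^ 2 * mass R w y y + 2 * t ^ 2 * mass R w z z := by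
  have hyz : MemLp (fun x => s * y x + t * z x) 2 (volume.restrict (Ioo (-R) R)) :=
    (hy.const_mul s).add (hz.const_mul t)
  have i1 := (hc.integrable_mass hy hy).const_mul (2 * s ^ 2)
  have i2 := (hc.integrable_mass hz hz).const_mul (2 * t ^ 2)
  simp only [mass]
  rw [← integral_const_mul, ← integral_const_mul, ← integral_add i1 i2]
  refine setIntegral_mono_on (hc.integrable_mass hyz hyz) (i1.add i2) measurableSet_Ioo
    fun x hx => ?_
  have hw := (hc.pos x (Ioo_subset_Icc_self hx)).le
  have := mul_nonneg (sq_nonneg (s * y x - t * z x)) hw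
  linarith

lemma Coefficients.const_mul_integral_sq_le (hc : Coefficients R w w' V)
    (hw : ∀ x ∈ Icc (-R) R, c ≤ w x) (hy : MemLp y 2 (volume.restrict (Ioo (-R) R))) :
    c * ∫ x in Ioo (-R) R, y x ^ 2 ≤ mass R w y y := by
  rw [mass, ← integral_const_mul]
  refine setIntegral_mono_on (hy.integrable_sq.const_mul c) (hc.integrable_mass hy hy)
    measurableSet_Ioo fun x hx => ?_
  have := mul_le_mul_of_nonneg_right (hw x (Ioo_subset_Icc_self hx)) (sq_nonneg (y x))
  linarith

lemma Coefficients.mass_le_of_le (hc : Coefficients R w w' V)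
    (hw : ∀ x ∈ Icc (-R) R, w x ≤ K) (hy : MemLp y 2 (volume.restrict (Ioo (-R) R))) :
    mass R w y y ≤ K * ∫ x in Ioo (-R) R, y x ^ 2 := by
  rw [mass, ← integral_const_mul]
  refine setIntegral_mono_on (hc.integrable_mass hy hy) (hy.integrable_sq.const_mul K)
    measurableSet_Ioo fun x hx => ?_
  have := mul_le_mul_of_nonneg_right (hw x (Ioo_subset_Icc_self hx)) (sq_nonneg (y x))
  linarith

/-- Gårding's inequality: together with a bound on the mass, the energy controls the derivative. -/
lemma Coefficients.mass_deriv_sub_le_energy (hc : Coefficients R w w' V)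
    {M : ℝ} (hV : ∀ᵐ x ∂(volume.restrict (Ioo (-R) R)), |V x| ≤ M) (hy : SobolevPair (-R) R y z) :
    mass R w z z - M * mass R w y y ≤ energy R w V y z y z := by
  have hyL := hy.memLp_left hc.neg_le
  have i1 := hc.integrable_mass hy.memLp hy.memLp
  have i2 := (hc.integrable_mass hyL hyL).const_mul M
  rw [mass, mass, energy, ← integral_const_mul, ← integral_sub i1 i2]
  refine integral_mono_ae (i1.sub i2) (hc.integrable_energy hy hy) ?_
  filter_upwards [hV, ae_restrict_mem measurableSet_Ioo] with x hx hxi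
  have hw := (hc.pos x (Ioo_subset_Icc_self hxi)).le
  have := mul_le_mul_of_nonneg_right (_root_.neg_le.1 ((neg_le_abs _).trans hx))
    (mul_nonneg (mul_self_nonneg (y x)) hw)
  linarith

set_option maxHeartbeats 1000000 in
/-- Bounds for the first eigenpair given a lower bound `κ` for the second eigenvalue. -/
theorem exists_first_eigenpair_bound (hf : IsDoubleWell f) (hθ : IsOptimalProfile f θ)
    {κ δ' C₄ : ℝ} (hc0 : 0 < c) (hK : 0 < K) (hκ : 0 < κ) (hδ' : 0 < δ') (hC₄ : 0 < C₄) :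
    ∃ A, 0 < A ∧ ∃ ε₀, 0 < ε₀ ∧ ∀ ε ∈ Ioc 0 ε₀, ∀ (θ₁ : ℝ → ℝ) (p j γ : ℝ) (w w' V : ℝ → ℝ),
      AEStronglyMeasurable θ₁ volume → (∀ᵐ x, |θ₁ x| ≤ C₄) →
      ∫ x, iteratedDeriv 3 f (θ x) * deriv θ x ^ 2 * θ₁ x = 0 →
      ProfilePerturbation f θ θ₁ c K ε p j γ (δ' / ε) w w' V →
      ∀ (lam₁ lam₂ : ℝ) (e e' u v : ℝ → ℝ), IsEigenbasis (δ' / ε) w V lam₁ e e' lam₂ u v →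
        (∀ x ∈ Icc (-(δ' / ε)) (δ' / ε), 0 ≤ e x) → κ ≤ lam₂ →
        |lam₁| ≤ A * ε ^ 2 ∧ ∀ b, b = (√j)⁻¹ *
            (√(∫ x in Ioo (-(δ' / ε)) (δ' / ε), deriv θ x ^ 2))⁻¹ →
          mass (δ' / ε) w (fun x => e x - b * deriv θ x) (fun x => e x - b * deriv θ x)
              ≤ A * ε ^ 2 ∧
            mass (δ' / ε) w (fun x => e' x - b * deriv f (θ x))
              (fun x => e' x - b * deriv f (θ x)) ≤ A * ε ^ 2 := by
  obtain ⟨K₀, hK₀, hdec⟩ := hθ.exists_decay hf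
  have hd1 : ∀ x, |deriv θ x| ≤ K₀ * (1 + x ^ 2)⁻¹ := fun x => by
    rw [abs_of_pos (hθ.deriv_pos hf x)]; exact (hdec x).1
  have hd2 := fun x => (hdec x).2
  obtain ⟨k, hk0, hk⟩ := hθ.exists_bound hf 2
  obtain ⟨A₀, hA₀, hlin⟩ := exists_energy_deriv_profile_le (c := c) hf hθ hK hδ'
  obtain ⟨A₁, hA₁, hquad⟩ := exists_energy_deriv_profile_self_le (c := c) hf hθ hK hδ' hC₄
  have hgc := hθ.continuous_deriv
  have hG₁ : 0 < ∫ x in Ioo (-1 : ℝ) 1, deriv θ x ^ 2 := by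
    rw [← integral_Ioc_eq_integral_Ioo, ← intervalIntegral.integral_of_le (by norm_num)]
    exact intervalIntegral.intervalIntegral_pos_of_pos
      ((hgc.pow 2).intervalIntegrable _ _) (fun x => pow_pos (hθ.deriv_pos hf x) 2) (by norm_num)
  set G₁ := ∫ x in Ioo (-1 : ℝ) 1, deriv θ x ^ 2 with hG₁def
  set M := k + K * δ' with hM
  have hM0 : 0 < M := by positivity
  -- Coercivity constant on the complement of e: the mass is at most B/κ, and the mass of the
  -- derivative at most B + M B/κ.
  set Cb := 1 / κ + 1 + M / κ with hCb
  have hCb0 : 0 < Cb := by positivity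
  set AB := 24 * A₀ * Cb / c with hAB
  have hAB0 : 0 < AB := by positivity
  set P := K₀ ^ 2 * Real.pi with hP
  have hP0 : 0 < P := by have := Real.pi_pos; positivity
  set D := 2 * K * P + Cb * AB with hD
  have hD0 : 0 < D := by positivity
  set g₀ := c * G₁ with hg₀
  have hg₀0 : 0 < g₀ := by positivity
  set A₂ := 2 * (D ^ 2 / (g₀ / 2 * g₀ ^ 2)) * (K * P) + 2 * (2 / g₀) * (Cb * AB) with hA₂
  -- The threshold makes the mass of Φ at most half of the lower bound g₀ for the mass of g, so that
  -- a stays away from 0.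
  refine ⟨2 * (A₁ + AB) / g₀ + A₂, by positivity, min 1 (g₀ / 2 / (Cb * AB)), by positivity, ?_⟩
  intro ε hε θ₁ p j γ w w' V hθ₁m hθ₁b horth H lam₁ lam₂ e e' u v hb hepos hlam₂
  obtain ⟨hε0, hε1⟩ := hε
  simp only [le_min_iff, le_div_iff₀ (by positivity : 0 < Cb * AB)] at hε1
  obtain ⟨hε1, hε2⟩ := hε1
  have hεsq : ε ^ 2 ≤ ε := by nlinarith
  have hlin' := hlin ε θ₁ p j γ w w' V hε0 H
  have hquad' := hquad ε θ₁ p j γ w w' V hε0 hθ₁m hθ₁b horth H hc0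
  have hεδ : ε ≤ δ' := by
    have := H.coefficients.one_le
    rwa [one_le_div hε0] at this
  clear hlin hquad
  generalize δ' / ε = R at *
  have hc := H.coefficients
  have hab := hc.neg_le
  have hR0 : 0 ≤ R := by linarith [hc.one_le]
  have hg := hθ.sobolevPair_deriv hf hR0
  have he := hb.first.sobolevPair hc
  have hgL := hg.memLp_left hab
  have heL := he.memLp_left hab
  set g : ℝ → ℝ := deriv θ with hgdef
  set g₁ : ℝ → ℝ := fun x => deriv f (θ x) with hg₁def
  set a := mass R w g e with ha
  have hΦ := hg.add (he.const_mul (-a))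
  have hΦL := hΦ.memLp_left hab
  set Φ : ℝ → ℝ := fun x => g x + -a * e x with hΦdef
  set Φ' : ℝ → ℝ := fun x => g₁ x + -a * e' x with hΦ'def
  have haeL : MemLp (fun x => -a * e x) 2 (volume.restrict (Ioo (-R) R)) := heL.const_mul (-a)
  have m1 : ∀ y, MemLp y 2 (volume.restrict (Ioo (-R) R)) →
      mass R w Φ y = mass R w g y - a * mass R w e y := fun y hy => by
    rw [hΦdef, hc.mass_add hgL haeL hy, mass_const_mul]; ring
  have horth' : mass R w e Φ = 0 := by
    rw [mass_comm, m1 e heL, hb.mass_first]; ring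
  have m2 : mass R w Φ Φ = mass R w g g - a ^ 2 := by
    rw [m1 Φ hΦL, horth', mass_comm, m1 g hgL, mass_comm (u := e)]; ring
  have b1 : ∀ y z, SobolevPair (-R) R y z →
      energy R w V Φ Φ' y z = energy R w V g g₁ y z - a * (lam₁ * mass R w e y) :=
    fun y z hyz => by
      rw [hΦdef, hΦ'def, hc.energy_add hg (he.const_mul (-a)) hyz, energy_const_mul,
        hb.first.energy_eq hc hyz]; ring
  -- The e component of g drops out because e is an eigenfunction orthogonal to Φ.
  have b2 : energy R w V Φ Φ' Φ Φ' = energy R w V g g₁ Φ Φ' := by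
    rw [b1 _ _ hΦ, horth']; ring
  have b3 : energy R w V Φ Φ' Φ Φ' = energy R w V g g₁ g g₁ - a ^ 2 * lam₁ := by
    rw [b2, energy_comm, b1 _ _ hg, mass_comm (u := e)]; ring
  have hV : ∀ᵐ x ∂(volume.restrict (Ioo (-R) R)), |V x| ≤ M := by
    filter_upwards [H.potential_sub] with x hx
    have h1 := abs_add_le (V x - iteratedDeriv 2 f (θ x)) (iteratedDeriv 2 f (θ x))
    rw [sub_add_cancel] at h1
    have h2 : K * ε ≤ K * δ' := by gcongr
    linarith [hk x]
  have hcoer1 := hb.second_le _ _ hΦ horth'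
  have hcoer2 := hc.mass_deriv_sub_le_energy hV hΦ
  have hmΦ := hc.mass_self_nonneg Φ
  have hmΦ' := hc.mass_self_nonneg Φ'
  have q1 := hc.const_mul_integral_sq_le H.le_weight hΦL
  have q2 := hc.const_mul_integral_sq_le H.le_weight hΦ.memLp
  set B := energy R w V Φ Φ' Φ Φ' with hB
  have hκB : κ * mass R w Φ Φ ≤ B := (mul_le_mul_of_nonneg_right hlam₂ hmΦ).trans hcoer1
  have hB0 : 0 ≤ B := (mul_nonneg hκ.le hmΦ).trans hκB
  have hmΦB : mass R w Φ Φ ≤ B / κ := by rwa [le_div_iff₀ hκ, mul_comm]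
  have hsum : mass R w Φ Φ + mass R w Φ' Φ' ≤ Cb * B := by
    have h1 : M * mass R w Φ Φ ≤ M * (B / κ) := by gcongr
    have h2 : Cb * B = B / κ + B + M * (B / κ) := by rw [hCb]; ring
    linarith
  -- With η = c / (12 Cb) the quadratic term of the linear estimate is at most B/2 and is absorbed.
  have hBle : B ≤ AB * ε ^ 2 := by
    have h1 := (le_abs_self _).trans (hlin' Φ Φ' hΦ (c / (12 * Cb)) (by positivity))
    rw [← b2] at h1
    have h2 : A₀ * ε ^ 2 / (c / (12 * Cb)) = AB * ε ^ 2 / 2 := by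
      rw [hAB]; field_simp; norm_num
    have h3 : 6 * (c / (12 * Cb)) * ((∫ x in Ioo (-R) R, Φ x ^ 2) + ∫ x in Ioo (-R) R, Φ' x ^ 2)
        ≤ B / 2 := by
      have h4 : c * ((∫ x in Ioo (-R) R, Φ x ^ 2) + ∫ x in Ioo (-R) R, Φ' x ^ 2) ≤ Cb * B := by
        linarith
      calc _ = c * ((∫ x in Ioo (-R) R, Φ x ^ 2) + ∫ x in Ioo (-R) R, Φ' x ^ 2) / (2 * Cb) := by
            field_simp; ring
        _ ≤ Cb * B / (2 * Cb) := by gcongr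
        _ = B / 2 := by field_simp
    linarith
  have hmle : mass R w Φ Φ + mass R w Φ' Φ' ≤ Cb * AB * ε ^ 2 := by
    refine hsum.trans ?_
    rw [mul_assoc]
    gcongr
  have hGle : ∫ x in Ioo (-R) R, g x ^ 2 ≤ P := (le_abs_self _).trans
    (abs_integral_le_of_decay (F := fun x => g x ^ 2) (by positivity)
      (Eventually.of_forall fun x => by
        simp only [abs_pow]
        rw [sq]
        exact mul_le_of_decay (hd1 x) (hd1 x) hK₀.le))
  have hG₁le : ∫ x in Ioo (-R) R, g₁ x ^ 2 ≤ P := (le_abs_self _).trans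
    (abs_integral_le_of_decay (F := fun x => g₁ x ^ 2) (by positivity)
      (Eventually.of_forall fun x => by
        simp only [abs_pow]
        rw [sq]
        exact mul_le_of_decay (hd2 x) (hd2 x) hK₀.le))
  have hGge : G₁ ≤ ∫ x in Ioo (-R) R, g x ^ 2 :=
    setIntegral_mono_set hgL.integrable_sq (Eventually.of_forall fun x => sq_nonneg _)
      (Ioo_subset_Ioo (neg_le_neg hc.one_le) hc.one_le).eventuallyLE
  have hmgg := hc.const_mul_integral_sq_le H.le_weight hgL
  have hmgg' := hc.mass_le_of_le H.weight_le hgL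
  have hmgg₁ := hc.mass_le_of_le H.weight_le hg.memLp
  set G := ∫ x in Ioo (-R) R, g x ^ 2 with hG
  have hG0 : 0 < G := hG₁.trans_le hGge
  have hasq : g₀ / 2 ≤ a ^ 2 := by
    have h1 : g₀ ≤ c * G := by rw [hg₀]; gcongr
    have h2 : Cb * AB * ε ^ 2 ≤ g₀ / 2 := by
      refine le_trans ?_ (by linarith : ε * (Cb * AB) ≤ g₀ / 2)
      rw [mul_comm ε]; gcongr
    linarith
  -- The sign comes from e ≥ 0 and θ₀' > 0; without it e might be close to the negative of the
  -- explicit multiple of g.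
  have ha0 : 0 < a := by
    have h1 : 0 ≤ a := setIntegral_nonneg measurableSet_Ioo fun x hx =>
      mul_nonneg (mul_nonneg (hθ.deriv_pos hf x).le (hepos x (Ioo_subset_Icc_self hx)))
        (hc.pos x (Ioo_subset_Icc_self hx)).le
    refine lt_of_le_of_ne h1 fun h2 => ?_
    rw [← h2] at hasq
    linarith
  have hlam₁ : |lam₁| ≤ 2 * (A₁ + AB) / g₀ * ε ^ 2 := by
    have h1 : |a ^ 2 * lam₁| ≤ (A₁ + AB) * ε ^ 2 := by
      have e1 : a ^ 2 * lam₁ = energy R w V g g₁ g g₁ - B := by linarith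
      rw [e1]
      refine (abs_sub _ _).trans ?_
      rw [abs_of_nonneg hB0]
      linarith
    rw [abs_mul, abs_of_pos (pow_pos ha0 2)] at h1
    have h2 : g₀ / 2 * |lam₁| ≤ (A₁ + AB) * ε ^ 2 :=
      (mul_le_mul_of_nonneg_right hasq (abs_nonneg _)).trans h1
    rw [div_mul_eq_mul_div, le_div_iff₀ hg₀0]
    linarith
  have hj0 : 0 < j := hc0.trans_le H.le_center
  have hA₂0 : 0 ≤ A₂ := by positivity
  refine ⟨hlam₁.trans (by gcongr; linarith), ?_⟩
  intro b hb'
  have hsj : 0 < √(j * G) := Real.sqrt_pos.2 (by positivity)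
  have hbinv : b = (√(j * G))⁻¹ := by rw [hb', Real.sqrt_mul hj0.le, mul_inv]
  -- Two errors: replacing the weight by J(0) in the mass of g costs 2 K P ε, and the mass of Φ
  -- costs Cb AB ε².
  have hdiff : |√(j * G) ^ 2 - a ^ 2| ≤ D * ε := by
    rw [Real.sq_sqrt (by positivity)]
    have e1 : mass R w g g - j * G = ∫ x in Ioo (-R) R, (w x - j) * (g x * g x) := by
      rw [mass, hG, ← integral_const_mul, ← integral_sub (hc.integrable_mass hgL hgL)
        (hgL.integrable_sq.const_mul j)]
      exact integral_congr_ae (Eventually.of_forall fun x => by simp only; ring)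
    have h1 : |mass R w g g - j * G| ≤ 2 * K * P * ε := by
      rw [e1]
      refine (abs_integral_le_of_decay (F := fun x => (w x - j) * (g x * g x))
        (A := K * ε * (2 * K₀ ^ 2)) (by positivity) ?_).trans (le_of_eq (by rw [hP]; ring))
      filter_upwards [ae_restrict_mem measurableSet_Ioo] with x hx
      rw [abs_mul, abs_mul]
      calc _ ≤ K * ε * (1 + |x|) * (|g x| * |g x|) := by
            gcongr; exact H.weight_sub x (Ioo_subset_Icc_self hx)
        _ = K * ε * ((1 + |x|) * (|g x| * |g x|)) := by ring
        _ ≤ K * ε * (2 * K₀ ^ 2 * (1 + x ^ 2)⁻¹) := by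
            gcongr ?_ * ?_
            exact one_add_abs_mul_mul_le (hd1 x) (hd1 x) hK₀.le
        _ = _ := by ring
    have h2 : Cb * AB * ε ^ 2 ≤ Cb * AB * ε := by gcongr
    have h3 : D * ε = 2 * K * P * ε + Cb * AB * ε := by rw [hD]; ring
    have h4 := abs_le.1 h1
    rw [abs_le]
    constructor <;> linarith
  have hcoef : (a⁻¹ - b) ^ 2 ≤ D ^ 2 / (g₀ / 2 * g₀ ^ 2) * ε ^ 2 := by
    rw [hbinv]
    have hbsq : g₀ ≤ √(j * G) ^ 2 := by
      rw [Real.sq_sqrt (by positivity), hg₀]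
      exact mul_le_mul H.le_center hGge hG₁.le hj0.le
    set β := √(j * G)
    -- Dividing by a + β turns the bound for the squares into one for the inverses; both a and β are
    -- positive, so the denominator has a lower bound.
    have e1 : (a⁻¹ - β⁻¹) ^ 2 = (β ^ 2 - a ^ 2) ^ 2 / (a ^ 2 * (β ^ 2 * (a + β) ^ 2)) := by
      field_simp; ring
    rw [e1, div_mul_eq_mul_div]
    have h1 : (β ^ 2 - a ^ 2) ^ 2 ≤ D ^ 2 * ε ^ 2 := by
      rw [← sq_abs, ← mul_pow]
      gcongr
    have h2 : g₀ / 2 * g₀ ^ 2 ≤ a ^ 2 * (β ^ 2 * (a + β) ^ 2) := by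
      rw [sq g₀]
      have : β ^ 2 ≤ (a + β) ^ 2 := by gcongr; linarith
      gcongr
      linarith
    gcongr
  have hainv : a⁻¹ ^ 2 ≤ 2 / g₀ := by
    rw [inv_pow, inv_le_comm₀ (by positivity) (by positivity), inv_div]
    exact hasq
  have hfin : ∀ y z : ℝ → ℝ, MemLp y 2 (volume.restrict (Ioo (-R) R)) →
      MemLp z 2 (volume.restrict (Ioo (-R) R)) → mass R w y y ≤ K * P →
      mass R w z z ≤ Cb * AB * ε ^ 2 →
      mass R w (fun x => (a⁻¹ - b) * y x + -a⁻¹ * z x) (fun x => (a⁻¹ - b) * y x + -a⁻¹ * z x)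
        ≤ A₂ * ε ^ 2 := by
    intro y z hy hz h1 h2
    refine (hc.mass_combination_le hy hz _ _).trans ?_
    rw [neg_sq]
    have h3 := hc.mass_self_nonneg y
    have h4 := hc.mass_self_nonneg z
    calc _ ≤ 2 * (D ^ 2 / (g₀ / 2 * g₀ ^ 2) * ε ^ 2) * (K * P)
          + 2 * (2 / g₀) * (Cb * AB * ε ^ 2) := by gcongr
      _ = _ := by rw [hA₂]; ring
  have hA₂le : A₂ * ε ^ 2 ≤ (2 * (A₁ + AB) / g₀ + A₂) * ε ^ 2 := by
    gcongr
    have : 0 ≤ 2 * (A₁ + AB) / g₀ := by positivity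
    linarith
  -- Solving g = a e + Φ for e leaves two terms, both O(ε).
  have r1 : (fun x => e x - b * g x) = fun x => (a⁻¹ - b) * g x + -a⁻¹ * Φ x := by
    funext x; simp only [hΦdef]; field_simp; ring
  have r2 : (fun x => e' x - b * deriv f (θ x))
      = fun x => (a⁻¹ - b) * g₁ x + -a⁻¹ * Φ' x := by
    funext x; simp only [hΦ'def, hg₁def]; field_simp; ring
  rw [r1, r2]
  exact ⟨(hfin _ _ hgL hΦL (hmgg'.trans (by gcongr)) (by linarith)).trans hA₂le,
    (hfin _ _ hg.memLp hΦ.memLp (hmgg₁.trans (by gcongr)) (by linarith)).trans hA₂le⟩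

end FirstEigenvalue

end AllenCahn

theorem theorem5p8 {𝕜 : Type*} [RCLike 𝕜] (f θ₀ : ℝ → ℝ)
    (hf : IsDoubleWell f) (hθ₀ : IsOptimalProfile f θ₀) :
    (∃ ν₁ : ℝ, IsUnperturbedGap 𝕜 f θ₀ ν₁) ∧
    ∀ ν₁ : ℝ, IsUnperturbedGap 𝕜 f θ₀ ν₁ →
    ∀ δ' C₀ c₁ C₂ C₃ C₄ : ℝ, 0 < δ' → 0 < C₀ → 0 < c₁ → 0 < C₂ → 0 < C₃ → 0 < C₄ →
    ∃ C : ℝ, 0 < C ∧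
    ∀ δ : ℝ, 0 < δ → δ' ≤ 3 * δ / 4 →
    ∃ ε₀ : ℝ, 0 < ε₀ ∧
    ∀ J θ₁ : ℝ → ℝ,
      C2Bounded δ C₂ J → (∀ r ∈ Icc (-δ) δ, c₁ ≤ J r) →
      MemLp θ₁ ∞ volume → eLpNorm θ₁ ∞ volume ≤ ENNReal.ofReal C₄ →
      ∫ z, iteratedDeriv 3 f (θ₀ z) * (deriv θ₀ z) ^ 2 * θ₁ z = 0 →
    ∀ ε ∈ Ioc 0 ε₀,
    ∀ (h : ℝ → ℝ) (p : ℝ) (q : ℝ → ℝ),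
      C2Bounded δ C₀ h →
      AEMeasurable q (volume.restrict (Icc (-δ) δ)) →
      (∀ r ∈ Icc (-δ) δ, |p| + ε / (ε + |r|) * |q r| ≤ C₃) →
    ∀ (R : ℝ) (w V : ℝ → ℝ),
      R = δ' / ε → w = JEps δ ε h J →
      V = (fun z => iteratedDeriv 2 f (phiEps θ₀ θ₁ ε p q (ε * z))) →
    ∃ lam₁ lam₂ : ℝ,
      IsNthEigenvalue 𝕜 R w V 1 lam₁ ∧ IsNthEigenvalue 𝕜 R w V 2 lam₂ ∧
      (∃ Ψ₁ : ℝ → 𝕜, IsNormalizedEigenfunction R w V lam₁ Ψ₁ ∧ IsPositiveOn R Ψ₁) ∧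
      ∀ Ψ₁ : ℝ → 𝕜, IsNormalizedEigenfunction R w V lam₁ Ψ₁ → IsPositiveOn R Ψ₁ →
        -- part 1
        (IsGLB {b : ℝ | ∃ Ψ : ℝ → 𝕜, MemH1 (Ioo (-R) R) Ψ ∧ wNorm R w Ψ = 1 ∧
            b = RCLike.re (wForm R w V Ψ Ψ)} lam₁ ∧
          wForm R w V Ψ₁ Ψ₁ = (lam₁ : 𝕜) ∧
          |lam₁| ≤ C * ε ^ 2) ∧
        -- part 2
        (∀ (β : ℝ) (ΨR : ℝ → 𝕜),
          β = (√(∫ z in Ioo (-R) R, (deriv θ₀ z) ^ 2))⁻¹ →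
          ΨR = (fun z => Ψ₁ z - (((√(J 0))⁻¹ * β * deriv θ₀ z : ℝ) : 𝕜)) →
          wNorm R w ΨR + wNorm R w (weakDeriv (Ioo (-R) R) ΨR) ≤ C * ε) ∧
        -- part 3
        (IsGLB {b : ℝ | ∃ Ψ : ℝ → 𝕜, MemH1 (Ioo (-R) R) Ψ ∧ wNorm R w Ψ = 1 ∧
            wInner R w Ψ Ψ₁ = 0 ∧ b = RCLike.re (wForm R w V Ψ Ψ)} lam₂ ∧
          min (ν₁ / 2) (min (iteratedDeriv 2 f 1) (iteratedDeriv 2 f (-1)) / 4) ≤ lam₂ ∧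
          0 < min (ν₁ / 2) (min (iteratedDeriv 2 f 1) (iteratedDeriv 2 f (-1)) / 4)) := by
  refine ⟨hθ₀.exists_isUnperturbedGap hf, ?_⟩
  intro ν₁ hν₁ δ' C₀ c₁ C₂ C₃ C₄ hδ' hC₀ hc₁ hC₂ hC₃ hC₄
  have hκ : 0 < min (ν₁ / 2) (min (iteratedDeriv 2 f 1) (iteratedDeriv 2 f (-1)) / 4) :=
    lt_min (half_pos hν₁.1)
      (div_pos (lt_min hf.deriv2_one hf.deriv2_neg_one) (by norm_num))
  obtain ⟨K, hK, hpert⟩ := exists_profilePerturbation hf hθ₀ hδ' hC₀ hc₁ hC₂ hC₃ hC₄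
  obtain ⟨ε₂, hε₂, hsecond⟩ := exists_second_eigenvalue_bound hf hθ₀ hν₁ hc₁ hK hδ'
  obtain ⟨A, hA, ε₁, hε₁, hfirst⟩ := exists_first_eigenpair_bound hf hθ₀ hc₁ hK hκ hδ' hC₄
  -- A serves the eigenvalue; each of the two norms of the remainder is at most √A ε.
  refine ⟨A + 2 * √A, by positivity, fun δ hδ hδδ => ?_⟩
  obtain ⟨ε₃, hε₃, hpert⟩ := hpert δ hδ hδδ
  refine ⟨min ε₁ (min ε₂ ε₃), by positivity, ?_⟩
  intro J θ₁ hJ hJc hθ₁ hθ₁b horth ε hε h p q hh hq hqb R w V hR hw hV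
  obtain ⟨hε0, hεle⟩ := hε
  obtain ⟨hl1, hl2, hl3⟩ : ε ≤ ε₁ ∧ ε ≤ ε₂ ∧ ε ≤ ε₃ := by simpa only [le_min_iff] using hεle
  obtain ⟨w', γ, H⟩ := hpert J θ₁ hJ hJc hθ₁ hθ₁b ε ⟨hε0, hl3⟩ h p q hh hq hqb
  rw [← hw, ← hV] at H
  have hsec := hsecond ε ⟨hε0, hl2⟩ θ₁ p (J 0) γ w w' V H
  have hfir := hfirst ε ⟨hε0, hl1⟩ θ₁ p (J 0) γ w w' V hθ₁.aestronglyMeasurable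
    (ae_abs_le_of_eLpNorm_top_le hC₄.le hθ₁b) horth H
  rw [← hR] at H hsec hfir
  clear hpert hsecond hfirst
  have hc := H.coefficients
  obtain ⟨lam₁, e₀, e₀', lam₂, u₀, v₀, hb₀, hpos₀⟩ := hc.exists_eigenbasis
  refine ⟨lam₁, lam₂, hb₀.isNthEigenvalue_one hc, hb₀.isNthEigenvalue_two hc,
    ⟨fun x => (e₀ x : 𝕜), hb₀.first.isNormalizedEigenfunction hc hb₀.mass_first, ?_⟩, ?_⟩
  · filter_upwards [ae_restrict_mem measurableSet_Ioo] with x hx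
    rw [RCLike.ofReal_re, RCLike.ofReal_im]
    exact ⟨hpos₀ x (Ioo_subset_Icc_self hx), rfl⟩
  intro Ψ₁ hΨ₁ hΨ₁pos
  -- The eigenfunction Ψ₁ is arbitrary, so a new eigenbasis is built on it; the two second
  -- eigenvalues agree because each is the least element of the same set.
  obtain ⟨e, e', lam₂', u, v, hb, he0, hrep, hae⟩ :=
    hc.exists_eigenbasis_of_positive (hb₀.isNthEigenvalue_one hc) hΨ₁ hΨ₁pos
  obtain rfl : lam₂ = lam₂' :=
    (hb₀.isNthEigenvalue_two (𝕜 := 𝕜) hc).unique (hb.isNthEigenvalue_two hc)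
  have hlam₂ := hsec _ _ _ _ _ _ hb
  obtain ⟨hlam₁, hrem⟩ := hfir _ _ _ _ _ _ hb he0 hlam₂
  have hsA : 0 ≤ √A := Real.sqrt_nonneg A
  have he := hb.first.sobolevPair hc
  have hg := hθ₀.sobolevPair_deriv hf (by linarith [hc.one_le] : 0 ≤ R)
  refine ⟨⟨hb.isGLB_one hc, ?_, hlam₁.trans (by gcongr; linarith)⟩, ?_,
    hb.isGLB_two hc hae, hlam₂, hκ⟩
  · rw [hrep.wForm_eq hc, energy_zero, add_zero, hb.first.energy_eq hc he, hb.mass_first, mul_one]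
  · intro β ΨR hβ hΨR
    obtain ⟨hm1, hm2⟩ := hrem _ rfl
    rw [← hβ] at hm1 hm2
    obtain ⟨-, hrepR, -⟩ := (he.sub (hg.const_mul ((√(J 0))⁻¹ * β))).memH1_of_real hc.neg_le
      (Ψ := ΨR) (by
        filter_upwards [hae] with x hx
        simp only [hΨR, hx, RCLike.ofReal_sub])
    rw [hrepR.wNorm_eq hc, hrepR.wNorm_weakDeriv_eq hc, mass_zero, add_zero, add_zero]
    have hsq : √(A * ε ^ 2) = √A * ε := by rw [Real.sqrt_mul hA.le, Real.sqrt_sq hε0.le]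
    have k1 := Real.sqrt_le_sqrt hm1
    have k2 := Real.sqrt_le_sqrt hm2
    rw [hsq] at k1 k2
    have k3 : 0 ≤ A * ε := by positivity
    linarith
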